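/- Let $N\ge 2$ and let $\mathbb B^N=\{x\in\mathbb R^N:|x|<1\}$ be the Poincaré ball. Put $\rho(x)=\frac{2}{1-|x|^2}$, $d(x)=\log\frac{1+|x|}{1-|x|}$, $dV=\rho^N\,dx$, $\nabla_{\mathbb B^N}u=\rho^{-1}\nabla u$ and $$\Delta^{\alpha}_{\mathbb B^N}u=\rho^{-N}\,\nabla\cdot\big(\rho^{N-2}d^{\alpha}\nabla u\big),$$ where $\nabla$, $\nabla\cdot$ are the Euclidean gradient and divergence. Let $\alpha,\beta\in\mathbb R$ with $\alpha-2>-N$ and let $p>1$. Let $\Omega$ be an open set with $C^1$ boundary (locally on one side of it), with $\overline\Omega\subset\mathbb B^N$ and $0\notin\partial\Omega$; let $\nu$ be its outward (Euclidean) unit normal and $\sigma$ the Euclidean surface measure on $\partial\Omega$. Let $u\in C^2(\Omega\setminus\{0\})\cap C^1(\overline\Omega\setminus\{0\})$ have finite energy $\int_\Omega d^\alpha|\nabla_{\mathbb B^N}u|^2\,dV<\infty$ and solve $$-\Delta^{\alpha}_{\mathbb B^N}u=d^{\beta}|u|^{p-2}u\ \text{ in }\Omega\setminus\{0\},\qquad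 u=0\ \text{ on }\partial\Omega .$$ Then all integrands below are integrable and $$-\frac12\int_{\partial\Omega}d^{\alpha}\rho^{N-2}|\nabla u|^2\,(x\cdot\nu)\,d\sigma =\int_{\Omega}d^{\alpha}|\nabla_{\mathbb B^N}u|^2\left(-1+\frac{\nabla\cdot(d^\alpha\rho^{N-2}x)}{2d^{\alpha}\rho^{N-2}}-\frac{\nabla\cdot(d^{\beta}\rho^{N}x)}{p\,d^{\beta}\rho^{N}}\right)dV +\frac{1}{2p}\int_{\Omega}u^2\,\Delta^{\alpha}_{\mathbb B^N}\!\left(\frac{\nabla\cdot(d^\beta\rho^{N}x)}{d^\beta\rho^{N}}\right)dV .$$ -/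

import Mathlib

open MeasureTheory Set Filter Topology

noncomputable section

namespace HypPohozaev

/-- Euclidean space `ℝ^N`; the Poincaré ball is its open unit ball. -/
abbrev E (N : ℕ) : Type := EuclideanSpace ℝ (Fin N)

variable {N : ℕ}

/-- The conformal factor `ρ(x) = 2 / (1 - |x|²)` of the Poincaré ball metric `ρ² δ_ij`. -/
def rho (x : E N) : ℝ := 2 / (1 - ‖x‖ ^ 2)

/-- The hyperbolic distance `d(x) = log ((1 + |x|) / (1 - |x|))` from the origin. -/
def dist0 (x : E N) : ℝ := Real.log ((1 + ‖x‖) / (1 - ‖x‖))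

/-- The hyperbolic volume `dV = ρ^N dx` (only used on subsets of the unit ball). -/
def hypVolume (N : ℕ) : Measure (E N) :=
  volume.withDensity fun x => ENNReal.ofReal (rho x ^ N)

/-- The Euclidean divergence `∑ᵢ ∂ᵢ Fᵢ`. -/
def divergence (F : E N → E N) (x : E N) : ℝ :=
  ∑ i : Fin N, fderiv ℝ (fun y => F y i) x (EuclideanSpace.single i 1)

/-- The hyperbolic gradient `ρ⁻¹ ∇u`. -/
def hypGradient (u : E N → ℝ) (x : E N) : E N := (rho x)⁻¹ • gradient u x

/-- The weighted Laplace–Beltrami operator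
`Δ_B^α u = ρ^{-N} ∑ᵢ ∂ᵢ (ρ^{N-2} d^α ∂ᵢ u)` (used for `N ≥ 2`). -/
def hypLaplacian (α : ℝ) (u : E N → ℝ) (x : E N) : ℝ :=
  (rho x ^ N)⁻¹ *
    divergence (fun y => (rho y ^ (N - 2) * dist0 y ^ α) • gradient u y) x

/-- The logarithmic divergence `∇·(d^γ ρ^k x) / (d^γ ρ^k)`. -/
def logDiv (γ : ℝ) (k : ℕ) (x : E N) : ℝ :=
  divergence (fun y => (dist0 y ^ γ * rho y ^ k) • y) x / (dist0 x ^ γ * rho x ^ k)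

/-- Near `x₀`, the set `Ω` is the sublevel set `{φ < 0}` of a `C¹` function with
non-vanishing gradient at `x₀`. -/
def IsLocalDefiningFunction (Ω : Set (E N)) (x₀ : E N) (φ : E N → ℝ) : Prop :=
  ContDiffAt ℝ 1 φ x₀ ∧ gradient φ x₀ ≠ 0 ∧ ∀ᶠ x in 𝓝 x₀, (x ∈ Ω ↔ φ x < 0)

/-- The boundary of `Ω` is of class `C¹`, with `Ω` locally on one side of it. -/
def HasC1Boundary (Ω : Set (E N)) : Prop :=
  ∀ x₀ ∈ frontier Ω, ∃ φ : E N → ℝ, IsLocalDefiningFunction Ω x₀ φ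

open Classical in
/-- The outward unit normal `∇φ / |∇φ|` at a boundary point, where `φ` is a local defining
function (the value does not depend on which one). -/
def outwardNormal (Ω : Set (E N)) (x : E N) : E N :=
  if h : ∃ φ : E N → ℝ, IsLocalDefiningFunction Ω x φ then
    ‖gradient h.choose x‖⁻¹ • gradient h.choose x
  else 0

/-- Solutions of `-Δ_B^α u = d^β |u|^{p-2} u` in `Ω`, `u = 0` on `∂Ω`: finite weighted energy,
`C²` in `Ω ∖ {0}` and `C¹` up to the boundary away from the origin. No regularity is imposed at
the origin, where the weights are singular or degenerate. -/
structure IsSolution (Ω : Set (E N)) (α β p : ℝ) (u : E N → ℝ) : Prop where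
  contDiffOn_interior : ContDiffOn ℝ 2 u (Ω \ {0})
  contDiffOn_closure : ContDiffOn ℝ 1 u (closure Ω \ {0})
  finite_energy :
    IntegrableOn (fun x => dist0 x ^ α * ‖hypGradient u x‖ ^ 2) Ω (hypVolume N)
  equation : ∀ x ∈ Ω, x ≠ 0 →
    -hypLaplacian α u x = dist0 x ^ β * (|u x| ^ (p - 2) * u x)
  boundary : ∀ x ∈ frontier Ω, u x = 0

/-- The integrand `d^α ρ^{N-2} |∇u|² (x·ν)` on `∂Ω`; on the boundary `∇u` is the gradient of
`u` relative to `closure Ω`. -/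
def boundaryIntegrand (Ω : Set (E N)) (α : ℝ) (u : E N → ℝ) (x : E N) : ℝ :=
  dist0 x ^ α * rho x ^ (N - 2) * ‖gradientWithin u (closure Ω) x‖ ^ 2 *
    inner ℝ x (outwardNormal Ω x)

/-- The integrand of the gradient term. -/
def gradientIntegrand (α β p : ℝ) (u : E N → ℝ) (x : E N) : ℝ :=
  dist0 x ^ α * ‖hypGradient u x‖ ^ 2 *
    (-1 + logDiv α (N - 2) x / 2 - logDiv β N x / p)

/-- The integrand of the zeroth-order term. -/
def zeroOrderIntegrand (α β : ℝ) (u : E N → ℝ) (x : E N) : ℝ :=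
  u x ^ 2 * hypLaplacian α (logDiv β N) x

end HypPohozaev

end

noncomputable section

namespace HypPohozaev

variable {N n : ℕ}

/-! ### The Euclidean divergence -/

/-! Write w = d^α ρ^(N-2), v = d^β ρ^N and f = ∇·(v x)/v. The identity is the divergence theorem for
a single field, `pohozaevField`: the classical multiplier field (x·∇u) w∇u - ½|∇u|² w x, plus
(1/p)|u|^p v x, plus (1/p) f u w∇u, minus (1/2p) u² w∇f. The equation reads ∇·(w∇u) = -v|u|^(p-2)u.
Hence the |u|^p field cancels the nonlinear term of the multiplier field and leaves (1/p) f v|u|^p;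
the next field trades this for (1/p) f w|∇u|² and a cross term in u ∇f·∇u; the last one trades the
cross term for u² ∇·(w∇f). What remains is, up to sign, the volume integrand
(`divergence_pohozaevField`). On ∂Ω, where u = 0 and ∇u is normal, the flux is ½ w|∇u|²(x·ν)
(`inner_pohozaevField_of_normal`).

The origin. Nothing is assumed on u there, so the divergence theorem is applied with radial cutoffs
whose gradient is at most C/|x|; the cutoff error disappears once |F|/|x| is integrable
(`integral_divergence_eq_of_punctured`). This quotient is controlled by w|∇u|², v|u|^p and w u²/|x|²
(`exists_norm_pohozaevField_le`). The first is the energy. The third is a Hardy inequality, for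
which α - 2 > -N is exactly the condition on the exponent (`integrableOn_hardy`). The second follows
by testing the equation with u itself (`integrableOn_potential`), so neither p nor β needs a growth
restriction.

The divergence theorem. Surface measure is normalised Hausdorff measure, and no area formula is
used. Near a boundary point Ω lies below a graph of slope at most δ. There the flux is computed
exactly in the hyperplane variable (`integral_divergence_subgraph`), while the graph map is
bi-Lipschitz with constants 1 and 1 + δ, so surface measure and hyperplane measure agree up to a
factor (1 + δ)^n. The theorem thus holds locally with a small relative error; a partition of unity
adds the errors to ε ∫|F| over ∂Ω, and ε tends to 0 (`integral_divergence_eq`). -/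

theorem inner_gradient_left {u : E N → ℝ} (x v : E N) :
    inner ℝ (gradient u x) v = fderiv ℝ u x v :=
  InnerProductSpace.toDual_symm_apply

theorem inner_gradientWithin_left {u : E N → ℝ} {s : Set (E N)} (x v : E N) :
    inner ℝ (gradientWithin u s x) v = fderivWithin ℝ u s x v :=
  InnerProductSpace.toDual_symm_apply

theorem fderiv_apply_coord {F : E N → E N} {x : E N} (hF : DifferentiableAt ℝ F x) (i : Fin N)
    (v : E N) : fderiv ℝ (fun y => F y i) x v = fderiv ℝ F x v i := by
  have h := ((EuclideanSpace.proj (𝕜 := ℝ) i).hasFDerivAt.comp x hF.hasFDerivAt).fderiv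
  exact congrArg (fun A => A v) h

/-- The trace does not depend on the basis, which permits computing the divergence in a frame
adapted to the boundary. -/
theorem divergence_eq_trace {F : E N → E N} {x : E N} (hF : DifferentiableAt ℝ F x) :
    divergence F x = LinearMap.trace ℝ (E N) (fderiv ℝ F x).toLinearMap := by
  rw [LinearMap.trace_eq_sum_inner _ (EuclideanSpace.basisFun (Fin N) ℝ)]
  refine Finset.sum_congr rfl fun i _ => ?_
  rw [fderiv_apply_coord hF]
  simp [EuclideanSpace.inner_single_left]

theorem divergence_eq_sum_inner {ι : Type*} [Fintype ι] (b : OrthonormalBasis ι ℝ (E N))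
    {F : E N → E N} {x : E N} (hF : DifferentiableAt ℝ F x) :
    divergence F x = ∑ i, inner ℝ (b i) (fderiv ℝ F x (b i)) := by
  rw [divergence_eq_trace hF, LinearMap.trace_eq_sum_inner _ b]
  rfl

theorem divergence_congr {F G : E N → E N} {x : E N} (h : F =ᶠ[𝓝 x] G) :
    divergence F x = divergence G x := by
  refine Finset.sum_congr rfl fun i _ => ?_
  have : (fun y => F y i) =ᶠ[𝓝 x] fun y => G y i := h.mono fun y hy => by simp [hy]
  rw [this.fderiv_eq]

theorem divergence_add {F G : E N → E N} {x : E N} (hF : DifferentiableAt ℝ F x)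
    (hG : DifferentiableAt ℝ G x) :
    divergence (fun y => F y + G y) x = divergence F x + divergence G x := by
  rw [divergence_eq_trace hF, divergence_eq_trace hG,
    divergence_eq_trace (hF.fun_add hG), fderiv_fun_add hF hG]
  simp

theorem divergence_sum {ι : Type*} (s : Finset ι) {F : ι → E N → E N} {x : E N}
    (hF : ∀ i ∈ s, DifferentiableAt ℝ (F i) x) :
    divergence (fun y => ∑ i ∈ s, F i y) x = ∑ i ∈ s, divergence (F i) x := by
  rw [divergence_eq_trace (DifferentiableAt.fun_sum hF), fderiv_fun_sum hF]
  simp only [ContinuousLinearMap.toLinearMap_sum, map_sum]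
  exact Finset.sum_congr rfl fun i hi => (divergence_eq_trace (hF i hi)).symm

theorem divergence_const_smul (c : ℝ) {F : E N → E N} {x : E N} (hF : DifferentiableAt ℝ F x) :
    divergence (fun y => c • F y) x = c * divergence F x := by
  rw [divergence_eq_trace hF, divergence_eq_trace (hF.fun_const_smul c), fderiv_fun_const_smul hF]
  simp

theorem divergence_smul {g : E N → ℝ} {F : E N → E N} {x : E N} (hg : DifferentiableAt ℝ g x)
    (hF : DifferentiableAt ℝ F x) :
    divergence (fun y => g y • F y) x =
      g x * divergence F x + inner ℝ (gradient g x) (F x) := by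
  rw [divergence_eq_sum_inner (EuclideanSpace.basisFun (Fin N) ℝ) hF,
    divergence_eq_sum_inner (EuclideanSpace.basisFun (Fin N) ℝ) (hg.fun_smul hF),
    fderiv_fun_smul hg hF, inner_gradient_left, Finset.mul_sum]
  have : F x = ∑ i, (F x i) • EuclideanSpace.basisFun (Fin N) ℝ i := by
    simpa using ((EuclideanSpace.basisFun (Fin N) ℝ).sum_repr (F x)).symm
  conv_rhs => rw [this, map_sum]
  rw [← Finset.sum_add_distrib]
  refine Finset.sum_congr rfl fun i _ => ?_
  simp [inner_add_right, inner_smul_right, EuclideanSpace.inner_single_left]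
  ring

theorem divergence_id (x : E N) : divergence (fun y : E N => y) x = N := by
  rw [divergence_eq_trace differentiableAt_fun_id, fderiv_fun_id]
  have : ((ContinuousLinearMap.id ℝ (E N) : E N →L[ℝ] E N) : E N →ₗ[ℝ] E N) = LinearMap.id := rfl
  rw [this, LinearMap.trace_id]
  simp

theorem continuousOn_divergence {F : E N → E N} {s : Set (E N)} (hs : IsOpen s)
    (hF : ContDiffOn ℝ 1 F s) : ContinuousOn (divergence F) s := by
  have h := hF.continuousOn_fderiv_of_isOpen hs le_rfl
  refine continuousOn_finsetSum _ fun i _ => ?_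
  have h2 : ContinuousOn (fun x => fderiv ℝ F x (EuclideanSpace.single i 1) i) s :=
    (EuclideanSpace.proj (𝕜 := ℝ) i).continuous.comp_continuousOn (h.clm_apply continuousOn_const)
  refine h2.congr fun x hx => ?_
  exact fderiv_apply_coord ((hF.contDiffAt (hs.mem_nhds hx)).differentiableAt one_ne_zero) _ _

theorem divergence_eq_zero_of_notMem_tsupport {F : E N → E N} {x : E N} (hx : x ∉ tsupport F) :
    divergence F x = 0 := by
  rw [divergence_congr (notMem_tsupport_iff_eventuallyEq.1 hx)]
  simp [divergence]

theorem integrable_fderiv_apply {g : E N → ℝ} (hg : ContDiff ℝ 1 g) (hc : HasCompactSupport g)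
    (v : E N) : Integrable (fun x => fderiv ℝ g x v) :=
  ((hg.continuous_fderiv one_ne_zero).clm_apply continuous_const).integrable_of_hasCompactSupport
    (hc.fderiv_apply (𝕜 := ℝ) v)

theorem integral_fderiv_apply_eq_zero {g : E N → ℝ} (hg : ContDiff ℝ 1 g)
    (hc : HasCompactSupport g) (v : E N) : ∫ x, fderiv ℝ g x v = 0 := by
  have h := integral_mul_fderiv_eq_neg_fderiv_mul_of_integrable (μ := (volume : Measure (E N)))
    (f := fun _ => (1 : ℝ)) (g := g) (v := v) (by simp)
    (by simpa using integrable_fderiv_apply hg hc v)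
    (by simpa using hg.continuous.integrable_of_hasCompactSupport hc)
    (fun x _ => differentiableAt_const _) (fun x _ => hg.differentiable one_ne_zero x)
  simpa using h

/-- The divergence of a compactly supported `C¹` field has zero integral. -/
theorem integral_divergence_eq_zero {F : E N → E N} (hF : ContDiff ℝ 1 F)
    (hc : HasCompactSupport F) : Integrable (divergence F) ∧ ∫ x, divergence F x = 0 := by
  have hFcoord : ∀ i : Fin N, ContDiff ℝ 1 fun y => F y i := fun i =>
    (EuclideanSpace.proj (𝕜 := ℝ) i).contDiff.comp hF
  have hcoord : ∀ i : Fin N, HasCompactSupport fun y => F y i := fun i =>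
    hc.comp_left (g := fun v : E N => v i) rfl
  constructor
  · exact integrable_finsetSum _ fun i _ => integrable_fderiv_apply (hFcoord i) (hcoord i) _
  · unfold divergence
    rw [integral_finsetSum _ fun i _ => integrable_fderiv_apply (hFcoord i) (hcoord i) _]
    exact Finset.sum_eq_zero fun i _ => integral_fderiv_apply_eq_zero (hFcoord i) (hcoord i) _

/-! ### Graph coordinates -/

/-- A linear isometric splitting of `ℝ^(n+1)` into a hyperplane and a line. -/
abbrev Frame (n : ℕ) : Type := WithLp 2 (E n × ℝ) ≃ₗᵢ[ℝ] E (n + 1)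

theorem exists_frame (e : E (n + 1)) (he : ‖e‖ = 1) :
    ∃ M : Frame n, M (WithLp.toLp 2 (0, 1)) = e := by
  classical
  have hcard : Module.finrank ℝ (E (n + 1)) = Fintype.card (Fin n ⊕ Unit) := by simp
  have hon : Orthonormal ℝ (({Sum.inr ()} : Set (Fin n ⊕ Unit)).domRestrict fun _ => e) := by
    rw [orthonormal_iff_ite]
    rintro ⟨i, hi⟩ ⟨j, hj⟩
    simp only [mem_singleton_iff] at hi hj
    subst hi hj
    simp [Set.domRestrict, he]
  obtain ⟨b, hb⟩ := hon.exists_orthonormalBasis_extension_of_card_eq hcard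
  let c : OrthonormalBasis (Fin n ⊕ Unit) ℝ (WithLp 2 (E n × ℝ)) :=
    (EuclideanSpace.basisFun (Fin n) ℝ).prod (OrthonormalBasis.singleton Unit ℝ)
  refine ⟨c.equiv b (Equiv.refl _), ?_⟩
  have hc : c (Sum.inr ()) = WithLp.toLp 2 (0, 1) := by
    simp [c]
  rw [← hc, OrthonormalBasis.equiv_apply_basis]
  exact hb _ rfl

/-- The chart `(y, t) ↦ x₀ + M (y, γ y + t)` straightening the graph of `γ`. -/
def graphChart (M : Frame n) (x₀ : E (n + 1)) (γ : E n → ℝ) (q : E n × ℝ) : E (n + 1) :=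
  x₀ + M (WithLp.toLp 2 (q.1, γ q.1 + q.2))

/-- The inverse of `graphChart`. -/
def graphCoord (M : Frame n) (x₀ : E (n + 1)) (γ : E n → ℝ) (x : E (n + 1)) : E n × ℝ :=
  ((M.symm (x - x₀)).fst, (M.symm (x - x₀)).snd - γ (M.symm (x - x₀)).fst)

theorem graphCoord_graphChart (M : Frame n) (x₀ : E (n + 1)) (γ : E n → ℝ) (q : E n × ℝ) :
    graphCoord M x₀ γ (graphChart M x₀ γ q) = q := by
  simp [graphCoord, graphChart]

theorem graphChart_graphCoord (M : Frame n) (x₀ : E (n + 1)) (γ : E n → ℝ) (x : E (n + 1)) :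
    graphChart M x₀ γ (graphCoord M x₀ γ x) = x := by
  have h : WithLp.toLp 2 ((M.symm (x - x₀)).fst, (M.symm (x - x₀)).snd) = M.symm (x - x₀) := rfl
  simp only [graphCoord, graphChart, add_sub_cancel]
  rw [h, LinearIsometryEquiv.apply_symm_apply, add_sub_cancel]

theorem contDiff_graphChart (M : Frame n) (x₀ : E (n + 1)) {γ : E n → ℝ} (hγ : ContDiff ℝ 1 γ) :
    ContDiff ℝ 1 (graphChart M x₀ γ) := by
  refine contDiff_const.add (M.toContinuousLinearEquiv.contDiff.comp ?_)
  refine (WithLp.prodContinuousLinearEquiv 2 ℝ (E n) ℝ).symm.contDiff.comp ?_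
  fun_prop

theorem contDiff_graphCoord (M : Frame n) (x₀ : E (n + 1)) {γ : E n → ℝ} (hγ : ContDiff ℝ 1 γ) :
    ContDiff ℝ 1 (graphCoord M x₀ γ) := by
  have h : ContDiff ℝ 1 fun x : E (n + 1) =>
      WithLp.prodContinuousLinearEquiv 2 ℝ (E n) ℝ (M.symm (x - x₀)) := by
    refine (WithLp.prodContinuousLinearEquiv 2 ℝ (E n) ℝ).contDiff.comp ?_
    exact M.symm.toContinuousLinearEquiv.contDiff.comp (contDiff_id.sub contDiff_const)
  exact h.fst.prodMk (h.snd.sub (hγ.comp h.fst))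

/-- `graphChart` as a homeomorphism. -/
def graphHomeomorph (M : Frame n) (x₀ : E (n + 1)) {γ : E n → ℝ} (hγ : ContDiff ℝ 1 γ) :
    E n × ℝ ≃ₜ E (n + 1) where
  toFun := graphChart M x₀ γ
  invFun := graphCoord M x₀ γ
  left_inv := graphCoord_graphChart M x₀ γ
  right_inv := graphChart_graphCoord M x₀ γ
  continuous_toFun := (contDiff_graphChart M x₀ hγ).continuous
  continuous_invFun := (contDiff_graphCoord M x₀ hγ).continuous

/-- The chart is a shear followed by an isometry and a translation, so no Jacobian appears. -/
theorem measurePreserving_graphChart (M : Frame n) (x₀ : E (n + 1)) {γ : E n → ℝ}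
    (hγ : ContDiff ℝ 1 γ) : MeasurePreserving (graphChart M x₀ γ) := by
  have h1 : MeasurePreserving (fun q : E n × ℝ => (q.1, γ q.1 + q.2)) :=
    (MeasurePreserving.id (volume : Measure (E n))).skew_product (g := fun y t => γ y + t)
      (by
        have := hγ.continuous
        exact (by fun_prop : Continuous fun q : E n × ℝ => γ q.1 + q.2).measurable)
      (ae_of_all _ fun y => map_add_left_eq_self _ _)
  have h2 := (WithLp.volume_preserving_toLp (E n) ℝ).comp h1
  have h3 := (M.measurePreserving).comp h2
  exact (measurePreserving_add_left volume x₀).comp h3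

theorem hasFDerivAt_graphChart_left (M : Frame n) (x₀ : E (n + 1)) {γ : E n → ℝ}
    (hγ : ContDiff ℝ 1 γ) (y : E n) (t : ℝ) :
    ∃ A : E n →L[ℝ] E (n + 1), HasFDerivAt (fun y => graphChart M x₀ γ (y, t)) A y ∧
      ∀ h, A h = M (WithLp.toLp 2 (h, fderiv ℝ γ y h)) := by
  have h1 : HasFDerivAt (fun y : E n => (y, γ y + t))
      ((ContinuousLinearMap.id ℝ (E n)).prod (fderiv ℝ γ y)) y :=
    (hasFDerivAt_id y).prodMk ((hγ.differentiable one_ne_zero y).hasFDerivAt.add_const t)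
  have h2 := ((WithLp.prodContinuousLinearEquiv 2 ℝ (E n) ℝ).symm.hasFDerivAt.comp y h1)
  have h3 := (M.toContinuousLinearEquiv.hasFDerivAt.comp y h2).const_add x₀
  exact ⟨_, h3, fun h => rfl⟩

theorem hasDerivAt_graphChart_right (M : Frame n) (x₀ : E (n + 1)) (γ : E n → ℝ) (y : E n)
    (t : ℝ) : HasDerivAt (fun t => graphChart M x₀ γ (y, t)) (M (WithLp.toLp 2 (0, 1))) t := by
  have h : (fun t => graphChart M x₀ γ (y, t)) =
      fun t => graphChart M x₀ γ (y, 0) + t • M (WithLp.toLp 2 (0, 1)) := by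
    funext t
    simp only [graphChart, add_assoc]
    rw [← map_smul, ← map_add]
    congr 2
    rw [← WithLp.toLp_smul, ← WithLp.toLp_add]
    simp
  rw [h]
  simpa using ((hasDerivAt_id t).smul_const (M (WithLp.toLp 2 (0, 1)))).const_add
    (graphChart M x₀ γ (y, 0))

theorem inner_frame (M : Frame n) (a b : E n) (s t : ℝ) :
    inner ℝ (M (WithLp.toLp 2 (a, s))) (M (WithLp.toLp 2 (b, t))) = inner ℝ a b + s * t := by
  rw [LinearIsometryEquiv.inner_map_map]
  simp [WithLp.prod_inner_apply, mul_comm]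

/-- The (non-normalized) upward normal `(-∇γ, 1)` to the graph of `γ`. -/
def graphNormal (M : Frame n) (γ : E n → ℝ) (y : E n) : E (n + 1) :=
  M (WithLp.toLp 2 (-gradient γ y, 1))

/-- Moving along the hyperplane at fixed height t displaces the point by bⱼ + (∂ⱼγ) e. The slice
divergence therefore picks up the extra terms ∂ⱼγ ⟨bⱼ, DF e⟩; removing them from the full trace
pairs DF e with e - ∑ ∂ⱼγ bⱼ, the unnormalised normal. The first summand integrates to zero over a
slice and the second is a t-derivative. -/
theorem divergence_graphChart (M : Frame n) (x₀ : E (n + 1)) {γ : E n → ℝ}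
    (hγ : ContDiff ℝ 1 γ) {F : E (n + 1) → E (n + 1)} (y : E n) (t : ℝ)
    (hF : DifferentiableAt ℝ F (graphChart M x₀ γ (y, t))) :
    divergence F (graphChart M x₀ γ (y, t)) =
      divergence (fun z => (M.symm (F (graphChart M x₀ γ (z, t)))).fst) y +
        inner ℝ (fderiv ℝ F (graphChart M x₀ γ (y, t)) (M (WithLp.toLp 2 (0, 1))))
          (graphNormal M γ y) := by
  obtain ⟨A, hA, hA'⟩ := hasFDerivAt_graphChart_left M x₀ hγ y t
  set D := fderiv ℝ F (graphChart M x₀ γ (y, t)) with hD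
  have hK : HasFDerivAt (fun z => (M.symm (F (graphChart M x₀ γ (z, t)))).fst)
      (((ContinuousLinearMap.fst ℝ (E n) ℝ).comp
        (WithLp.prodContinuousLinearEquiv 2 ℝ (E n) ℝ).toContinuousLinearMap).comp
        (M.symm.toContinuousLinearEquiv.toContinuousLinearMap.comp (D.comp A))) y := by
    have h1 : HasFDerivAt (fun z => F (graphChart M x₀ γ (z, t))) (D.comp A) y :=
      HasFDerivAt.comp y (f := fun z => graphChart M x₀ γ (z, t)) hF.hasFDerivAt hA
    have h2 := (M.symm.toContinuousLinearEquiv.toContinuousLinearMap.hasFDerivAt.comp y h1)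
    exact (((ContinuousLinearMap.fst ℝ (E n) ℝ).comp
        (WithLp.prodContinuousLinearEquiv 2 ℝ (E n) ℝ).toContinuousLinearMap).hasFDerivAt.comp y h2)
  let b : OrthonormalBasis (Fin n ⊕ Unit) ℝ (E (n + 1)) :=
    ((EuclideanSpace.basisFun (Fin n) ℝ).prod (OrthonormalBasis.singleton Unit ℝ)).map M
  have hbl : ∀ j, b (Sum.inl j) = M (WithLp.toLp 2 (EuclideanSpace.single j 1, 0)) := by
    intro j; simp [b]
  have hbr : b (Sum.inr ()) = M (WithLp.toLp 2 (0, 1)) := by simp [b]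
  rw [divergence_eq_sum_inner b hF, Fintype.sum_sum_type,
    divergence_eq_sum_inner (EuclideanSpace.basisFun (Fin n) ℝ) hK.differentiableAt, hK.fderiv]
  simp only [Finset.univ_unique, PUnit.default_eq_unit, Finset.sum_singleton, hbl, hbr, ← hD]
  set e := M (WithLp.toLp 2 ((0 : E n), (1 : ℝ))) with he
  have hsplit : ∀ j : Fin n, A (EuclideanSpace.single j 1) =
      M (WithLp.toLp 2 (EuclideanSpace.single j 1, 0)) +
        (gradient γ y j) • e := by
    intro j
    rw [hA', he, ← map_smul, ← map_add, ← WithLp.toLp_smul, ← WithLp.toLp_add]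
    congr 2
    have : fderiv ℝ γ y (EuclideanSpace.single j 1) = gradient γ y j := by
      rw [← inner_gradient_left, EuclideanSpace.inner_single_right]; simp only [one_mul]; rfl
    simp [this]
  have hfst : ∀ (j : Fin n) (z : E (n + 1)), inner ℝ (EuclideanSpace.single j (1 : ℝ))
      (M.symm z).fst = inner ℝ (M (WithLp.toLp 2 (EuclideanSpace.single j 1, 0))) z := by
    intro j z
    obtain ⟨q, rfl⟩ := M.surjective z
    obtain ⟨a, s⟩ := q
    rw [inner_frame]; simp
  have hterm : ∀ j : Fin n, inner ℝ (EuclideanSpace.basisFun (Fin n) ℝ j)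
      ((((ContinuousLinearMap.fst ℝ (E n) ℝ).comp
        (WithLp.prodContinuousLinearEquiv 2 ℝ (E n) ℝ).toContinuousLinearMap).comp
        (M.symm.toContinuousLinearEquiv.toContinuousLinearMap.comp (D.comp A)))
          (EuclideanSpace.basisFun (Fin n) ℝ j)) =
      inner ℝ (M (WithLp.toLp 2 (EuclideanSpace.single j 1, 0)))
        (D (M (WithLp.toLp 2 (EuclideanSpace.single j 1, 0)))) +
      gradient γ y j * inner ℝ (M (WithLp.toLp 2 (EuclideanSpace.single j 1, 0))) (D e) := by
    intro j
    rw [EuclideanSpace.basisFun_apply]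
    change inner ℝ (EuclideanSpace.single j (1 : ℝ)) (M.symm (D (A _))).fst = _
    rw [hfst, hsplit, map_add, map_smul, inner_add_right, inner_smul_right]
  rw [Finset.sum_congr rfl fun j _ => hterm j, Finset.sum_add_distrib, add_assoc]
  congr 1
  obtain ⟨⟨a, s⟩, hq⟩ := M.surjective (D e)
  rw [← hq]
  simp only [graphNormal, he, inner_frame]
  simp only [EuclideanSpace.inner_single_left, inner_zero_left, inner_neg_right]
  rw [PiLp.inner_apply]
  simp [mul_comm]

/-! ### The divergence theorem below a graph -/

/-- The open region below the graph of `γ` in the frame `M` based at `x₀`. -/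
def subgraph (M : Frame n) (x₀ : E (n + 1)) (γ : E n → ℝ) : Set (E (n + 1)) :=
  {x | (graphCoord M x₀ γ x).2 < 0}

/-- The closed region below the graph of `γ` in the frame `M` based at `x₀`. -/
def closedSubgraph (M : Frame n) (x₀ : E (n + 1)) (γ : E n → ℝ) : Set (E (n + 1)) :=
  {x | (graphCoord M x₀ γ x).2 ≤ 0}

theorem graphChart_mem_subgraph {M : Frame n} {x₀ : E (n + 1)} {γ : E n → ℝ} {q : E n × ℝ} :
    graphChart M x₀ γ q ∈ subgraph M x₀ γ ↔ q.2 < 0 := by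
  simp [subgraph, graphCoord_graphChart]

theorem graphChart_mem_closedSubgraph {M : Frame n} {x₀ : E (n + 1)} {γ : E n → ℝ}
    {q : E n × ℝ} : graphChart M x₀ γ q ∈ closedSubgraph M x₀ γ ↔ q.2 ≤ 0 := by
  simp [closedSubgraph, graphCoord_graphChart]

theorem isOpen_subgraph (M : Frame n) (x₀ : E (n + 1)) {γ : E n → ℝ} (hγ : ContDiff ℝ 1 γ) :
    IsOpen (subgraph M x₀ γ) :=
  isOpen_lt (contDiff_graphCoord M x₀ hγ).continuous.snd continuous_const

theorem continuous_gradient {γ : E n → ℝ} (hγ : ContDiff ℝ 1 γ) : Continuous (gradient γ) :=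
  (InnerProductSpace.toDual ℝ (E n)).symm.continuous.comp (hγ.continuous_fderiv one_ne_zero)

theorem continuous_graphNormal (M : Frame n) {γ : E n → ℝ} (hγ : ContDiff ℝ 1 γ) :
    Continuous (graphNormal M γ) := by
  have := continuous_gradient hγ
  refine M.continuous.comp ((WithLp.prodContinuousLinearEquiv 2 ℝ (E n) ℝ).symm.continuous.comp ?_)
  fun_prop

/-- By Fubini, the integral is taken slice by slice. On the slice at height t the tangential
divergence integrates to zero, leaving the derivative of H(t) = ∫ F·ν dy; the fundamental theorem of
calculus on (-∞, 0] gives H(0). Since F is only continuous up to the graph, H is differentiated for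
t < 0 and merely continuous at 0. -/
theorem integral_divergence_subgraph (M : Frame n) (x₀ : E (n + 1)) {γ : E n → ℝ}
    (hγ : ContDiff ℝ 1 γ) {F : E (n + 1) → E (n + 1)} (hc : HasCompactSupport F)
    (hF : ContDiffOn ℝ 1 F (subgraph M x₀ γ)) (hF0 : ContinuousOn F (closedSubgraph M x₀ γ))
    (hint : IntegrableOn (divergence F) (subgraph M x₀ γ)) :
    ∫ x in subgraph M x₀ γ, divergence F x =
      ∫ y, inner ℝ (F (graphChart M x₀ γ (y, 0))) (graphNormal M γ y) := by
  set ch := graphChart M x₀ γ with hch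
  have hchc : Continuous ch := (contDiff_graphChart M x₀ hγ).continuous
  set e : E (n + 1) := M (WithLp.toLp 2 (0, 1)) with he
  have hν := continuous_graphNormal M hγ
  set ν := graphNormal M γ with hνdef
  have hopen := isOpen_subgraph M x₀ hγ
  -- compact support in the chart
  have hKc : IsCompact (ch ⁻¹' tsupport F) :=
    (graphHomeomorph M x₀ hγ).isCompact_preimage.2 hc
  set K : Set (E n) := Prod.fst '' (ch ⁻¹' tsupport F) with hK
  have hKcomp : IsCompact K := hKc.image continuous_fst
  have hKout : ∀ y t, y ∉ K → ch (y, t) ∉ tsupport F := fun y t hy h => hy ⟨(y, t), h, rfl⟩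
  obtain ⟨R, hR⟩ : ∃ R, ∀ y t, t < R → ch (y, t) ∉ tsupport F := by
    obtain ⟨R, hR⟩ := (hKc.image continuous_snd).bddBelow
    exact ⟨R, fun y t ht h => absurd (hR ⟨(y, t), h, rfl⟩) (not_le.2 ht)⟩
  have hF0' : ∀ {x}, x ∉ tsupport F → F x = 0 := fun hx => image_eq_zero_of_notMem_tsupport hx
  have hdF0 : ∀ {x}, x ∉ tsupport F → fderiv ℝ F x = 0 := fun hx => by
    rw [(notMem_tsupport_iff_eventuallyEq.1 hx).fderiv_eq]; simp
  -- continuity facts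
  have hGcont : ContinuousOn (fun q => F (ch q)) {q | q.2 ≤ 0} :=
    hF0.comp hchc.continuousOn fun q hq => graphChart_mem_closedSubgraph.2 hq
  have hGy : ∀ t ≤ 0, Continuous fun y => F (ch (y, t)) := fun t ht =>
    hGcont.comp_continuous (by fun_prop) fun y => ht
  have hDcont : ContinuousOn (fun q => fderiv ℝ F (ch q) e) {q | q.2 < 0} :=
    ((hF.continuousOn_fderiv_of_isOpen hopen le_rfl).clm_apply continuousOn_const).comp
      hchc.continuousOn fun q hq => graphChart_mem_subgraph.2 hq
  have hDy : ∀ t < 0, Continuous fun y => fderiv ℝ F (ch (y, t)) e := fun t ht =>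
    hDcont.comp_continuous (by fun_prop) fun y => ht
  have hdiff : ∀ y t, t < 0 → DifferentiableAt ℝ F (ch (y, t)) := fun y t ht =>
    (hF.contDiffAt (hopen.mem_nhds (graphChart_mem_subgraph.2 ht))).differentiableAt one_ne_zero
  set H : ℝ → ℝ := fun t => ∫ y, inner ℝ (F (ch (y, t))) (ν y) with hH
  set h : ℝ → ℝ := fun t => ∫ y, divergence F (ch (y, t)) with hh
  have hmeas : ∀ t ≤ 0, Continuous fun y => inner ℝ (F (ch (y, t))) (ν y) := fun t ht =>
    (hGy t ht).inner hν
  have hindint : ∀ C : ℝ, Integrable (K.indicator fun _ => C) (volume : Measure (E n)) := fun C =>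
    (integrable_indicator_iff hKcomp.measurableSet).2
      (integrableOn_const hKcomp.measure_lt_top.ne)
  -- continuity at the boundary
  have hHcont : ContinuousWithinAt H (Iic 0) 0 := by
    have hcpt : IsCompact (K ×ˢ Icc (-1 : ℝ) 0) := hKcomp.prod isCompact_Icc
    obtain ⟨C, hC⟩ := hcpt.exists_bound_of_continuousOn
      (f := fun q : E n × ℝ => inner ℝ (F (ch q)) (ν q.1))
      ((hGcont.mono fun q hq => hq.2.2).inner (hν.comp continuous_fst).continuousOn)
    refine continuousWithinAt_of_dominated (bound := K.indicator fun _ => C) ?_ ?_ (hindint C) ?_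
    · filter_upwards [self_mem_nhdsWithin] with t ht
      exact (hmeas t ht).aestronglyMeasurable
    · filter_upwards [self_mem_nhdsWithin, nhdsWithin_le_nhds (Ici_mem_nhds (neg_one_lt_zero))]
        with t ht ht'
      refine ae_of_all _ fun y => ?_
      by_cases hy : y ∈ K
      · simpa [hy] using hC (y, t) ⟨hy, ht', ht⟩
      · simp [hy, hF0' (hKout y t hy)]
    · refine ae_of_all _ fun y => ?_
      have : ContinuousOn (fun t => F (ch (y, t))) (Iic 0) :=
        hGcont.comp (by fun_prop) fun t ht => ht
      exact (this 0 self_mem_Iic).inner continuousWithinAt_const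
  -- differentiability in the interior
  have hHder : ∀ t < 0, Integrable (fun y => inner ℝ (fderiv ℝ F (ch (y, t)) e) (ν y)) ∧
      HasDerivAt H (∫ y, inner ℝ (fderiv ℝ F (ch (y, t)) e) (ν y)) t := by
    intro t ht
    -- The interval [t - 1, t/2] is a neighbourhood of t < 0 that stays off the graph, where the
    -- derivative of F may blow up.
    have hcpt : IsCompact (K ×ˢ Icc (t - 1) (t / 2)) := hKcomp.prod isCompact_Icc
    obtain ⟨C, hC⟩ := hcpt.exists_bound_of_continuousOn
      (f := fun q : E n × ℝ => inner ℝ (fderiv ℝ F (ch q) e) (ν q.1))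
      ((hDcont.mono fun q hq => by
        have := hq.2.2
        simp only [mem_ofPred_eq]
        linarith).inner (hν.comp continuous_fst).continuousOn)
    refine hasDerivAt_integral_of_dominated_loc_of_deriv_le
      (F := fun t y => inner ℝ (F (ch (y, t))) (ν y))
      (F' := fun t y => inner ℝ (fderiv ℝ F (ch (y, t)) e) (ν y))
      (s := Icc (t - 1) (t / 2)) (bound := K.indicator fun _ => C)
      (Icc_mem_nhds (by linarith) (by linarith)) ?_ ?_ ?_ ?_ (hindint C) ?_
    · filter_upwards [Iio_mem_nhds ht] with s hs
      exact (hmeas s hs.le).aestronglyMeasurable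
    · refine (hmeas t ht.le).integrable_of_hasCompactSupport
        (HasCompactSupport.intro hKcomp fun y hy => ?_)
      simp [hF0' (hKout y t hy)]
    · exact ((hDy t ht).inner hν).aestronglyMeasurable
    · refine ae_of_all _ fun y s hs => ?_
      by_cases hy : y ∈ K
      · simpa [hy] using hC (y, s) ⟨hy, hs⟩
      · simp [hy, hdF0 (hKout y s hy)]
    · refine ae_of_all _ fun y s hs => ?_
      have hs0 : s < 0 := by have := hs.2; linarith
      have h1 := (hdiff y s hs0).hasFDerivAt.comp_hasDerivAt s
        (hasDerivAt_graphChart_right M x₀ γ y s)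
      simpa using h1.inner ℝ (hasDerivAt_const s (ν y))
  have hheq : ∀ t < 0, h t = ∫ y, inner ℝ (fderiv ℝ F (ch (y, t)) e) (ν y) := by
    intro t ht
    have hKt : ContDiff ℝ 1 fun z => (M.symm (F (ch (z, t)))).fst := by
      have h1 : ContDiff ℝ 1 fun z => F (ch (z, t)) :=
        hF.comp_contDiff ((contDiff_graphChart M x₀ hγ).comp (by fun_prop : ContDiff ℝ 1 fun z : E n => (z, t)))
          fun z => graphChart_mem_subgraph.2 ht
      exact contDiff_fst.comp ((WithLp.prodContinuousLinearEquiv 2 ℝ (E n) ℝ).contDiff.comp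
        (M.symm.toContinuousLinearEquiv.contDiff.comp h1))
    obtain ⟨hi, hz⟩ := integral_divergence_eq_zero hKt
      (HasCompactSupport.intro hKcomp fun y hy => by simp [hF0' (hKout y t hy)])
    have : h t = ∫ y, (divergence (fun z => (M.symm (F (ch (z, t)))).fst) y +
        inner ℝ (fderiv ℝ F (ch (y, t)) e) (ν y)) :=
      integral_congr_ae (ae_of_all _ fun y => divergence_graphChart M x₀ hγ y t (hdiff y t ht))
    rw [this, integral_add hi (hHder t ht).1, hz, zero_add]
  -- Fubini
  have hmp := measurePreserving_graphChart M x₀ hγ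
  have hemb : MeasurableEmbedding ch := (graphHomeomorph M x₀ hγ).measurableEmbedding
  have hpre : ch ⁻¹' subgraph M x₀ γ = univ ×ˢ Iio (0 : ℝ) := by
    ext q; simp [hch, graphChart_mem_subgraph]
  have hmeaseq : (volume : Measure (E n × ℝ)).restrict (univ ×ˢ Iio 0) =
      (volume : Measure (E n)).prod (volume.restrict (Iio (0 : ℝ))) := by
    rw [Measure.volume_eq_prod, ← Measure.prod_restrict, Measure.restrict_univ]
  have hint2 : Integrable (fun q => divergence F (ch q))
      ((volume : Measure (E n)).prod (volume.restrict (Iio (0 : ℝ)))) := by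
    rw [← hmeaseq, ← hpre]
    exact (hmp.integrableOn_comp_preimage hemb).2 hint
  have hhint : IntegrableOn h (Iic 0) := by
    rw [integrableOn_Iic_iff_integrableOn_Iio]
    exact hint2.integral_prod_right
  have hfub : ∫ x in subgraph M x₀ γ, divergence F x = ∫ t in Iic 0, h t := by
    rw [← hmp.setIntegral_preimage_emb hemb, hpre, hmeaseq, integral_prod_symm _ hint2,
      integral_Iic_eq_integral_Iio]
  rw [hfub, integral_Iic_of_hasDerivAt_of_tendsto (f := H) (m := 0) hHcont
    (fun t ht => by rw [hheq t ht]; exact (hHder t ht).2) hhint ?_, sub_zero]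
  -- The limit of H at -∞ is 0 because the support of F lies above height R.
  refine tendsto_const_nhds.congr' ?_
  filter_upwards [Iio_mem_atBot R] with t ht
  simp only [hH]
  rw [eq_comm]
  exact integral_eq_zero_of_ae (ae_of_all _ fun y => by simp [hF0' (hR y t ht)])

/-! ### Surface measure of nearly flat graphs -/

/-- For the positive and the negative part of g separately, the integral against ν lies between 1
and c times the integral against μ. Applied with c = (1 + δ)^n to surface measure in graph
coordinates. -/
theorem abs_integral_sub_integral_le_of_le_smul {α : Type*} [MeasurableSpace α]
    {μ ν : Measure α} {c : NNReal} (h1 : μ ≤ ν) (h2 : ν ≤ c • μ) {g : α → ℝ}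
    (hg : Integrable g μ) :
    Integrable g ν ∧ |∫ x, g x ∂ν - ∫ x, g x ∂μ| ≤ (c - 1) * ∫ x, |g x| ∂μ := by
  have hcμ : ∀ {f : α → ℝ}, Integrable f μ → Integrable f (c • μ) := fun hf =>
    hf.smul_measure_nnreal
  have key : ∀ f : α → ℝ, (∀ x, 0 ≤ f x) → Integrable f μ →
      ∫ x, f x ∂μ ≤ ∫ x, f x ∂ν ∧ ∫ x, f x ∂ν ≤ c * ∫ x, f x ∂μ := by
    intro f hf hfi
    refine ⟨integral_mono_measure h1 (ae_of_all _ hf) ((hcμ hfi).mono_measure h2), ?_⟩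
    have := integral_mono_measure h2 (ae_of_all _ hf) (hcμ hfi)
    rwa [integral_smul_nnreal_measure] at this
  have hgν : Integrable g ν := (hcμ hg).mono_measure h2
  refine ⟨hgν, ?_⟩
  obtain ⟨p1, p2⟩ := key (fun x => max (g x) 0) (fun x => le_max_right _ _) hg.pos_part
  obtain ⟨q1, q2⟩ := key (fun x => max (-g x) 0) (fun x => le_max_right _ _) hg.neg_part
  have e1 : ∀ m : Measure α, Integrable g m →
      ∫ x, g x ∂m = ∫ x, max (g x) 0 ∂m - ∫ x, max (-g x) 0 ∂m := by
    intro m hm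
    rw [← integral_sub hm.pos_part hm.neg_part]
    refine integral_congr_ae (ae_of_all _ fun x => ?_)
    simp only
    rcases le_total 0 (g x) with h | h
    · rw [max_eq_left h, max_eq_right (by linarith), sub_zero]
    · rw [max_eq_right h, max_eq_left (by linarith)]; ring
  have e2 : ∫ x, |g x| ∂μ = ∫ x, max (g x) 0 ∂μ + ∫ x, max (-g x) 0 ∂μ := by
    rw [← integral_add hg.pos_part hg.neg_part]
    refine integral_congr_ae (ae_of_all _ fun x => ?_)
    simp only
    rcases le_total 0 (g x) with h | h
    · rw [max_eq_left h, max_eq_right (by linarith), abs_of_nonneg h, add_zero]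
    · rw [max_eq_right h, max_eq_left (by linarith), abs_of_nonpos h]; ring
  rw [e1 ν hgν, e1 μ hg, e2, abs_le]
  constructor <;> nlinarith

theorem dist_graphChart_zero (M : Frame n) (x₀ : E (n + 1)) (γ : E n → ℝ) (y z : E n) :
    dist (graphChart M x₀ γ (y, 0)) (graphChart M x₀ γ (z, 0)) =
      Real.sqrt (‖y - z‖ ^ 2 + |γ y - γ z| ^ 2) := by
  simp only [graphChart, dist_add_left, add_zero]
  rw [LinearIsometryEquiv.dist_map, dist_eq_norm, ← WithLp.toLp_sub, WithLp.prod_norm_eq_of_L2]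
  simp

/-- Projecting the graph back onto the hyperplane does not increase distances. -/
theorem antilipschitzWith_graph (M : Frame n) (x₀ : E (n + 1)) (γ : E n → ℝ) :
    AntilipschitzWith 1 fun y => graphChart M x₀ γ (y, 0) := by
  refine AntilipschitzWith.of_le_mul_dist fun y z => ?_
  rw [NNReal.coe_one, one_mul, dist_graphChart_zero, dist_eq_norm]
  exact Real.le_sqrt_of_sq_le (by nlinarith [sq_nonneg |γ y - γ z|])

theorem lipschitzWith_graph (M : Frame n) (x₀ : E (n + 1)) {γ : E n → ℝ} {δ : NNReal}
    (hγ : ContDiff ℝ 1 γ) (hδ : ∀ y, ‖fderiv ℝ γ y‖ ≤ δ) :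
    LipschitzWith (1 + δ) fun y => graphChart M x₀ γ (y, 0) := by
  have hL : LipschitzWith δ γ := lipschitzWith_of_nnnorm_fderiv_le
    (hγ.differentiable one_ne_zero) fun y => by exact_mod_cast hδ y
  refine LipschitzWith.of_dist_le_mul fun y z => ?_
  rw [dist_graphChart_zero, dist_eq_norm]
  have h := hL.dist_le_mul y z
  rw [Real.dist_eq, dist_eq_norm] at h
  refine Real.sqrt_le_iff.2 ⟨by positivity, ?_⟩
  have h0 := abs_nonneg (γ y - γ z)
  have h1 := norm_nonneg (y - z)
  have h2 : (0 : ℝ) ≤ δ := δ.2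
  push_cast
  have h3 : |γ y - γ z| ^ 2 ≤ (δ * ‖y - z‖) ^ 2 := by gcongr
  nlinarith [mul_nonneg h2 (sq_nonneg ‖y - z‖)]

theorem measurableEmbedding_graph (M : Frame n) (x₀ : E (n + 1)) {γ : E n → ℝ} {δ : NNReal}
    (hγ : ContDiff ℝ 1 γ) (hδ : ∀ y, ‖fderiv ℝ γ y‖ ≤ δ) :
    MeasurableEmbedding fun y => graphChart M x₀ γ (y, 0) :=
  ((antilipschitzWith_graph M x₀ γ).isClosedEmbedding
    (lipschitzWith_graph M x₀ hγ hδ).uniformContinuous).measurableEmbedding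

/-- Hausdorff measure cannot decrease under a map that expands distances, and on the hyperplane its
normalised form is Lebesgue measure. Together with `comap_graph_le_smul_volume` this stands in for
the area formula. -/
theorem volume_le_comap_graph (M : Frame n) (x₀ : E (n + 1)) {γ : E n → ℝ} {δ : NNReal}
    (hγ : ContDiff ℝ 1 γ) (hδ : ∀ y, ‖fderiv ℝ γ y‖ ≤ δ) :
    (volume : Measure (E n)) ≤ Measure.comap (fun y => graphChart M x₀ γ (y, 0)) μHE[n] := by
  refine Measure.le_iff.2 fun s _ => ?_
  rw [(measurableEmbedding_graph M x₀ hγ hδ).comap_apply,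
    ← EuclideanSpace.euclideanHausdorffMeasure_eq_volume]
  simp only [Measure.euclideanHausdorffMeasure_def, Measure.smul_apply]
  have h := (antilipschitzWith_graph M x₀ γ).le_hausdorffMeasure_image (d := n) (by positivity) s
  simp only [ENNReal.coe_one, ENNReal.one_rpow, one_mul] at h
  gcongr

theorem comap_graph_le_smul_volume (M : Frame n) (x₀ : E (n + 1)) {γ : E n → ℝ} {δ : NNReal}
    (hγ : ContDiff ℝ 1 γ) (hδ : ∀ y, ‖fderiv ℝ γ y‖ ≤ δ) :
    Measure.comap (fun y => graphChart M x₀ γ (y, 0)) μHE[n] ≤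
      (1 + δ) ^ n • (volume : Measure (E n)) := by
  refine Measure.le_iff.2 fun s _ => ?_
  rw [(measurableEmbedding_graph M x₀ hγ hδ).comap_apply,
    ← EuclideanSpace.euclideanHausdorffMeasure_eq_volume]
  simp only [Measure.euclideanHausdorffMeasure_def, Measure.smul_apply]
  have h := (lipschitzWith_graph M x₀ hγ hδ).hausdorffMeasure_image_le (d := n) (by positivity) s
  rw [ENNReal.rpow_natCast] at h
  rw [smul_comm]
  gcongr
  rw [ENNReal.smul_def, smul_eq_mul]
  exact_mod_cast h

/-! ### Cutting off a function with vanishing differential -/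

/-- Multiply g by a bump of scale a. Differentiating the bump costs a factor 1/a, but there |g| is
at most a small multiple of a, so the product rule keeps the slope small independently of a. -/
theorem exists_contDiff_eventuallyEq_fderiv_le {g : E n → ℝ} (hg : ContDiffAt ℝ 1 g 0)
    (hg0 : g 0 = 0) (hg1 : fderiv ℝ g 0 = 0) {δ : ℝ} (hδ : 0 < δ) :
    ∃ γ : E n → ℝ, ContDiff ℝ 1 γ ∧ (∀ y, ‖fderiv ℝ γ y‖ ≤ δ) ∧ γ =ᶠ[𝓝 0] g := by
  let χ : ContDiffBump (0 : E n) := ⟨1, 2, by norm_num, by norm_num⟩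
  have hχ : ContDiff ℝ 1 χ := χ.contDiff
  obtain ⟨B, hB⟩ : ∃ B, ∀ y, ‖fderiv ℝ χ y‖ ≤ B :=
    (hχ.continuous_fderiv one_ne_zero).bounded_above_of_compact_support
      (χ.hasCompactSupport.fderiv ℝ)
  have hB0 : 0 ≤ B := (norm_nonneg _).trans (hB 0)
  -- Chosen so that the two product-rule terms, δ' from χ∇g and 3Bδ' from g∇χ, add up to δ.
  set δ' := δ / (1 + 3 * B) with hδ'
  have hδ'0 : 0 < δ' := by positivity
  have hev : ∀ᶠ y in 𝓝 (0 : E n), ContDiffAt ℝ 1 g y ∧ ‖fderiv ℝ g y‖ < δ' := by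
    refine (hg.eventually (by simp)).and ?_
    have : ContinuousAt (fun y => ‖fderiv ℝ g y‖) 0 := (hg.continuousAt_fderiv one_ne_zero).norm
    exact this.eventually_lt continuousAt_const (by simpa [hg1] using hδ'0)
  obtain ⟨r, hr, hball⟩ := Metric.eventually_nhds_iff_ball.1 hev
  -- The rescaled bump vanishes for |y| ≥ 2a, hence near every point outside the ball of radius r =
  -- 3a.
  set a := r / 3 with ha
  have ha0 : 0 < a := by positivity
  have hgb : ∀ y ∈ Metric.ball (0 : E n) r, |g y| ≤ δ' * ‖y‖ := by
    intro y hy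
    have := (convex_ball (0 : E n) r).norm_image_sub_le_of_norm_fderiv_le (𝕜 := ℝ)
      (fun z hz => (hball z hz).1.differentiableAt one_ne_zero) (fun z hz => (hball z hz).2.le)
      (Metric.mem_ball_self hr) hy
    simpa [hg0] using this
  have hχa : ContDiff ℝ 1 fun y : E n => χ (a⁻¹ • y) := hχ.comp (contDiff_const_smul _)
  have hout : ∀ y ∉ Metric.ball (0 : E n) r, (fun y => χ (a⁻¹ • y) * g y) =ᶠ[𝓝 y] fun _ => 0 := by
    intro y hy
    have h1 : 2 < ‖a⁻¹ • y‖ := by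
      rw [norm_smul, norm_inv, Real.norm_of_nonneg ha0.le, inv_mul_eq_div, lt_div_iff₀ ha0]
      simp only [Metric.mem_ball, dist_zero_right, not_lt] at hy
      linarith
    have h2 : ∀ᶠ z in 𝓝 y, 2 < ‖a⁻¹ • z‖ :=
      (by fun_prop : Continuous fun z : E n => ‖a⁻¹ • z‖).continuousAt.eventually (lt_mem_nhds h1)
    filter_upwards [h2] with z hz
    rw [χ.zero_of_le_dist (by simpa using hz.le), zero_mul]
  refine ⟨fun y => χ (a⁻¹ • y) * g y, ?_, ?_, ?_⟩
  · refine contDiff_iff_contDiffAt.2 fun y => ?_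
    by_cases hy : y ∈ Metric.ball (0 : E n) r
    · exact hχa.contDiffAt.mul (hball y hy).1
    · exact contDiffAt_const.congr_of_eventuallyEq (hout y hy)
  · intro y
    by_cases hy : y ∈ Metric.ball (0 : E n) r
    · have hd := (hball y hy).1.differentiableAt one_ne_zero
      have h1 : HasFDerivAt (fun y : E n => χ (a⁻¹ • y))
          ((fderiv ℝ χ (a⁻¹ • y)).comp (a⁻¹ • ContinuousLinearMap.id ℝ (E n))) y :=
        (hχ.differentiable one_ne_zero _).hasFDerivAt.comp y ((hasFDerivAt_id y).const_smul a⁻¹)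
      have h2 := h1.fun_mul hd.hasFDerivAt
      rw [h2.fderiv]
      have hy' : ‖y‖ < 3 * a := by
        have : ‖y‖ < r := by simpa using hy
        linarith
      calc _ ≤ ‖χ (a⁻¹ • y) • fderiv ℝ g y‖ + ‖g y • (fderiv ℝ χ (a⁻¹ • y)).comp
            (a⁻¹ • ContinuousLinearMap.id ℝ (E n))‖ := norm_add_le _ _
        _ ≤ 1 * δ' + (δ' * (3 * a)) * (B * a⁻¹) := by
          rw [norm_smul, norm_smul]
          have hχ1 : ‖χ (a⁻¹ • y)‖ ≤ 1 := by
            rw [Real.norm_of_nonneg χ.nonneg]; exact χ.le_one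
          have hg' : ‖g y‖ ≤ δ' * (3 * a) := (hgb y hy).trans (by gcongr)
          have hc : ‖(fderiv ℝ χ (a⁻¹ • y)).comp (a⁻¹ • ContinuousLinearMap.id ℝ (E n))‖ ≤
              B * a⁻¹ := by
            refine (ContinuousLinearMap.opNorm_comp_le _ _).trans ?_
            refine mul_le_mul (hB _) ?_ (norm_nonneg _) hB0
            rw [norm_smul, norm_inv, Real.norm_of_nonneg ha0.le]
            exact mul_le_of_le_one_right (by positivity) ContinuousLinearMap.norm_id_le
          exact add_le_add (mul_le_mul hχ1 (hball y hy).2.le (norm_nonneg _) zero_le_one)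
            (mul_le_mul hg' hc (norm_nonneg _) (by positivity))
        _ = δ := by
          rw [hδ']; field_simp
    · rw [(hout y hy).fderiv_eq]
      simpa using hδ.le
  · have h2 : ∀ᶠ z in 𝓝 (0 : E n), ‖a⁻¹ • z‖ < 1 :=
      (by fun_prop : Continuous fun z : E n => ‖a⁻¹ • z‖).continuousAt.eventually
        (gt_mem_nhds (by simp))
    filter_upwards [h2] with z hz
    rw [χ.one_of_mem_closedBall (by simpa using hz.le), one_mul]

/-! ### Geometry of `C¹` boundaries -/

theorem IsLocalDefiningFunction.apply_eq_zero {Ω : Set (E N)} (hΩ : IsOpen Ω) {x : E N}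
    {φ : E N → ℝ} (h : IsLocalDefiningFunction Ω x φ) (hx : x ∈ frontier Ω) : φ x = 0 := by
  have hxΩ : x ∉ Ω := by
    rw [hΩ.frontier_eq] at hx
    exact hx.2
  refine le_antisymm ?_ (not_lt.1 fun hlt => hxΩ (h.2.2.self_of_nhds.2 hlt))
  by_contra! hlt
  have h1 : ∀ᶠ y in 𝓝 x, 0 < φ y := h.1.continuousAt.eventually (lt_mem_nhds hlt)
  obtain ⟨y, hy, hyΩ, hy'⟩ := mem_closure_iff_frequently.1 hx.1 |>.and_eventually (h1.and h.2.2)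
    |>.exists
  exact absurd (hy'.1 hy) hyΩ.not_gt

theorem IsLocalDefiningFunction.tendsto_div {Ω : Set (E N)} {x : E N} {φ : E N → ℝ}
    (h : IsLocalDefiningFunction Ω x φ) (hx : φ x = 0) (v : E N) :
    Tendsto (fun t : ℝ => φ (x + t • v) / t) (𝓝[>] 0) (𝓝 (inner ℝ (gradient φ x) v)) := by
  have hl : HasDerivAt (fun t : ℝ => φ (x + t • v)) (inner ℝ (gradient φ x) v) 0 := by
    rw [inner_gradient_left]
    have h1 : HasDerivAt (fun t : ℝ => x + t • v) v 0 := by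
      simpa using ((hasDerivAt_id (0 : ℝ)).smul_const v).const_add x
    have hd : HasFDerivAt φ (fderiv ℝ φ x) (x + (0 : ℝ) • v) := by
      simpa using (h.1.differentiableAt one_ne_zero).hasFDerivAt
    exact hd.comp_hasDerivAt 0 h1
  refine (hl.tendsto_slope.mono_left
    (nhdsWithin_mono 0 fun t (ht : 0 < t) => ht.ne')).congr fun t => ?_
  rw [slope_def_field]
  simp [hx]

theorem IsLocalDefiningFunction.eventually_mem_iff {Ω : Set (E N)} {x : E N} {φ : E N → ℝ}
    (h : IsLocalDefiningFunction Ω x φ) (v : E N) :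
    ∀ᶠ t in 𝓝[>] (0 : ℝ), (x + t • v ∈ Ω ↔ φ (x + t • v) < 0) := by
  have hc : Tendsto (fun t : ℝ => x + t • v) (𝓝[>] 0) (𝓝 x) := by
    have : ContinuousAt (fun t : ℝ => x + t • v) 0 := by fun_prop
    simpa [ContinuousAt] using this.mono_left nhdsWithin_le_nhds
  exact hc.eventually h.2.2

theorem IsLocalDefiningFunction.eventually_mem_of_inner_neg {Ω : Set (E N)} {x v : E N}
    {φ : E N → ℝ} (h : IsLocalDefiningFunction Ω x φ) (hx : φ x = 0)
    (hv : inner ℝ (gradient φ x) v < 0) : ∀ᶠ t in 𝓝[>] (0 : ℝ), x + t • v ∈ Ω := by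
  filter_upwards [(h.tendsto_div hx v).eventually (gt_mem_nhds hv), h.eventually_mem_iff v,
    self_mem_nhdsWithin] with t ht htm ht0
  exact htm.2 (by simpa using (div_lt_iff₀ ht0).1 ht)

/-- If a ≠ b then ⟨a, b⟩ < 1, and v = b - a violates the hypothesis: it has negative product with a
and positive product with b. -/
theorem eq_of_forall_inner_neg_imp {a b : E N} (ha : ‖a‖ = 1) (hb : ‖b‖ = 1)
    (h : ∀ v, inner ℝ a v < 0 → inner ℝ b v ≤ 0) : a = b := by
  by_contra hne
  have hlt : inner ℝ a b < 1 := (inner_lt_one_iff_real_of_norm_eq_one ha hb).2 hne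
  have := h (b - a) (by rw [inner_sub_right, real_inner_self_eq_norm_sq, ha]; linarith)
  rw [inner_sub_right, real_inner_self_eq_norm_sq, hb, real_inner_comm] at this
  linarith

/-- The outward normal can be computed from any local defining function. -/
theorem IsLocalDefiningFunction.outwardNormal_eq {Ω : Set (E N)} (hΩ : IsOpen Ω) {x : E N}
    {φ : E N → ℝ} (h : IsLocalDefiningFunction Ω x φ) (hx : x ∈ frontier Ω) :
    outwardNormal Ω x = ‖gradient φ x‖⁻¹ • gradient φ x := by
  have hex : ∃ φ : E N → ℝ, IsLocalDefiningFunction Ω x φ := ⟨φ, h⟩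
  rw [outwardNormal, dif_pos hex]
  have hc := hex.choose_spec
  set ψ := hex.choose
  have hnorm : ∀ {z : E N}, z ≠ 0 → ‖‖z‖⁻¹ • z‖ = 1 := fun hz => norm_smul_inv_norm (𝕜 := ℝ) hz
  -- A ray along which one defining function decreases enters Ω, and a ray along which the other
  -- increases stays outside; so the open half-space of one gradient is compatible with that of the
  -- other.
  refine eq_of_forall_inner_neg_imp (hnorm hc.2.1) (hnorm h.2.1) fun v hv => ?_
  rw [real_inner_smul_left] at hv ⊢
  have hv' : inner ℝ (gradient ψ x) v < 0 :=
    neg_of_mul_neg_right hv (inv_nonneg.2 (norm_nonneg _))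
  have h1 := hc.eventually_mem_of_inner_neg (hc.apply_eq_zero hΩ hx) hv'
  by_contra! hpos
  have hpos' : 0 < inner ℝ (gradient φ x) v :=
    pos_of_mul_pos_right hpos (inv_nonneg.2 (norm_nonneg _))
  have h0 := h.apply_eq_zero hΩ hx
  have hfalse : ∀ᶠ t in 𝓝[>] (0 : ℝ), False := by
    filter_upwards [(h.tendsto_div h0 v).eventually (lt_mem_nhds hpos'), h.eventually_mem_iff v, h1,
      self_mem_nhdsWithin] with t ht htm htΩ ht0
    exact absurd (htm.1 htΩ) (not_lt.2 ((div_pos_iff_of_pos_right ht0).1 ht).le)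
  exact hfalse.exists.choose_spec

/-- A `C¹` domain has unique derivatives on its closure at boundary points. -/
theorem IsLocalDefiningFunction.uniqueDiffWithinAt {Ω : Set (E N)} (hΩ : IsOpen Ω) {x : E N}
    {φ : E N → ℝ} (h : IsLocalDefiningFunction Ω x φ) (hx : x ∈ frontier Ω) :
    UniqueDiffWithinAt ℝ Ω x := by
  have h0 := h.apply_eq_zero hΩ hx
  -- The tangent cone contains an open half-space, whose span is already everything.
  have hsub : {v : E N | inner ℝ (gradient φ x) v < 0} ⊆ tangentConeAt ℝ Ω x := by
    intro v hv
    exact mem_tangentConeAt_of_add_smul_mem (l := 𝓝[>] (0 : ℝ)) (c := fun t : ℝ => t)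
      (tendsto_id.mono_right (nhdsWithin_mono 0 fun t (ht : 0 < t) => ht.ne'))
      (h.eventually_mem_of_inner_neg h0 hv)
  refine ⟨?_, hx.1⟩
  have hopen : IsOpen {v : E N | inner ℝ (gradient φ x) v < 0} :=
    isOpen_lt (by fun_prop) continuous_const
  have hne : {v : E N | inner ℝ (gradient φ x) v < 0}.Nonempty :=
    ⟨-gradient φ x, by
      rw [mem_ofPred_eq, inner_neg_right, real_inner_self_eq_norm_sq, neg_lt_zero]
      exact pow_pos (norm_pos_iff.2 h.2.1) 2⟩
  have hspan : Submodule.span ℝ (tangentConeAt ℝ Ω x) = ⊤ := by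
    refine Submodule.eq_top_of_nonempty_interior' _ ?_
    obtain ⟨v, hv⟩ := hne
    exact ⟨v, mem_interior.2 ⟨_, hsub.trans Submodule.subset_span, hopen, hv⟩⟩
  rw [hspan]
  simp

/-- Near a boundary point, a `C¹` domain is the region below a graph that is as flat as we wish. -/
theorem IsLocalDefiningFunction.exists_graph {Ω : Set (E (n + 1))} (hΩ : IsOpen Ω)
    {x₀ : E (n + 1)} {φ : E (n + 1) → ℝ} (h : IsLocalDefiningFunction Ω x₀ φ)
    (hx₀ : x₀ ∈ frontier Ω) {δ : ℝ} (hδ : 0 < δ) :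
    ∃ (M : Frame n) (γ : E n → ℝ) (U : Set (E (n + 1))), ContDiff ℝ 1 γ ∧ γ 0 = 0 ∧
      fderiv ℝ γ 0 = 0 ∧ (∀ y, ‖fderiv ℝ γ y‖ ≤ δ) ∧ IsOpen U ∧ x₀ ∈ U ∧
      ∀ x ∈ U, x ∈ Ω ↔ x ∈ subgraph M x₀ γ := by
  set c := ‖gradient φ x₀‖ with hc
  have hc0 : 0 < c := norm_pos_iff.2 h.2.1
  -- Aligning the last axis with ∇φ(x₀) makes the hyperplane derivative of φ vanish at x₀, so the
  -- implicit function has zero slope there.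
  obtain ⟨M, hM⟩ := exists_frame (c⁻¹ • gradient φ x₀) (norm_smul_inv_norm (𝕜 := ℝ) h.2.1)
  have hgrad : gradient φ x₀ = M (WithLp.toLp 2 (0, c)) := by
    have : (WithLp.toLp 2 ((0 : E n), c)) = c • WithLp.toLp 2 ((0 : E n), (1 : ℝ)) := by
      rw [← WithLp.toLp_smul]; simp
    rw [this, map_smul, hM, smul_smul, mul_inv_cancel₀ hc0.ne', one_smul]
  have hφ0 := h.apply_eq_zero hΩ hx₀
  set T : E n × ℝ → E (n + 1) := graphChart M x₀ fun _ => 0 with hT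
  have hTc : ContDiff ℝ 1 T := contDiff_graphChart M x₀ contDiff_const
  have hT0 : T (0, 0) = x₀ := by simp [hT, graphChart]
  set f : E n × ℝ → ℝ := fun q => φ (T q) with hf
  have hφT : ContDiffAt ℝ 1 φ (T (0, 0)) := by rw [hT0]; exact h.1
  have hfc : ContDiffAt ℝ 1 f (0, 0) := hφT.comp _ hTc.contDiffAt
  have hT' : HasFDerivAt T (M.toContinuousLinearEquiv.toContinuousLinearMap.comp
      (WithLp.prodContinuousLinearEquiv 2 ℝ (E n) ℝ).symm.toContinuousLinearMap) (0, 0) := by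
    have h1 := ((M.toContinuousLinearEquiv.toContinuousLinearMap.comp
      (WithLp.prodContinuousLinearEquiv 2 ℝ (E n) ℝ).symm.toContinuousLinearMap).hasFDerivAt
        (x := ((0 : E n), (0 : ℝ)))).const_add x₀
    refine h1.congr_of_eventuallyEq (Eventually.of_forall fun q => ?_)
    simp [hT, graphChart]
  have hfd : ∀ q : E n × ℝ, fderiv ℝ f (0, 0) q = c * q.2 := by
    intro q
    have h1 : HasFDerivAt f _ (0, 0) :=
      HasFDerivAt.comp (0, 0) (hφT.differentiableAt one_ne_zero).hasFDerivAt hT'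
    rw [h1.fderiv, hT0]
    change fderiv ℝ φ x₀ (M (WithLp.toLp 2 (q.1, q.2))) = _
    rw [← inner_gradient_left, hgrad, inner_frame]
    simp
  have hinv : (fderiv ℝ f (0, 0) ∘SL ContinuousLinearMap.inr ℝ (E n) ℝ).IsInvertible := by
    have : fderiv ℝ f (0, 0) ∘SL ContinuousLinearMap.inr ℝ (E n) ℝ =
        (ContinuousLinearEquiv.smulLeft (Units.mk0 c hc0.ne') : ℝ ≃L[ℝ] ℝ) := by
      ext
      simp [hfd, Units.smul_def]
    rw [this]
    exact ContinuousLinearMap.isInvertible_equiv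
  set g := hfc.implicitFunction one_ne_zero hinv with hg
  have hgc : ContDiffAt ℝ 1 g 0 := hfc.contDiffAt_implicitFunction one_ne_zero hinv
  have hg0 : g 0 = 0 := hfc.implicitFunction_apply_self one_ne_zero hinv
  have hg1 : fderiv ℝ g 0 = 0 := by
    rw [(hfc.hasStrictFDerivAt_implicitFunction one_ne_zero hinv).hasFDerivAt.fderiv]
    have : fderiv ℝ f (0, 0) ∘SL ContinuousLinearMap.inl ℝ (E n) ℝ = 0 := by
      ext v; simp [hfd]
    rw [this]
    simp
  have hf0 : f (0, 0) = 0 := by simp only [hf, hT0, hφ0]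
  have hzero : ∀ᶠ y in 𝓝 (0 : E n), f (y, g y) = 0 := by
    have h1 := hfc.eventually_apply_eq_iff_implicitFunction one_ne_zero hinv
    have h2 : Tendsto (fun y => (y, g y)) (𝓝 0) (𝓝 ((0 : E n), (0 : ℝ))) := by
      have : ContinuousAt (fun y => (y, g y)) 0 := continuousAt_id.prodMk hgc.continuousAt
      simpa [ContinuousAt, hg0] using this
    filter_upwards [h2.eventually h1] with y hy
    rw [hf0] at hy
    exact hy.2 rfl
  -- monotonicity in the last variable
  have hmono : ∀ᶠ q in 𝓝 ((0 : E n), (0 : ℝ)), ContDiffAt ℝ 1 f q ∧ 0 < fderiv ℝ f q (0, 1) := by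
    refine (hfc.eventually (by simp)).and ?_
    have : ContinuousAt (fun q => fderiv ℝ f q (0, 1)) (0, 0) :=
      (hfc.continuousAt_fderiv one_ne_zero).clm_apply continuousAt_const
    exact this.eventually (lt_mem_nhds (by simpa [hfd] using hc0))
  rw [nhds_prod_eq] at hmono
  obtain ⟨s, hs, hsm⟩ := ((nhds_basis_opens (0 : E n)).prod (Metric.nhds_basis_ball
    (x := (0 : ℝ)))).eventually_iff.1 hmono
  obtain ⟨V, b⟩ := s
  simp only at hs hsm
  rw [Real.ball_eq_Ioo, zero_sub, zero_add] at hsm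
  have hb : 0 < b := hs.2
  have hstrict : ∀ y ∈ V, StrictMonoOn (fun t => f (y, t)) (Ioo (-b) b) := by
    intro y hy
    have hd : ∀ t ∈ Ioo (-b) b, HasDerivAt (fun t => f (y, t)) (fderiv ℝ f (y, t) (0, 1)) t := by
      intro t ht
      have h1 : HasDerivAt (fun t : ℝ => (y, t)) ((0 : E n), (1 : ℝ)) t :=
        (hasDerivAt_const t y).prodMk (hasDerivAt_id t)
      exact ((hsm ⟨hy, ht⟩).1.differentiableAt one_ne_zero).hasFDerivAt.comp_hasDerivAt t h1
    refine strictMonoOn_of_deriv_pos (convex_Ioo _ _)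
      (fun t ht => (hd t ht).continuousAt.continuousWithinAt) fun t ht => ?_
    rw [interior_Ioo] at ht
    rw [(hd t ht).deriv]
    exact (hsm ⟨hy, ht⟩).2
  have hgb : ∀ᶠ y in 𝓝 (0 : E n), g y ∈ Ioo (-b) b :=
    hgc.continuousAt.eventually (by rw [hg0]; exact Ioo_mem_nhds (neg_lt_zero.2 hb) hb)
  -- The implicit function g is only local; γ has the same germ at 0 and is globally defined, C¹ and
  -- flat.
  obtain ⟨γ, hγ, hγδ, hγg⟩ := exists_contDiff_eventuallyEq_fderiv_le hgc hg0 hg1 hδ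
  have hgood : ∀ᶠ y in 𝓝 (0 : E n), y ∈ V ∧ f (y, g y) = 0 ∧ g y ∈ Ioo (-b) b ∧ γ y = g y :=
    Eventually.and (hs.1.2.mem_nhds hs.1.1) (hzero.and (hgb.and hγg))
  have hcoord : Tendsto (graphCoord M x₀ fun _ => 0) (𝓝 x₀) (𝓝 ((0 : E n), (0 : ℝ))) := by
    have h1 := (contDiff_graphCoord M x₀ (γ := fun _ => (0 : ℝ)) contDiff_const).continuous.tendsto x₀
    have h2 : graphCoord M x₀ (fun _ => 0) x₀ = (0, 0) := by simp [graphCoord]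
    rwa [h2] at h1
  have hev : ∀ᶠ x in 𝓝 x₀, (x ∈ Ω ↔ x ∈ subgraph M x₀ γ) := by
    have e1 := ((continuous_fst.tendsto _).comp hcoord).eventually hgood
    have e2 := ((continuous_snd.tendsto _).comp hcoord).eventually
      (Ioo_mem_nhds (neg_lt_zero.2 hb) hb)
    filter_upwards [h.2.2, e1, e2] with x hx he1 he2
    obtain ⟨hyV, hyz, hyb, hyγ⟩ := he1
    simp only [Function.comp_apply] at hyV hyz hyb hyγ he2
    have hfx : φ x = f (graphCoord M x₀ (fun _ => 0) x) := by
      simp only [hf, hT, graphChart_graphCoord]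
    set q := graphCoord M x₀ (fun _ => 0) x with hq
    have hsub : x ∈ subgraph M x₀ γ ↔ q.2 < γ q.1 := by
      simp [subgraph, hq, graphCoord, sub_neg]
    rw [hx, hsub, hyγ, hfx, ← (hstrict q.1 hyV).lt_iff_lt he2 hyb]
    simp only [hyz]
  obtain ⟨U, hU, hUo, hUx⟩ := eventually_nhds_iff.1 hev
  exact ⟨M, γ, U, hγ, by rw [hγg.self_of_nhds, hg0], by rw [hγg.fderiv_eq, hg1], hγδ, hUo, hUx, hU⟩

/-! ### Closure, frontier and normal read off from a local graph -/

theorem closure_subgraph (M : Frame n) (x₀ : E (n + 1)) {γ : E n → ℝ} (hγ : ContDiff ℝ 1 γ) :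
    closure (subgraph M x₀ γ) = closedSubgraph M x₀ γ := by
  have h1 : subgraph M x₀ γ = (graphHomeomorph M x₀ hγ).symm ⁻¹' (univ ×ˢ Iio 0) := by
    ext x
    simp [subgraph, graphHomeomorph]
  have h2 : closedSubgraph M x₀ γ = (graphHomeomorph M x₀ hγ).symm ⁻¹' (univ ×ˢ Iic 0) := by
    ext x
    simp [closedSubgraph, graphHomeomorph]
  rw [h1, ← Homeomorph.preimage_closure, closure_prod_eq, closure_univ, closure_Iio, h2]

theorem hasFDerivAt_graphCoord_snd (M : Frame n) (x₀ : E (n + 1)) {γ : E n → ℝ}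
    (hγ : ContDiff ℝ 1 γ) (x : E (n + 1)) :
    HasFDerivAt (fun z => (graphCoord M x₀ γ z).2)
      (innerSL ℝ (graphNormal M γ (graphCoord M x₀ γ x).1)) x := by
  have h1 : HasFDerivAt (fun z : E (n + 1) =>
      WithLp.prodContinuousLinearEquiv 2 ℝ (E n) ℝ (M.symm (z - x₀)))
      ((WithLp.prodContinuousLinearEquiv 2 ℝ (E n) ℝ).toContinuousLinearMap.comp
        M.symm.toContinuousLinearEquiv.toContinuousLinearMap) x :=
    ((WithLp.prodContinuousLinearEquiv 2 ℝ (E n) ℝ).toContinuousLinearMap.comp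
        M.symm.toContinuousLinearEquiv.toContinuousLinearMap).hasFDerivAt.comp x
      ((hasFDerivAt_id x).sub_const x₀)
  have h2 := h1.snd.sub ((hγ.differentiable one_ne_zero _).hasFDerivAt.comp x h1.fst)
  refine h2.congr_fderiv ?_
  ext v
  obtain ⟨⟨a, s⟩, rfl⟩ := M.surjective v
  rw [innerSL_apply_apply, graphNormal, inner_frame, inner_neg_left, inner_gradient_left]
  simp [graphCoord]
  ring

theorem gradient_graphCoord_snd (M : Frame n) (x₀ : E (n + 1)) {γ : E n → ℝ}
    (hγ : ContDiff ℝ 1 γ) (x : E (n + 1)) :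
    gradient (fun z => (graphCoord M x₀ γ z).2) x = graphNormal M γ (graphCoord M x₀ γ x).1 := by
  refine ext_inner_right ℝ fun v => ?_
  rw [inner_gradient_left, (hasFDerivAt_graphCoord_snd M x₀ hγ x).fderiv, innerSL_apply_apply]

theorem norm_graphNormal_sq (M : Frame n) (γ : E n → ℝ) (y : E n) :
    ‖graphNormal M γ y‖ ^ 2 = ‖fderiv ℝ γ y‖ ^ 2 + 1 := by
  rw [← real_inner_self_eq_norm_sq, graphNormal, inner_frame, inner_neg_neg,
    real_inner_self_eq_norm_sq]
  simp [gradient]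

theorem one_le_norm_graphNormal (M : Frame n) (γ : E n → ℝ) (y : E n) :
    1 ≤ ‖graphNormal M γ y‖ := by
  nlinarith [norm_graphNormal_sq M γ y, norm_nonneg (graphNormal M γ y),
    sq_nonneg ‖fderiv ℝ γ y‖]

section LocalGraph

variable {Ω U : Set (E (n + 1))} {M : Frame n} {x₀ : E (n + 1)} {γ : E n → ℝ}

theorem isLocalDefiningFunction_graph (hγ : ContDiff ℝ 1 γ) (hU : IsOpen U)
    (h : ∀ x ∈ U, x ∈ Ω ↔ x ∈ subgraph M x₀ γ) {x : E (n + 1)} (hx : x ∈ U) :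
    IsLocalDefiningFunction Ω x fun z => (graphCoord M x₀ γ z).2 := by
  refine ⟨(contDiff_graphCoord M x₀ hγ).snd.contDiffAt, ?_, ?_⟩
  · rw [gradient_graphCoord_snd M x₀ hγ, ← norm_pos_iff]
    exact zero_lt_one.trans_le (one_le_norm_graphNormal _ _ _)
  · filter_upwards [hU.mem_nhds hx] with z hz using h z hz

theorem mem_closure_iff_of_graph (hγ : ContDiff ℝ 1 γ) (hU : IsOpen U)
    (h : ∀ x ∈ U, x ∈ Ω ↔ x ∈ subgraph M x₀ γ) {x : E (n + 1)} (hx : x ∈ U) :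
    x ∈ closure Ω ↔ x ∈ closedSubgraph M x₀ γ := by
  rw [← closure_subgraph M x₀ hγ, mem_closure_iff_frequently, mem_closure_iff_frequently]
  refine frequently_congr ?_
  filter_upwards [hU.mem_nhds hx] with z hz using h z hz

theorem mem_frontier_iff_of_graph (hΩ : IsOpen Ω) (hγ : ContDiff ℝ 1 γ) (hU : IsOpen U)
    (h : ∀ x ∈ U, x ∈ Ω ↔ x ∈ subgraph M x₀ γ) {x : E (n + 1)} (hx : x ∈ U) :
    x ∈ frontier Ω ↔ (graphCoord M x₀ γ x).2 = 0 := by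
  rw [hΩ.frontier_eq, Set.mem_sdiff, mem_closure_iff_of_graph hγ hU h hx, h x hx]
  simp only [closedSubgraph, subgraph, mem_ofPred_eq, not_lt]
  exact ⟨fun h => le_antisymm h.1 h.2, fun h => ⟨h.le, h.ge⟩⟩

theorem outwardNormal_eq_of_graph (hΩ : IsOpen Ω) (hγ : ContDiff ℝ 1 γ) (hU : IsOpen U)
    (h : ∀ x ∈ U, x ∈ Ω ↔ x ∈ subgraph M x₀ γ) {x : E (n + 1)} (hx : x ∈ U)
    (hxf : x ∈ frontier Ω) :
    outwardNormal Ω x = ‖graphNormal M γ (graphCoord M x₀ γ x).1‖⁻¹ •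
      graphNormal M γ (graphCoord M x₀ γ x).1 := by
  rw [(isLocalDefiningFunction_graph hγ hU h hx).outwardNormal_eq hΩ hxf,
    gradient_graphCoord_snd M x₀ hγ]

end LocalGraph

/-! ### The divergence theorem on `C¹` domains -/

section LocalGraph

variable {Ω U : Set (E (n + 1))} {M : Frame n} {x₀ : E (n + 1)} {γ : E n → ℝ}

/-- Inside U the two closed sets coincide; at points outside U the field vanishes in a whole
neighbourhood. This lets Ω be replaced by a global subgraph. -/
theorem continuousOn_closedSubgraph_of_tsupport_subset (hγ : ContDiff ℝ 1 γ) (hU : IsOpen U)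
    (h : ∀ x ∈ U, x ∈ Ω ↔ x ∈ subgraph M x₀ γ) {F : E (n + 1) → E (n + 1)}
    (hFU : tsupport F ⊆ U) (hF : ContinuousOn F (closure Ω)) :
    ContinuousOn F (closedSubgraph M x₀ γ) := by
  intro x hx
  by_cases hxU : x ∈ U
  · refine (hF x ((mem_closure_iff_of_graph hγ hU h hxU).2 hx)).mono_of_mem_nhdsWithin ?_
    filter_upwards [self_mem_nhdsWithin, nhdsWithin_le_nhds (hU.mem_nhds hxU)] with z hz hzU
    exact (mem_closure_iff_of_graph hγ hU h hzU).2 hz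
  · have h0 := notMem_tsupport_iff_eventuallyEq.1 fun hx => hxU (hFU hx)
    exact (continuousAt_const.congr h0.symm).continuousWithinAt

theorem contDiffOn_subgraph_of_tsupport_subset (hΩ : IsOpen Ω)
    (h : ∀ x ∈ U, x ∈ Ω ↔ x ∈ subgraph M x₀ γ) {F : E (n + 1) → E (n + 1)}
    (hFU : tsupport F ⊆ U) (hF : ContDiffOn ℝ 1 F Ω) :
    ContDiffOn ℝ 1 F (subgraph M x₀ γ) := by
  intro x hx
  by_cases hxU : x ∈ U
  · exact (hF.contDiffAt (hΩ.mem_nhds ((h x hxU).2 hx))).contDiffWithinAt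
  · have h0 := notMem_tsupport_iff_eventuallyEq.1 fun hx => hxU (hFU hx)
    exact (contDiffAt_const.congr_of_eventuallyEq h0).contDiffWithinAt

theorem indicator_eq_indicator_subgraph (h : ∀ x ∈ U, x ∈ Ω ↔ x ∈ subgraph M x₀ γ)
    {g : E (n + 1) → ℝ} (hg : ∀ x ∉ U, g x = 0) :
    Ω.indicator g = (subgraph M x₀ γ).indicator g := by
  funext x
  by_cases hxU : x ∈ U
  · by_cases hx : x ∈ Ω
    · rw [indicator_of_mem hx, indicator_of_mem ((h x hxU).1 hx)]
    · rw [indicator_of_notMem hx, indicator_of_notMem fun hx' => hx ((h x hxU).2 hx')]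
  · rw [indicator_apply_eq_zero.2 fun _ => hg x hxU, indicator_apply_eq_zero.2 fun _ => hg x hxU]

theorem setIntegral_frontier_eq_of_graph (hΩ : IsOpen Ω) (hγ : ContDiff ℝ 1 γ) {δ : NNReal}
    (hδ : ∀ y, ‖fderiv ℝ γ y‖ ≤ δ) (hU : IsOpen U)
    (h : ∀ x ∈ U, x ∈ Ω ↔ x ∈ subgraph M x₀ γ) {g : E (n + 1) → ℝ} (hg : ∀ x ∉ U, g x = 0) :
    ∫ x in frontier Ω, g x ∂μHE[n] =
      ∫ y, g (graphChart M x₀ γ (y, 0))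
        ∂(Measure.comap (fun y => graphChart M x₀ γ (y, 0)) μHE[n]) := by
  have hemb := measurableEmbedding_graph M x₀ hγ hδ
  rw [← hemb.integral_map, hemb.map_comap, ← integral_indicator isClosed_frontier.measurableSet,
    ← integral_indicator hemb.measurableSet_range]
  congr 1
  funext x
  by_cases hxU : x ∈ U
  · have hiff : x ∈ frontier Ω ↔ x ∈ range fun y => graphChart M x₀ γ (y, 0) := by
      rw [mem_frontier_iff_of_graph hΩ hγ hU h hxU]
      constructor
      · intro hx
        refine ⟨(graphCoord M x₀ γ x).1, ?_⟩
        have : ((graphCoord M x₀ γ x).1, (0 : ℝ)) = graphCoord M x₀ γ x := by rw [← hx]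
        simp only [this, graphChart_graphCoord]
      · rintro ⟨y, rfl⟩
        simp [graphCoord_graphChart]
    by_cases hx : x ∈ frontier Ω
    · rw [indicator_of_mem hx, indicator_of_mem (hiff.1 hx)]
    · rw [indicator_of_notMem hx, indicator_of_notMem fun hx' => hx (hiff.2 hx')]
  · rw [indicator_apply_eq_zero.2 fun _ => hg x hxU, indicator_apply_eq_zero.2 fun _ => hg x hxU]

/-- The volume integral equals ∫ F·ν dy with ν = (-∇γ, 1) exactly. Passing to the surface integral
takes two replacements: ν by ν/|ν|, which costs δ since 1 ≤ |ν| ≤ 1 + δ, and dy by surface measure,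
which costs (1 + δ)^n - 1. -/
theorem abs_integral_divergence_sub_le_of_graph (hΩ : IsOpen Ω) (hγ : ContDiff ℝ 1 γ)
    {δ : NNReal} (hδ : ∀ y, ‖fderiv ℝ γ y‖ ≤ δ) (hU : IsOpen U)
    (h : ∀ x ∈ U, x ∈ Ω ↔ x ∈ subgraph M x₀ γ) {F : E (n + 1) → E (n + 1)}
    (hc : HasCompactSupport F) (hFU : tsupport F ⊆ U) (hF : ContDiffOn ℝ 1 F Ω)
    (hF0 : ContinuousOn F (closure Ω)) (hint : IntegrableOn (divergence F) Ω) :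
    |(∫ x in Ω, divergence F x) - ∫ x in frontier Ω, inner ℝ (F x) (outwardNormal Ω x) ∂μHE[n]| ≤
      ((1 + δ) ^ n - 1 + δ) * ∫ x in frontier Ω, ‖F x‖ ∂μHE[n] := by
  set Φ : E n → E (n + 1) := fun y => graphChart M x₀ γ (y, 0) with hΦ
  have hΦc : Continuous Φ := (lipschitzWith_graph M x₀ hγ hδ).continuous
  set ν := graphNormal M γ with hν
  have hνc : Continuous ν := continuous_graphNormal M hγ
  have hν1 : ∀ y, 1 ≤ ‖ν y‖ := one_le_norm_graphNormal M γ
  have hν2 : ∀ y, ‖ν y‖ ≤ 1 + δ := by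
    intro y
    have h1 := norm_graphNormal_sq M γ y
    have h2 := hδ y
    have h3 := norm_nonneg (fderiv ℝ γ y)
    refine le_of_sq_le_sq ?_ (by positivity)
    rw [h1]
    nlinarith [pow_le_pow_left₀ h3 h2 2]
  have hFS := continuousOn_closedSubgraph_of_tsupport_subset hγ hU h hFU hF0
  have hFΦ : Continuous fun y => F (Φ y) :=
    hFS.comp_continuous hΦc fun y => graphChart_mem_closedSubgraph.2 le_rfl
  have hz : ∀ x ∉ U, F x = 0 := fun x hx => image_eq_zero_of_notMem_tsupport fun h' => hx (hFU h')
  have hcΦ : HasCompactSupport fun y => F (Φ y) :=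
    hc.comp_isClosedEmbedding ((antilipschitzWith_graph M x₀ γ).isClosedEmbedding
      (lipschitzWith_graph M x₀ hγ hδ).uniformContinuous)
  set m : Measure (E n) := Measure.comap Φ μHE[n] with hm
  have hm1 := volume_le_comap_graph M x₀ hγ hδ
  have hm2 := comap_graph_le_smul_volume M x₀ hγ hδ
  -- the volume integral
  have hvol : ∫ x in Ω, divergence F x = ∫ y, inner ℝ (F (Φ y)) (ν y) := by
    have hd : ∀ x ∉ U, divergence F x = 0 := fun x hx =>
      divergence_eq_zero_of_notMem_tsupport fun h' => hx (hFU h')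
    have hind := indicator_eq_indicator_subgraph h hd
    have hmeas := (isOpen_subgraph M x₀ hγ).measurableSet
    rw [← integral_indicator hΩ.measurableSet, hind, integral_indicator hmeas]
    refine integral_divergence_subgraph M x₀ hγ hc
      (contDiffOn_subgraph_of_tsupport_subset hΩ h hFU hF) hFS ?_
    rw [← integrable_indicator_iff hmeas, ← hind, integrable_indicator_iff hΩ.measurableSet]
    exact hint
  set g : E n → ℝ := fun y => inner ℝ (F (Φ y)) (ν y) / ‖ν y‖ with hg
  have hgc : Continuous g := (hFΦ.inner hνc).div hνc.norm fun y => (zero_lt_one.trans_le (hν1 y)).ne'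
  have hgint : Integrable g := hgc.integrable_of_hasCompactSupport
    (hcΦ.mono fun y hy hy0 => hy (by simp [hg, hy0]))
  have hgF : ∀ y, |g y| ≤ ‖F (Φ y)‖ := by
    intro y
    have h0 := zero_lt_one.trans_le (hν1 y)
    rw [hg, abs_div, abs_of_pos h0, div_le_iff₀ h0]
    exact abs_real_inner_le_norm _ _
  have hbd : ∫ x in frontier Ω, inner ℝ (F x) (outwardNormal Ω x) ∂μHE[n] = ∫ y, g y ∂m := by
    rw [setIntegral_frontier_eq_of_graph hΩ hγ hδ hU h fun x hx => by simp [hz x hx]]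
    refine integral_congr_ae (ae_of_all _ fun y => ?_)
    change inner ℝ (F (Φ y)) (outwardNormal Ω (Φ y)) = g y
    by_cases hy : Φ y ∈ U
    · have hyf : Φ y ∈ frontier Ω := by
        rw [mem_frontier_iff_of_graph hΩ hγ hU h hy, hΦ, graphCoord_graphChart]
      rw [outwardNormal_eq_of_graph hΩ hγ hU h hy hyf]
      simp only [hΦ, graphCoord_graphChart, hg, inner_smul_right]
      rw [inv_mul_eq_div]
    · simp [hg, hz _ hy]
  have hnm : ∫ x in frontier Ω, ‖F x‖ ∂μHE[n] = ∫ y, ‖F (Φ y)‖ ∂m :=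
    setIntegral_frontier_eq_of_graph hΩ hγ hδ hU h fun x hx => by simp [hz x hx]
  have hFint : Integrable (fun y => ‖F (Φ y)‖) :=
    hFΦ.norm.integrable_of_hasCompactSupport hcΦ.norm
  obtain ⟨hFm, -⟩ := abs_integral_sub_integral_le_of_le_smul hm1 hm2 hFint
  obtain ⟨-, hest⟩ := abs_integral_sub_integral_le_of_le_smul hm1 hm2 hgint
  have hmono : ∫ y, ‖F (Φ y)‖ ≤ ∫ y, ‖F (Φ y)‖ ∂m :=
    integral_mono_measure hm1 (ae_of_all _ fun y => norm_nonneg _) hFm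
  have hgF' : ∫ y, |g y| ≤ ∫ y, ‖F (Φ y)‖ ∂m := (integral_mono hgint.abs hFint hgF).trans hmono
  have hνint : Integrable fun y => inner ℝ (F (Φ y)) (ν y) :=
    (hFΦ.inner hνc).integrable_of_hasCompactSupport
      (hcΦ.mono fun y hy hy0 => hy (by simp [hy0]))
  have hdiff : |(∫ y, inner ℝ (F (Φ y)) (ν y)) - ∫ y, g y| ≤ δ * ∫ y, |g y| := by
    rw [← integral_sub hνint hgint, ← integral_const_mul]
    refine (abs_integral_le_integral_abs).trans
      (integral_mono (hνint.sub hgint).abs (hgint.abs.const_mul _) fun y => ?_)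
    have h0 := zero_lt_one.trans_le (hν1 y)
    have : inner ℝ (F (Φ y)) (ν y) = g y * ‖ν y‖ := by
      rw [hg, div_mul_cancel₀ _ h0.ne']
    simp only [this]
    rw [show g y * ‖ν y‖ - g y = (‖ν y‖ - 1) * g y by ring, abs_mul,
      abs_of_nonneg (by linarith [hν1 y])]
    gcongr
    linarith [hν2 y]
  rw [hvol, hbd, hnm]
  have h1δ : (0 : ℝ) ≤ (1 + δ) ^ n - 1 :=
    sub_nonneg.2 (one_le_pow₀ (le_add_of_nonneg_right δ.2))
  push_cast at hest
  calc |(∫ y, inner ℝ (F (Φ y)) (ν y)) - ∫ y, g y ∂m|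
      ≤ |(∫ y, inner ℝ (F (Φ y)) (ν y)) - ∫ y, g y| + |(∫ y, g y) - ∫ y, g y ∂m| :=
        abs_sub_le _ _ _
    _ ≤ δ * (∫ y, |g y|) + ((1 + δ) ^ n - 1) * ∫ y, |g y| := by
        rw [abs_sub_comm (∫ y, g y) _]
        exact add_le_add hdiff hest
    _ = ((1 + δ) ^ n - 1 + δ) * ∫ y, |g y| := by ring
    _ ≤ _ := mul_le_mul_of_nonneg_left hgF' (add_nonneg h1δ δ.2)

end LocalGraph

theorem HasC1Boundary.exists_graph {Ω : Set (E (n + 1))} (hΩ : IsOpen Ω) (hreg : HasC1Boundary Ω)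
    {x₀ : E (n + 1)} (hx₀ : x₀ ∈ frontier Ω) {δ : NNReal} (hδ : 0 < δ) :
    ∃ (M : Frame n) (γ : E n → ℝ) (U : Set (E (n + 1))), ContDiff ℝ 1 γ ∧ γ 0 = 0 ∧
      fderiv ℝ γ 0 = 0 ∧ (∀ y, ‖fderiv ℝ γ y‖ ≤ δ) ∧ IsOpen U ∧ x₀ ∈ U ∧
      ∀ x ∈ U, x ∈ Ω ↔ x ∈ subgraph M x₀ γ := by
  obtain ⟨φ, hφ⟩ := hreg x₀ hx₀
  exact hφ.exists_graph hΩ hx₀ (NNReal.coe_pos.2 hδ)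

theorem continuousOn_outwardNormal {Ω : Set (E (n + 1))} (hΩ : IsOpen Ω)
    (hreg : HasC1Boundary Ω) : ContinuousOn (outwardNormal Ω) (frontier Ω) := by
  intro x hx
  obtain ⟨M, γ, U, hγ, -, -, -, hU, hxU, h⟩ := hreg.exists_graph hΩ hx one_pos
  have hc : Continuous fun z => ‖graphNormal M γ (graphCoord M x γ z).1‖⁻¹ •
      graphNormal M γ (graphCoord M x γ z).1 := by
    have h1 : Continuous fun z => graphNormal M γ (graphCoord M x γ z).1 :=
      (continuous_graphNormal M hγ).comp (contDiff_graphCoord M x hγ).continuous.fst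
    exact (h1.norm.inv₀ fun z => (zero_lt_one.trans_le (one_le_norm_graphNormal _ _ _)).ne').smul h1
  refine hc.continuousWithinAt.congr_of_eventuallyEq ?_
    (outwardNormal_eq_of_graph hΩ hγ hU h hxU hx)
  filter_upwards [self_mem_nhdsWithin, nhdsWithin_le_nhds (hU.mem_nhds hxU)] with z hz hzU
  exact outwardNormal_eq_of_graph hΩ hγ hU h hzU hz

/-- By compactness it suffices to argue locally, where the frontier lies in a Lipschitz image of a
ball. -/
theorem euclideanHausdorffMeasure_frontier_lt_top {Ω : Set (E (n + 1))} (hΩ : IsOpen Ω)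
    (hcpt : IsCompact (closure Ω)) (hreg : HasC1Boundary Ω) : μHE[n] (frontier Ω) < ⊤ := by
  have hfc : IsCompact (frontier Ω) := hcpt.of_isClosed_subset isClosed_frontier
    frontier_subset_closure
  refine hfc.measure_lt_top_of_nhdsWithin fun x hx => ?_
  obtain ⟨M, γ, U, hγ, -, -, hδ, hU, hxU, h⟩ := hreg.exists_graph hΩ hx one_pos
  refine ⟨frontier Ω ∩ (U ∩ (fun z => (graphCoord M x γ z).1) ⁻¹' Metric.ball 0 1),
    inter_mem self_mem_nhdsWithin (nhdsWithin_le_nhds (inter_mem (hU.mem_nhds hxU) ?_)), ?_⟩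
  · refine (contDiff_graphCoord M x hγ).continuous.fst.continuousAt.preimage_mem_nhds
      (Metric.isOpen_ball.mem_nhds ?_)
    simp [graphCoord]
  · have hsub : frontier Ω ∩ (U ∩ (fun z => (graphCoord M x γ z).1) ⁻¹' Metric.ball 0 1) ⊆
        (fun y => graphChart M x γ (y, 0)) '' Metric.ball 0 1 := by
      rintro z ⟨hz, hzU, hzb⟩
      refine ⟨(graphCoord M x γ z).1, hzb, ?_⟩
      have h0 := (mem_frontier_iff_of_graph hΩ hγ hU h hzU).1 hz
      have : ((graphCoord M x γ z).1, (0 : ℝ)) = graphCoord M x γ z := by rw [← h0]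
      simp only [this, graphChart_graphCoord]
    refine (measure_mono hsub).trans_lt ?_
    rw [← (measurableEmbedding_graph M x hγ hδ).comap_apply]
    refine (comap_graph_le_smul_volume M x hγ hδ _).trans_lt ?_
    rw [Measure.smul_apply, ENNReal.smul_def, smul_eq_mul]
    exact ENNReal.mul_lt_top ENNReal.coe_lt_top Metric.isBounded_ball.measure_lt_top

theorem integrableOn_frontier {Ω : Set (E (n + 1))} (hΩ : IsOpen Ω)
    (hcpt : IsCompact (closure Ω)) (hreg : HasC1Boundary Ω) {g : E (n + 1) → ℝ}
    (hg : ContinuousOn g (frontier Ω)) : IntegrableOn g (frontier Ω) μHE[n] := by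
  have hfc : IsCompact (frontier Ω) := hcpt.of_isClosed_subset isClosed_frontier
    frontier_subset_closure
  obtain ⟨C, hC⟩ := hfc.exists_bound_of_continuousOn hg
  exact IntegrableOn.of_bound (euclideanHausdorffMeasure_frontier_lt_top hΩ hcpt hreg)
    (hg.aestronglyMeasurable hfc.measurableSet) C
    (ae_restrict_of_forall_mem hfc.measurableSet hC)

theorem exists_pow_sub_one_add_le (n : ℕ) {ε : ℝ} (hε : 0 < ε) :
    ∃ δ : NNReal, 0 < δ ∧ ((1 + δ : ℝ)) ^ n - 1 + δ ≤ ε := by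
  have hc : ContinuousAt (fun t : ℝ => (1 + t) ^ n - 1 + t) 0 := by fun_prop
  have h1 : ∀ᶠ t in 𝓝 (0 : ℝ), (1 + t) ^ n - 1 + t < ε := hc.eventually (gt_mem_nhds (by simpa))
  obtain ⟨r, hr, hball⟩ := Metric.eventually_nhds_iff_ball.1 h1
  refine ⟨⟨r / 2, by positivity⟩, NNReal.coe_pos.1 (half_pos hr), ?_⟩
  refine (hball (r / 2) ?_).le
  rw [Metric.mem_ball, dist_zero_right, Real.norm_of_nonneg (by positivity)]
  linarith

/-- Every point of the closure has a neighbourhood in which the divergence theorem holds up to a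
small relative error. -/
theorem exists_isOpen_abs_integral_divergence_sub_le {Ω : Set (E (n + 1))} (hΩ : IsOpen Ω)
    (hreg : HasC1Boundary Ω) {x₀ : E (n + 1)} (hx₀ : x₀ ∈ closure Ω) {ε : ℝ} (hε : 0 < ε) :
    ∃ U : Set (E (n + 1)), IsOpen U ∧ x₀ ∈ U ∧ ∀ F : E (n + 1) → E (n + 1), tsupport F ⊆ U →
      ContDiffOn ℝ 1 F Ω → ContinuousOn F (closure Ω) → IntegrableOn (divergence F) Ω →
      |(∫ x in Ω, divergence F x) - ∫ x in frontier Ω, inner ℝ (F x) (outwardNormal Ω x) ∂μHE[n]| ≤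
        ε * ∫ x in frontier Ω, ‖F x‖ ∂μHE[n] := by
  have hcs : ∀ {U : Set (E (n + 1))} {F : E (n + 1) → E (n + 1)},
      tsupport F ⊆ U ∩ Metric.ball x₀ 1 → HasCompactSupport F := fun hF =>
    Metric.isCompact_of_isClosed_isBounded (isClosed_tsupport _)
      (Metric.isBounded_ball.subset (hF.trans inter_subset_right))
  by_cases hxΩ : x₀ ∈ Ω
  -- At an interior point both integrals vanish; intersecting with a ball makes the support compact.
  · refine ⟨Ω ∩ Metric.ball x₀ 1, hΩ.inter Metric.isOpen_ball, ⟨hxΩ, by simp⟩,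
      fun F hFU hF hF0 hint => ?_⟩
    have hFc : ContDiff ℝ 1 F := by
      refine contDiff_iff_contDiffAt.2 fun x => ?_
      by_cases hx : x ∈ Ω
      · exact hF.contDiffAt (hΩ.mem_nhds hx)
      · exact contDiffAt_const.congr_of_eventuallyEq
          (notMem_tsupport_iff_eventuallyEq.1 fun h => hx (hFU h).1)
    have h1 : ∫ x in Ω, divergence F x = 0 := by
      rw [setIntegral_eq_integral_of_forall_compl_eq_zero fun x hx =>
        divergence_eq_zero_of_notMem_tsupport fun h => hx (hFU h).1]
      exact (integral_divergence_eq_zero hFc (hcs hFU)).2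
    have h2 : ∫ x in frontier Ω, inner ℝ (F x) (outwardNormal Ω x) ∂μHE[n] = 0 := by
      refine setIntegral_eq_zero_of_forall_eq_zero fun x hx => ?_
      rw [hΩ.frontier_eq] at hx
      rw [image_eq_zero_of_notMem_tsupport fun h => hx.2 (hFU h).1, inner_zero_left]
    rw [h1, h2, sub_zero, abs_zero]
    exact mul_nonneg hε.le (integral_nonneg fun x => norm_nonneg _)
  · have hxf : x₀ ∈ frontier Ω := by
      rw [hΩ.frontier_eq]; exact ⟨hx₀, hxΩ⟩
    obtain ⟨δ, hδ0, hδ⟩ := exists_pow_sub_one_add_le n hε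
    obtain ⟨M, γ, U, hγ, -, -, hγδ, hU, hxU, h⟩ := hreg.exists_graph hΩ hxf hδ0
    refine ⟨U ∩ Metric.ball x₀ 1, hU.inter Metric.isOpen_ball, ⟨hxU, by simp⟩,
      fun F hFU hF hF0 hint => ?_⟩
    refine (abs_integral_divergence_sub_le_of_graph hΩ hγ hγδ hU h (hcs hFU)
      (hFU.trans inter_subset_left) hF hF0 hint).trans ?_
    exact mul_le_mul_of_nonneg_right hδ (integral_nonneg fun x => norm_nonneg _)

theorem integrableOn_divergence_smul {Ω : Set (E N)} (hΩ : IsOpen Ω)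
    (hcpt : IsCompact (closure Ω)) {χ : E N → ℝ} (hχ : ContDiff ℝ 1 χ) {F : E N → E N}
    (hF : ContDiffOn ℝ 1 F Ω) (hF0 : ContinuousOn F (closure Ω))
    (hint : IntegrableOn (divergence F) Ω) :
    IntegrableOn (divergence fun y => χ y • F y) Ω := by
  obtain ⟨C, hC⟩ := hcpt.exists_bound_of_continuousOn hχ.continuous.continuousOn
  have h1 : IntegrableOn (fun x => χ x * divergence F x) Ω :=
    Integrable.bdd_mul hint hχ.continuous.aestronglyMeasurable
      (ae_restrict_of_forall_mem hΩ.measurableSet fun x hx => hC x (subset_closure hx))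
  have h2 : IntegrableOn (fun x => inner ℝ (gradient χ x) (F x)) Ω :=
    (((continuous_gradient hχ).continuousOn.inner hF0).integrableOn_compact hcpt).mono_set
      subset_closure
  refine (h1.add h2).congr_fun (fun x hx => ?_) hΩ.measurableSet
  exact (divergence_smul (hχ.differentiable one_ne_zero x)
    ((hF.contDiffAt (hΩ.mem_nhds hx)).differentiableAt one_ne_zero)).symm

/-- **Divergence theorem** on a bounded `C¹` domain, for a field that is `C¹` inside, continuous up
to the boundary, and has integrable divergence. -/
theorem integral_divergence_eq {Ω : Set (E (n + 1))} (hΩ : IsOpen Ω)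
    (hcpt : IsCompact (closure Ω)) (hreg : HasC1Boundary Ω) {F : E (n + 1) → E (n + 1)}
    (hF : ContDiffOn ℝ 1 F Ω) (hF0 : ContinuousOn F (closure Ω))
    (hint : IntegrableOn (divergence F) Ω) :
    ∫ x in Ω, divergence F x =
      ∫ x in frontier Ω, inner ℝ (F x) (outwardNormal Ω x) ∂μHE[n] := by
  -- The local errors are relative: each is ε times the integral of |χᵢ F|. As the χᵢ are
  -- nonnegative with sum 1 on the closure, they add up to ε ∫|F| however many patches are used.
  have key : ∀ ε > 0, |(∫ x in Ω, divergence F x) -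
      ∫ x in frontier Ω, inner ℝ (F x) (outwardNormal Ω x) ∂μHE[n]| ≤
        ε * ∫ x in frontier Ω, ‖F x‖ ∂μHE[n] := by
    intro ε hε
    choose! U hU hxU hest using fun x (hx : x ∈ closure Ω) =>
      exists_isOpen_abs_integral_divergence_sub_le hΩ hreg hx hε
    obtain ⟨t, htΩ, htc⟩ := hcpt.elim_nhds_subcover U fun x hx => (hU x hx).mem_nhds (hxU x hx)
    obtain ⟨χ, hχ⟩ := SmoothPartitionOfUnity.exists_isSubordinate (modelWithCornersSelf ℝ (E (n + 1)))
      (isClosed_closure (s := Ω)) (fun i : t => U i) (fun i => hU i (htΩ i i.2)) (by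
        intro x hx
        obtain ⟨i, hi, hxi⟩ := mem_iUnion₂.1 (htc hx)
        exact mem_iUnion.2 ⟨⟨i, hi⟩, hxi⟩)
    have hχs : ∀ i : t, ContDiff ℝ 1 (χ i) := fun i =>
      (χ i).contMDiff.contDiff.of_le (by simp)
    have hsum : ∀ x ∈ closure Ω, ∑ i, χ i x = 1 := fun x hx => by
      rw [← finsum_eq_sum_of_fintype]; exact χ.sum_eq_one hx
    have hFi : ∀ i, ContDiffOn ℝ 1 (fun y => χ i y • F y) Ω := fun i =>
      (hχs i).contDiffOn.smul hF
    have hFi0 : ∀ i, ContinuousOn (fun y => χ i y • F y) (closure Ω) := fun i =>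
      (hχs i).continuous.continuousOn.smul hF0
    have hinti : ∀ i, IntegrableOn (divergence fun y => χ i y • F y) Ω := fun i =>
      integrableOn_divergence_smul hΩ hcpt (hχs i) hF hF0 hint
    have hlhs : ∫ x in Ω, divergence F x = ∑ i, ∫ x in Ω, divergence (fun y => χ i y • F y) x := by
      rw [← integral_finsetSum _ fun i _ => hinti i]
      refine setIntegral_congr_fun hΩ.measurableSet fun x hx => ?_
      have hd : ∀ i ∈ Finset.univ, DifferentiableAt ℝ (fun y => χ i y • F y) x := fun i _ =>
        ((hFi i).contDiffAt (hΩ.mem_nhds hx)).differentiableAt one_ne_zero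
      rw [← divergence_sum _ hd]
      refine divergence_congr ?_
      filter_upwards [hΩ.mem_nhds hx] with z hz
      rw [← Finset.sum_smul, hsum z (subset_closure hz), one_smul]
    have hrhs : ∫ x in frontier Ω, inner ℝ (F x) (outwardNormal Ω x) ∂μHE[n] =
        ∑ i, ∫ x in frontier Ω, inner ℝ (χ i x • F x) (outwardNormal Ω x) ∂μHE[n] := by
      rw [← integral_finsetSum _ fun i _ => integrableOn_frontier hΩ hcpt hreg
        (((hFi0 i).mono frontier_subset_closure).inner (continuousOn_outwardNormal hΩ hreg))]
      refine setIntegral_congr_fun isClosed_frontier.measurableSet fun x hx => ?_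
      rw [← sum_inner, ← Finset.sum_smul, hsum x (frontier_subset_closure hx), one_smul]
    have hnorm : ∫ x in frontier Ω, ‖F x‖ ∂μHE[n] =
        ∑ i, ∫ x in frontier Ω, ‖χ i x • F x‖ ∂μHE[n] := by
      rw [← integral_finsetSum _ fun i _ => integrableOn_frontier hΩ hcpt hreg
        ((hFi0 i).mono frontier_subset_closure).norm]
      refine setIntegral_congr_fun isClosed_frontier.measurableSet fun x hx => ?_
      simp only [norm_smul]
      rw [← Finset.sum_mul]
      have : ∑ i, ‖χ i x‖ = 1 := by
        rw [← hsum x (frontier_subset_closure hx)]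
        exact Finset.sum_congr rfl fun i _ => Real.norm_of_nonneg (χ.nonneg i x)
      rw [this, one_mul]
    rw [hlhs, hrhs, hnorm, ← Finset.sum_sub_distrib, Finset.mul_sum]
    refine (Finset.abs_sum_le_sum_abs _ _).trans (Finset.sum_le_sum fun i _ => ?_)
    refine hest i (htΩ i i.2) _ ?_ (hFi i) (hFi0 i) (hinti i)
    exact (tsupport_smul_subset_left _ _).trans (hχ i)
  have h0 : |(∫ x in Ω, divergence F x) -
      ∫ x in frontier Ω, inner ℝ (F x) (outwardNormal Ω x) ∂μHE[n]| ≤ 0 := by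
    have hlim : Tendsto (fun ε : ℝ => ε * ∫ x in frontier Ω, ‖F x‖ ∂μHE[n]) (𝓝[>] 0) (𝓝 0) := by
      have : ContinuousAt (fun ε : ℝ => ε * ∫ x in frontier Ω, ‖F x‖ ∂μHE[n]) 0 := by fun_prop
      simpa [ContinuousAt] using this.mono_left nhdsWithin_le_nhds
    refine ge_of_tendsto hlim ?_
    filter_upwards [self_mem_nhdsWithin] with ε hε using key ε hε
  exact sub_eq_zero.1 (abs_nonpos_iff.1 h0)

/-! ### Radial cutoffs and the divergence theorem on punctured domains -/

/-- A smooth radial cutoff that vanishes for `k |x| ≤ 1` and equals `1` for `k² |x|² ≥ 2`. -/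
def cutoff (k : ℝ) (x : E N) : ℝ := Real.smoothTransition (k ^ 2 * ‖x‖ ^ 2 - 1)

theorem contDiff_cutoff (k : ℝ) : ContDiff ℝ 1 (cutoff k : E N → ℝ) :=
  (Real.smoothTransition.contDiff (n := 1)).comp
    ((contDiff_const.mul (contDiff_norm_sq ℝ)).sub contDiff_const)

theorem cutoff_nonneg (k : ℝ) (x : E N) : 0 ≤ cutoff k x := Real.smoothTransition.nonneg _

theorem cutoff_le_one (k : ℝ) (x : E N) : cutoff k x ≤ 1 := Real.smoothTransition.le_one _

theorem cutoff_eq_one {k : ℝ} {x : E N} (h : 2 ≤ k ^ 2 * ‖x‖ ^ 2) : cutoff k x = 1 :=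
  Real.smoothTransition.one_of_one_le (by linarith)

theorem cutoff_eventuallyEq_zero (k : ℝ) : (cutoff k : E N → ℝ) =ᶠ[𝓝 0] fun _ => 0 := by
  have : ∀ᶠ x in 𝓝 (0 : E N), k ^ 2 * ‖x‖ ^ 2 < 1 :=
    (by fun_prop : Continuous fun x : E N => k ^ 2 * ‖x‖ ^ 2).continuousAt.eventually
      (gt_mem_nhds (by simp))
  filter_upwards [this] with x hx
  exact Real.smoothTransition.zero_of_nonpos (by linarith)

theorem gradient_cutoff (k : ℝ) (x : E N) :
    gradient (cutoff k) x = (2 * k ^ 2 * deriv Real.smoothTransition (k ^ 2 * ‖x‖ ^ 2 - 1)) • x := by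
  refine ext_inner_right ℝ fun v => ?_
  have hd : HasDerivAt Real.smoothTransition (deriv Real.smoothTransition (k ^ 2 * ‖x‖ ^ 2 - 1))
      (k ^ 2 * ‖x‖ ^ 2 - 1) :=
    ((Real.smoothTransition.contDiff (n := 1)).differentiable (by simp) _).hasDerivAt
  have h1 := ((hasStrictFDerivAt_norm_sq x).hasFDerivAt.const_mul (k ^ 2)).sub_const 1
  have h2 : HasFDerivAt (cutoff k) _ x := hd.comp_hasFDerivAt x h1
  rw [inner_gradient_left, h2.fderiv, real_inner_smul_left]
  simp
  ring

/-- The cutoff increases radially. In the Hardy inequality this sign lets the cutoff term be dropped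
rather than estimated. -/
theorem inner_gradient_cutoff_nonneg (k : ℝ) (x : E N) :
    0 ≤ inner ℝ (gradient (cutoff k) x) x := by
  rw [gradient_cutoff, real_inner_smul_left, real_inner_self_eq_norm_sq]
  have := Real.smoothTransition.monotone.deriv_nonneg (x := k ^ 2 * ‖x‖ ^ 2 - 1)
  positivity

/-- Scale invariance: the product depends on k and x only through s = k²|x|², and the derivative of
the transition vanishes unless 1 ≤ s ≤ 2. -/
theorem exists_norm_gradient_cutoff_le :
    ∃ C, 0 ≤ C ∧ ∀ (k : ℝ) (x : E N), ‖gradient (cutoff k) x‖ * ‖x‖ ≤ C := by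
  have hc : Continuous (deriv Real.smoothTransition) :=
    (Real.smoothTransition.contDiff (n := 1)).continuous_deriv (by simp)
  obtain ⟨B, hB⟩ := (isCompact_Icc (a := (0 : ℝ)) (b := 1)).exists_bound_of_continuousOn
    hc.continuousOn
  have hB0 : 0 ≤ B := (norm_nonneg _).trans (hB 0 (by simp))
  refine ⟨4 * B, by positivity, fun k x => ?_⟩
  rw [gradient_cutoff, norm_smul, Real.norm_eq_abs, abs_mul, abs_of_nonneg (by positivity)]
  set s := k ^ 2 * ‖x‖ ^ 2 with hs
  have hexp : 2 * k ^ 2 * |deriv Real.smoothTransition (s - 1)| * ‖x‖ * ‖x‖ =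
      2 * s * |deriv Real.smoothTransition (s - 1)| := by rw [hs]; ring
  rw [hexp]
  by_cases h : s - 1 ∈ Icc (0 : ℝ) 1
  · have h1 := hB _ h
    rw [Real.norm_eq_abs] at h1
    have h2 : s ≤ 2 := by linarith [h.2]
    have h3 : 0 ≤ s := by positivity
    nlinarith [abs_nonneg (deriv Real.smoothTransition (s - 1))]
  · have h0 : deriv Real.smoothTransition (s - 1) = 0 := by
      rw [mem_Icc, not_and_or, not_le, not_le] at h
      rcases h with h | h
      · have : Real.smoothTransition =ᶠ[𝓝 (s - 1)] fun _ => 0 := by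
          filter_upwards [Iio_mem_nhds h] with t ht
          exact Real.smoothTransition.zero_of_nonpos (le_of_lt ht)
        rw [this.deriv_eq]; simp
      · have : Real.smoothTransition =ᶠ[𝓝 (s - 1)] fun _ => 1 := by
          filter_upwards [Ioi_mem_nhds h] with t ht
          exact Real.smoothTransition.one_of_one_le (le_of_lt ht)
        rw [this.deriv_eq]; simp
    rw [h0]
    simpa using hB0

theorem eventually_cutoff_eq_one {x : E N} (hx : x ≠ 0) :
    ∀ᶠ k : ℕ in atTop, (cutoff (k : ℝ) : E N → ℝ) =ᶠ[𝓝 x] fun _ => 1 := by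
  have hx' : 0 < ‖x‖ := norm_pos_iff.2 hx
  obtain ⟨K, hK⟩ := exists_nat_gt (2 / ‖x‖)
  filter_upwards [eventually_ge_atTop K] with k hk
  have h1 : 2 < k * ‖x‖ := by
    rw [div_lt_iff₀ hx'] at hK
    exact hK.trans_le (by gcongr)
  have h2 : 2 < (k : ℝ) ^ 2 * ‖x‖ ^ 2 := by nlinarith
  have : ∀ᶠ z in 𝓝 x, 2 < (k : ℝ) ^ 2 * ‖z‖ ^ 2 :=
    (by fun_prop : Continuous fun z : E N => (k : ℝ) ^ 2 * ‖z‖ ^ 2).continuousAt.eventually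
      (lt_mem_nhds h2)
  filter_upwards [this] with z hz using cutoff_eq_one hz.le

/-- A point is null in positive dimension, so whatever values the weights and derivatives take at 0
are irrelevant to volume integrals. -/
theorem restrict_sdiff_zero (Ω : Set (E (n + 1))) :
    (volume : Measure (E (n + 1))).restrict (Ω \ {0}) = volume.restrict Ω :=
  Measure.restrict_congr_set (sdiff_null_ae_eq_self (by simp))

theorem sdiff_zero_mem_nhdsWithin {S : Set (E N)} {x : E N} (hx : x ≠ 0) : S \ {0} ∈ 𝓝[S] x :=
  inter_mem self_mem_nhdsWithin (nhdsWithin_le_nhds (isOpen_ne.mem_nhds hx))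

theorem continuousOn_cutoff_smul {X : Type*} [NormedAddCommGroup X] [NormedSpace ℝ X] {S : Set (E N)}
    {F : E N → X} (hF : ContinuousOn F (S \ {0})) {η : E N → ℝ}
    (hη : Continuous η) (h0 : η =ᶠ[𝓝 0] fun _ => 0) : ContinuousOn (fun x => η x • F x) S := by
  intro x hx
  by_cases hx0 : x = 0
  · subst hx0
    refine ContinuousAt.continuousWithinAt ((continuousAt_const (y := (0 : X))).congr ?_)
    filter_upwards [h0] with z hz
    rw [hz, zero_smul]
  · refine hη.continuousWithinAt.smul ((hF x ⟨hx, hx0⟩).mono_of_mem_nhdsWithin ?_)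
    exact sdiff_zero_mem_nhdsWithin hx0

theorem contDiffOn_cutoff_smul {Ω : Set (E N)} (hΩ : IsOpen Ω) {F : E N → E N}
    (hF : ContDiffOn ℝ 1 F (Ω \ {0})) (k : ℝ) : ContDiffOn ℝ 1 (fun x => cutoff k x • F x) Ω := by
  intro x hx
  by_cases hx0 : x = 0
  · subst hx0
    refine (contDiffAt_const (c := (0 : E N))).congr_of_eventuallyEq ?_ |>.contDiffWithinAt
    filter_upwards [cutoff_eventuallyEq_zero k] with z hz
    rw [hz, zero_smul]
  · have hopen : IsOpen (Ω \ {0}) := hΩ.sdiff isClosed_singleton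
    exact ((contDiff_cutoff k).contDiffAt.smul
      (hF.contDiffAt (hopen.mem_nhds ⟨hx, hx0⟩))).contDiffWithinAt

theorem divergence_cutoff_smul {Ω : Set (E N)} (hΩ : IsOpen Ω) {F : E N → E N}
    (hF : ContDiffOn ℝ 1 F (Ω \ {0})) (k : ℝ) {x : E N} (hx : x ∈ Ω \ {0}) :
    divergence (fun x => cutoff k x • F x) x =
      cutoff k x * divergence F x + inner ℝ (gradient (cutoff k) x) (F x) :=
  divergence_smul ((contDiff_cutoff k).differentiable one_ne_zero x)
    ((hF.contDiffAt ((hΩ.sdiff isClosed_singleton).mem_nhds hx)).differentiableAt one_ne_zero)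

/-- The divergence theorem for a field that vanishes on the boundary and is cut off near `0`. -/
theorem integral_cutoff_divergence {Ω : Set (E (n + 1))} (hΩ : IsOpen Ω)
    (hcpt : IsCompact (closure Ω)) (hreg : HasC1Boundary Ω) {F : E (n + 1) → E (n + 1)}
    {D : E (n + 1) → ℝ} (hF : ContDiffOn ℝ 1 F (Ω \ {0})) (hF0 : ContinuousOn F (closure Ω \ {0}))
    (hD : ContinuousOn D (closure Ω \ {0})) (hFD : ∀ x ∈ Ω \ {0}, divergence F x = D x)
    (hbd : ∀ x ∈ frontier Ω, F x = 0) (k : ℝ) :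
    IntegrableOn (fun x => cutoff k x * D x) Ω ∧
      IntegrableOn (fun x => inner ℝ (gradient (cutoff k) x) (F x)) Ω ∧
      (∫ x in Ω, cutoff k x * D x) + ∫ x in Ω, inner ℝ (gradient (cutoff k) x) (F x) = 0 := by
  have hη := contDiff_cutoff (N := n + 1) k
  have hη0 := cutoff_eventuallyEq_zero (N := n + 1) k
  -- The extension D of the divergence is continuous on the closure away from 0, so after cutting
  -- off, compactness gives integrability; `divergence F` itself carries no information on the
  -- boundary.
  have h1 : IntegrableOn (fun x => cutoff k x * D x) Ω :=
    ((continuousOn_cutoff_smul hD hη.continuous hη0).integrableOn_compact hcpt).mono_set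
      subset_closure
  have h2 : IntegrableOn (fun x => inner ℝ (gradient (cutoff k) x) (F x)) Ω := by
    suffices hcont : ContinuousOn (fun x => inner ℝ (gradient (cutoff k) x) (F x)) (closure Ω) from
      (hcont.integrableOn_compact hcpt).mono_set subset_closure
    intro x hx
    by_cases hx0 : x = 0
    · subst hx0
      refine ContinuousAt.continuousWithinAt ((continuousAt_const (y := (0 : ℝ))).congr ?_)
      filter_upwards [hη0.eventuallyEq_nhds] with z hz
      rw [inner_gradient_left, hz.fderiv_eq]
      simp
    · exact (continuous_gradient hη).continuousWithinAt.inner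
        ((hF0 x ⟨hx, hx0⟩).mono_of_mem_nhdsWithin (sdiff_zero_mem_nhdsWithin hx0))
  refine ⟨h1, h2, ?_⟩
  have heq : ∀ᵐ x ∂(volume.restrict Ω), divergence (fun x => cutoff k x • F x) x =
      cutoff k x * D x + inner ℝ (gradient (cutoff k) x) (F x) := by
    rw [← restrict_sdiff_zero]
    refine ae_restrict_of_forall_mem (hΩ.sdiff isClosed_singleton).measurableSet fun x hx => ?_
    rw [divergence_cutoff_smul hΩ hF k hx, hFD x hx]
  have hdiv := integral_divergence_eq hΩ hcpt hreg (contDiffOn_cutoff_smul hΩ hF k)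
    (continuousOn_cutoff_smul hF0 hη.continuous hη0)
    ((h1.add h2).congr (heq.mono fun x hx => hx.symm))
  rw [integral_congr_ae heq, integral_add h1 h2] at hdiv
  rw [hdiv]
  exact setIntegral_eq_zero_of_forall_eq_zero fun x hx => by simp [hbd x hx]

/-- **Divergence theorem** for a field that may be singular at the origin. -/
theorem integral_divergence_eq_of_punctured {Ω : Set (E (n + 1))} (hΩ : IsOpen Ω)
    (hcpt : IsCompact (closure Ω)) (hreg : HasC1Boundary Ω) (h0 : 0 ∉ frontier Ω)
    {F : E (n + 1) → E (n + 1)} (hF : ContDiffOn ℝ 1 F (Ω \ {0}))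
    (hF0 : ContinuousOn F (closure Ω \ {0})) (hint : IntegrableOn (divergence F) Ω)
    (hFx : IntegrableOn (fun x => ‖F x‖ / ‖x‖) Ω) :
    ∫ x in Ω, divergence F x =
      ∫ x in frontier Ω, inner ℝ (F x) (outwardNormal Ω x) ∂μHE[n] := by
  have hopen : IsOpen (Ω \ {0}) := hΩ.sdiff isClosed_singleton
  obtain ⟨C, hC0, hC⟩ := exists_norm_gradient_cutoff_le (N := n + 1)
  have hbound : ∀ (k : ℝ) (x : E (n + 1)), x ≠ 0 →
      ‖inner ℝ (gradient (cutoff k) x) (F x)‖ ≤ C * (‖F x‖ / ‖x‖) := by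
    intro k x hx
    have hx' := norm_pos_iff.2 hx
    calc ‖inner ℝ (gradient (cutoff k) x) (F x)‖ ≤ ‖gradient (cutoff k) x‖ * ‖F x‖ :=
          norm_inner_le_norm _ _
      _ = (‖gradient (cutoff k) x‖ * ‖x‖) * (‖F x‖ / ‖x‖) := by field_simp
      _ ≤ _ := by gcongr; exact hC k x
  have hae : ∀ {p : E (n + 1) → Prop}, (∀ x ∈ Ω \ {0}, p x) → ∀ᵐ x ∂(volume.restrict Ω), p x := by
    intro p hp
    rw [← restrict_sdiff_zero]
    exact ae_restrict_of_forall_mem hopen.measurableSet hp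
  have hgm : ∀ k : ℝ, AEStronglyMeasurable (fun x => inner ℝ (gradient (cutoff k) x) (F x))
      (volume.restrict Ω) := by
    intro k
    rw [← restrict_sdiff_zero]
    exact ((continuous_gradient (contDiff_cutoff k)).continuousOn.inner
      hF.continuousOn).aestronglyMeasurable hopen.measurableSet
  have h2 : ∀ k : ℝ, IntegrableOn (fun x => inner ℝ (gradient (cutoff k) x) (F x)) Ω := fun k =>
    (hFx.const_mul C).mono' (hgm k) (hae fun x hx => hbound k x hx.2)
  have h1 : ∀ k : ℝ, IntegrableOn (fun x => cutoff k x * divergence F x) Ω := fun k =>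
    Integrable.bdd_mul hint (contDiff_cutoff k).continuous.aestronglyMeasurable
      (ae_of_all _ fun x => by
        rw [Real.norm_of_nonneg (cutoff_nonneg k x)]; exact cutoff_le_one k x)
  have hdiv : ∀ k : ℝ, (∫ x in Ω, cutoff k x * divergence F x) +
      (∫ x in Ω, inner ℝ (gradient (cutoff k) x) (F x)) =
      ∫ x in frontier Ω, inner ℝ (cutoff k x • F x) (outwardNormal Ω x) ∂μHE[n] := by
    intro k
    have heq := hae fun x hx => divergence_cutoff_smul hΩ hF k hx
    rw [← integral_add (h1 k) (h2 k), ← integral_congr_ae heq]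
    exact integral_divergence_eq hΩ hcpt hreg (contDiffOn_cutoff_smul hΩ hF k)
      (continuousOn_cutoff_smul hF0 (contDiff_cutoff k).continuous (cutoff_eventuallyEq_zero k))
      (((h1 k).add (h2 k)).congr (heq.mono fun x hx => hx.symm))
  -- Since 0 is off the frontier, a whole ball around it is, so for large k the boundary term does
  -- not see the cutoff.
  have hev : ∀ᶠ k : ℕ in atTop, ∀ x ∈ frontier Ω, cutoff (k : ℝ) x = 1 := by
    obtain ⟨r, hr, hball⟩ := Metric.isOpen_iff.1 isClosed_frontier.isOpen_compl 0 h0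
    obtain ⟨K, hK⟩ := exists_nat_gt (2 / r)
    filter_upwards [eventually_ge_atTop K] with k hk x hx
    have hxr : r ≤ ‖x‖ := by
      by_contra! hlt
      exact hball (by simpa using hlt) hx
    have h1 : 2 < k * ‖x‖ := by
      rw [div_lt_iff₀ hr] at hK
      exact hK.trans_le (by gcongr)
    exact cutoff_eq_one (by nlinarith)
  have hlim1 : Tendsto (fun k : ℕ => ∫ x in Ω, cutoff (k : ℝ) x * divergence F x) atTop
      (𝓝 (∫ x in Ω, divergence F x)) := by
    refine tendsto_integral_of_dominated_convergence (fun x => ‖divergence F x‖)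
      (fun k => (h1 k).aestronglyMeasurable) hint.norm (fun k => ae_of_all _ fun x => ?_)
      (hae fun x hx => ?_)
    · rw [norm_mul, Real.norm_of_nonneg (cutoff_nonneg _ x)]
      exact mul_le_of_le_one_left (norm_nonneg _) (cutoff_le_one _ x)
    · refine tendsto_const_nhds.congr' ?_
      filter_upwards [eventually_cutoff_eq_one hx.2] with k hk
      rw [hk.self_of_nhds, one_mul]
  -- The integrand is dominated by C|F|/|x| uniformly in k, and at each x ≠ 0 it is eventually zero.
  have hlim2 : Tendsto (fun k : ℕ => ∫ x in Ω, inner ℝ (gradient (cutoff (k : ℝ)) x) (F x)) atTop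
      (𝓝 (∫ x in Ω, (0 : ℝ))) := by
    refine tendsto_integral_of_dominated_convergence (fun x => C * (‖F x‖ / ‖x‖))
      (fun k => hgm k) (hFx.const_mul C) (fun k => hae fun x hx => hbound k x hx.2)
      (hae fun x hx => ?_)
    refine tendsto_const_nhds.congr' ?_
    filter_upwards [eventually_cutoff_eq_one hx.2] with k hk
    rw [inner_gradient_left, hk.fderiv_eq]
    simp
  rw [integral_zero] at hlim2
  have hlim := hlim1.add hlim2
  rw [add_zero] at hlim
  refine tendsto_nhds_unique hlim (tendsto_const_nhds.congr' ?_)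
  filter_upwards [hev] with k hk
  rw [hdiv k]
  refine setIntegral_congr_fun isClosed_frontier.measurableSet fun x hx => ?_
  rw [hk x hx, one_smul]

/-- Monotone convergence along the cutoffs. -/
theorem integrableOn_of_cutoff {Ω : Set (E (n + 1))} (hΩ : IsOpen Ω) {g : E (n + 1) → ℝ}
    (hg : ContinuousOn g (Ω \ {0})) (hg0 : ∀ x ∈ Ω \ {0}, 0 ≤ g x) {B : ℝ}
    (hint : ∀ k : ℝ, IntegrableOn (fun x => cutoff k x * g x) Ω)
    (hB : ∀ k : ℝ, ∫ x in Ω, cutoff k x * g x ≤ B) : IntegrableOn g Ω := by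
  have hopen : IsOpen (Ω \ {0}) := hΩ.sdiff isClosed_singleton
  have hae : ∀ {p : E (n + 1) → Prop}, (∀ x ∈ Ω \ {0}, p x) → ∀ᵐ x ∂(volume.restrict Ω), p x := by
    intro p hp
    rw [← restrict_sdiff_zero]
    exact ae_restrict_of_forall_mem hopen.measurableSet hp
  have hgm : AEStronglyMeasurable g (volume.restrict Ω) := by
    rw [← restrict_sdiff_zero]
    exact hg.aestronglyMeasurable hopen.measurableSet
  have hlim : ∀ᵐ x ∂(volume.restrict Ω),
      Tendsto (fun k : ℕ => cutoff (k : ℝ) x * g x) atTop (𝓝 (g x)) := by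
    refine hae fun x hx => tendsto_const_nhds.congr' ?_
    filter_upwards [eventually_cutoff_eq_one hx.2] with k hk
    rw [hk.self_of_nhds, one_mul]
  -- Fatou's lemma suffices, so monotonicity of the cutoffs in k is never needed.
  have hfatou : ∫⁻ x in Ω, ‖g x‖ₑ ≤
      liminf (fun k : ℕ => ∫⁻ x in Ω, ‖cutoff (k : ℝ) x * g x‖ₑ) atTop := by
    rw [lintegral_congr_ae (g := fun x => liminf (fun k : ℕ => ‖cutoff (k : ℝ) x * g x‖ₑ) atTop)
      (hlim.mono fun x hx => hx.enorm.liminf_eq.symm)]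
    exact lintegral_liminf_le' fun k => (hint k).aestronglyMeasurable.aemeasurable.enorm
  refine ⟨hgm, hfatou.trans_lt (lt_top_iff_ne_top.2 ?_)⟩
  · have : ∀ k : ℕ, ∫⁻ x in Ω, ‖cutoff (k : ℝ) x * g x‖ₑ ≤ ENNReal.ofReal B := by
      intro k
      have hnn : ∀ᵐ x ∂(volume.restrict Ω), 0 ≤ cutoff (k : ℝ) x * g x :=
        hae fun x hx => mul_nonneg (cutoff_nonneg _ _) (hg0 x hx)
      have h1 : ∫⁻ x in Ω, ‖cutoff (k : ℝ) x * g x‖ₑ =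
          ENNReal.ofReal (∫ x in Ω, cutoff (k : ℝ) x * g x) := by
        rw [ofReal_integral_eq_lintegral_ofReal (hint k) hnn]
        refine lintegral_congr_ae (hnn.mono fun x hx => ?_)
        simp only
        rw [Real.enorm_eq_ofReal hx]
      rw [h1]
      exact ENNReal.ofReal_le_ofReal (hB k)
    refine ne_top_of_le_ne_top (ENNReal.ofReal_ne_top (r := B)) (liminf_le_of_le (by isBoundedDefault) ?_)
    intro b hb
    obtain ⟨k, hk⟩ := hb.exists
    exact hk.trans (this k)

/-! ### Calculus of radial functions on the Poincaré ball -/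

/-- `h` has gradient `c • x` at `x`. -/
def HasRadialDerivAt (h : E N → ℝ) (c : ℝ) (x : E N) : Prop :=
  HasFDerivAt h (c • innerSL ℝ x) x

namespace HasRadialDerivAt

variable {h h₁ h₂ : E N → ℝ} {c c₁ c₂ : ℝ} {x : E N}

theorem gradient_eq (hh : HasRadialDerivAt h c x) : gradient h x = c • x := by
  refine ext_inner_right ℝ fun v => ?_
  rw [inner_gradient_left, hh.fderiv, real_inner_smul_left]
  simp

theorem differentiableAt (hh : HasRadialDerivAt h c x) : DifferentiableAt ℝ h x :=
  HasFDerivAt.differentiableAt hh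

theorem const (a : ℝ) : HasRadialDerivAt (fun _ : E N => a) 0 x := by
  unfold HasRadialDerivAt
  rw [zero_smul]
  exact hasFDerivAt_const a x

theorem add (hh₁ : HasRadialDerivAt h₁ c₁ x) (hh₂ : HasRadialDerivAt h₂ c₂ x) :
    HasRadialDerivAt (fun y => h₁ y + h₂ y) (c₁ + c₂) x := by
  unfold HasRadialDerivAt
  rw [add_smul]
  exact HasFDerivAt.fun_add hh₁ hh₂

theorem mul (hh₁ : HasRadialDerivAt h₁ c₁ x) (hh₂ : HasRadialDerivAt h₂ c₂ x) :
    HasRadialDerivAt (fun y => h₁ y * h₂ y) (h₁ x * c₂ + h₂ x * c₁) x := by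
  unfold HasRadialDerivAt
  rw [add_smul, ← smul_smul, ← smul_smul]
  exact HasFDerivAt.fun_mul hh₁ hh₂

theorem const_mul (a : ℝ) (hh : HasRadialDerivAt h c x) :
    HasRadialDerivAt (fun y => a * h y) (a * c) x := by
  unfold HasRadialDerivAt
  rw [← smul_smul]
  exact HasFDerivAt.const_mul hh a

theorem comp {f : ℝ → ℝ} {f' : ℝ} (hf : HasDerivAt f f' (h x)) (hh : HasRadialDerivAt h c x) :
    HasRadialDerivAt (fun y => f (h y)) (f' * c) x := by
  unfold HasRadialDerivAt
  rw [← smul_smul]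
  exact hf.comp_hasFDerivAt x hh

theorem congr_deriv (hh : HasRadialDerivAt h c₁ x) (hc : c₁ = c₂) : HasRadialDerivAt h c₂ x :=
  hc ▸ hh

theorem divergence_smul_id (hh : HasRadialDerivAt h c x) :
    divergence (fun y => h y • y) x = N * h x + c * ‖x‖ ^ 2 := by
  rw [divergence_smul hh.differentiableAt differentiableAt_fun_id, divergence_id, hh.gradient_eq,
    real_inner_smul_left, real_inner_self_eq_norm_sq]
  ring

end HasRadialDerivAt

/-- The unit ball without its centre. -/
def puncturedBall (N : ℕ) : Set (E N) := Metric.ball 0 1 \ {0}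

theorem isOpen_puncturedBall : IsOpen (puncturedBall N) :=
  Metric.isOpen_ball.sdiff isClosed_singleton

section PuncturedBall

variable {x : E N}

theorem norm_pos_of_mem (hx : x ∈ puncturedBall N) : 0 < ‖x‖ := norm_pos_iff.2 hx.2

theorem norm_lt_one_of_mem (hx : x ∈ puncturedBall N) : ‖x‖ < 1 := by simpa using hx.1

theorem one_sub_norm_sq_pos (hx : x ∈ puncturedBall N) : 0 < 1 - ‖x‖ ^ 2 := by
  have h1 := norm_pos_of_mem hx
  have h2 := norm_lt_one_of_mem hx
  nlinarith

/-! ### Bounds and radial derivatives of ρ, d and |x|/d -/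

theorem rho_pos (hx : x ∈ puncturedBall N) : 0 < rho x :=
  div_pos two_pos (one_sub_norm_sq_pos hx)

/-- Apply log y ≤ y - 1 to y = (1 - |x|)/(1 + |x|), which gives d ≥ 2|x|/(1 + |x|). -/
theorem norm_le_dist0 (hx : x ∈ puncturedBall N) : ‖x‖ ≤ dist0 x := by
  have h1 := norm_pos_of_mem hx
  have h2 := norm_lt_one_of_mem hx
  have h3 : 0 < 1 - ‖x‖ := by linarith
  have h := Real.log_le_sub_one_of_pos (x := (1 - ‖x‖) / (1 + ‖x‖)) (by positivity)
  have h4 : Real.log ((1 - ‖x‖) / (1 + ‖x‖)) = -dist0 x := by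
    rw [dist0, ← Real.log_inv, inv_div]
  have h5 : (1 - ‖x‖) / (1 + ‖x‖) - 1 ≤ -‖x‖ := by
    rw [div_sub_one (by positivity), div_le_iff₀ (by positivity)]
    nlinarith
  linarith

theorem dist0_pos (hx : x ∈ puncturedBall N) : 0 < dist0 x :=
  (norm_pos_of_mem hx).trans_le (norm_le_dist0 hx)

theorem dist0_le {R : ℝ} (hx : x ∈ puncturedBall N) (hR : ‖x‖ ≤ R) (hR1 : R < 1) :
    dist0 x ≤ 2 / (1 - R) * ‖x‖ := by
  have h1 := norm_pos_of_mem hx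
  have h2 := norm_lt_one_of_mem hx
  have h3 : 0 < 1 - ‖x‖ := by linarith
  have h := Real.log_le_sub_one_of_pos (x := (1 + ‖x‖) / (1 - ‖x‖)) (by positivity)
  refine (h : dist0 x ≤ _).trans ?_
  rw [div_sub_one h3.ne', div_mul_eq_mul_div]
  calc (1 + ‖x‖ - (1 - ‖x‖)) / (1 - ‖x‖) = 2 * ‖x‖ / (1 - ‖x‖) := by ring
    _ ≤ 2 * ‖x‖ / (1 - R) := by gcongr

/-- The quotient `|x| / d(x)`. -/
def tau (x : E N) : ℝ := ‖x‖ / dist0 x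

theorem tau_pos (hx : x ∈ puncturedBall N) : 0 < tau x :=
  div_pos (norm_pos_of_mem hx) (dist0_pos hx)

theorem tau_le_one (hx : x ∈ puncturedBall N) : tau x ≤ 1 :=
  div_le_one_of_le₀ (norm_le_dist0 hx) (dist0_pos hx).le

theorem hasRadialDerivAt_normSq (x : E N) : HasRadialDerivAt (fun y : E N => ‖y‖ ^ 2) 2 x := by
  have h := (hasStrictFDerivAt_norm_sq x).hasFDerivAt
  have h2 : (2 : ℝ) • innerSL ℝ x = (2 : ℕ) • innerSL ℝ x := by rw [two_smul, two_nsmul]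
  unfold HasRadialDerivAt
  rw [h2]
  exact h

theorem hasRadialDerivAt_norm (hx : x ∈ puncturedBall N) :
    HasRadialDerivAt (fun y : E N => ‖y‖) (1 / ‖x‖) x := by
  have h1 := norm_pos_of_mem hx
  have hd : HasDerivAt Real.sqrt (1 / (2 * Real.sqrt (‖x‖ ^ 2))) (‖x‖ ^ 2) :=
    Real.hasDerivAt_sqrt (by positivity)
  have h := (hasRadialDerivAt_normSq x).comp hd
  have h2 : (fun y : E N => Real.sqrt (‖y‖ ^ 2)) = fun y => ‖y‖ := by
    funext y; exact Real.sqrt_sq (norm_nonneg _)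
  rw [h2, Real.sqrt_sq h1.le] at h
  exact h.congr_deriv (by field_simp)

theorem hasRadialDerivAt_rho (hx : x ∈ puncturedBall N) :
    HasRadialDerivAt rho (rho x ^ 2) x := by
  have h1 := one_sub_norm_sq_pos hx
  have hd : HasDerivAt (fun s : ℝ => 2 / (1 - s)) (2 / (1 - ‖x‖ ^ 2) ^ 2) (‖x‖ ^ 2) := by
    have h2 : HasDerivAt (fun s : ℝ => 2 * (1 - s)⁻¹) _ (‖x‖ ^ 2) :=
      (((hasDerivAt_id (‖x‖ ^ 2)).const_sub 1).fun_inv h1.ne').const_mul 2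
    simp only [← div_eq_mul_inv] at h2
    refine h2.congr_deriv ?_
    simp only [id_eq]
    ring
  have h := (hasRadialDerivAt_normSq x).comp hd
  exact HasRadialDerivAt.congr_deriv (h := rho) h (by rw [rho, div_pow]; ring)

theorem hasRadialDerivAt_dist0 (hx : x ∈ puncturedBall N) :
    HasRadialDerivAt dist0 (rho x / ‖x‖) x := by
  have h1 := norm_pos_of_mem hx
  have h2 := norm_lt_one_of_mem hx
  have h3 : 0 < 1 - ‖x‖ := by linarith
  have h4 := one_sub_norm_sq_pos hx
  have hd : HasDerivAt (fun r : ℝ => Real.log ((1 + r) / (1 - r))) (2 / (1 - ‖x‖ ^ 2)) ‖x‖ := by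
    have ha : HasDerivAt (fun r : ℝ => (1 + r) / (1 - r)) _ ‖x‖ :=
      ((hasDerivAt_id ‖x‖).const_add 1).fun_div ((hasDerivAt_id ‖x‖).const_sub 1) h3.ne'
    have hb := ha.log (by simp only [id]; positivity : (1 + id ‖x‖) / (1 - id ‖x‖) ≠ 0)
    refine hb.congr_deriv ?_
    simp only [id]
    have h5 : 1 - ‖x‖ ^ 2 = (1 - ‖x‖) * (1 + ‖x‖) := by ring
    rw [h5]
    field_simp
    ring
  have h := (hasRadialDerivAt_norm hx).comp hd
  exact HasRadialDerivAt.congr_deriv (h := dist0) h (by simp only [rho]; ring)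

/-- In Euler form this is (x·∇)τ = τ - ρτ², next to (x·∇)|x|² = 2|x|² and (x·∇)ρ = |x|²ρ².
Polynomials in |x|², ρ, τ are therefore stable under x·∇, so all derivatives of f needed below are
such polynomials divided by |x|². -/
theorem hasRadialDerivAt_tau (hx : x ∈ puncturedBall N) :
    HasRadialDerivAt tau ((tau x - rho x * tau x ^ 2) / ‖x‖ ^ 2) x := by
  have h1 := norm_pos_of_mem hx
  have h2 := dist0_pos hx
  have h := (hasRadialDerivAt_norm hx).mul ((hasRadialDerivAt_dist0 hx).comp (hasDerivAt_inv h2.ne'))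
  exact (h : HasRadialDerivAt tau _ x).congr_deriv (by rw [tau]; field_simp; ring)

theorem hasRadialDerivAt_dist0_rpow (γ : ℝ) (hx : x ∈ puncturedBall N) :
    HasRadialDerivAt (fun y => dist0 y ^ γ) (dist0 x ^ γ * (γ * (rho x * tau x / ‖x‖ ^ 2))) x := by
  have h1 := norm_pos_of_mem hx
  have h2 := dist0_pos hx
  have h := (hasRadialDerivAt_dist0 hx).comp (Real.hasDerivAt_rpow_const (p := γ) (Or.inl h2.ne'))
  refine h.congr_deriv ?_
  rw [Real.rpow_sub_one h2.ne', tau]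
  field_simp

theorem hasRadialDerivAt_rho_pow (k : ℕ) (hx : x ∈ puncturedBall N) :
    HasRadialDerivAt (fun y => rho y ^ k) (rho x ^ k * (k * rho x)) x := by
  have h := (hasRadialDerivAt_rho hx).comp (hasDerivAt_pow k (rho x))
  refine h.congr_deriv ?_
  rcases k with _ | k
  · simp
  · rw [Nat.add_sub_cancel]; ring

theorem hasRadialDerivAt_normSq_rpow (a : ℝ) (hx : x ∈ puncturedBall N) :
    HasRadialDerivAt (fun y => (‖y‖ ^ 2) ^ a) ((‖x‖ ^ 2) ^ a * (2 * a / ‖x‖ ^ 2)) x := by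
  have h1 : 0 < ‖x‖ ^ 2 := pow_pos (norm_pos_of_mem hx) 2
  have h := (hasRadialDerivAt_normSq x).comp (Real.hasDerivAt_rpow_const (p := a) (Or.inl h1.ne'))
  refine h.congr_deriv ?_
  rw [Real.rpow_sub_one h1.ne']
  field_simp

theorem hasRadialDerivAt_weight (γ : ℝ) (k : ℕ) (hx : x ∈ puncturedBall N) :
    HasRadialDerivAt (fun y => dist0 y ^ γ * rho y ^ k)
      (dist0 x ^ γ * rho x ^ k * (γ * (rho x * tau x / ‖x‖ ^ 2) + k * rho x)) x :=
  ((hasRadialDerivAt_dist0_rpow γ hx).mul (hasRadialDerivAt_rho_pow k hx)).congr_deriv (by ring)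

theorem weight_pos (γ : ℝ) (k : ℕ) (hx : x ∈ puncturedBall N) : 0 < dist0 x ^ γ * rho x ^ k :=
  mul_pos (Real.rpow_pos_of_pos (dist0_pos hx) _) (pow_pos (rho_pos hx) _)

theorem divergence_weight_smul_id (γ : ℝ) (k : ℕ) (hx : x ∈ puncturedBall N) :
    divergence (fun y => (dist0 y ^ γ * rho y ^ k) • y) x =
      dist0 x ^ γ * rho x ^ k * (N + γ * (rho x * tau x) + k * (‖x‖ ^ 2 * rho x)) := by
  rw [(hasRadialDerivAt_weight γ k hx).divergence_smul_id]
  have h1 := norm_pos_of_mem hx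
  field_simp
  ring

theorem logDiv_eq (γ : ℝ) (k : ℕ) (hx : x ∈ puncturedBall N) :
    logDiv γ k x = N + γ * (rho x * tau x) + k * (‖x‖ ^ 2 * rho x) := by
  rw [logDiv, divergence_weight_smul_id γ k hx, mul_div_cancel_left₀ _ (weight_pos γ k hx).ne']

end PuncturedBall

/-- `(x · ∇) logDiv β N` as a polynomial in `s = |x|²`, `ρ` and `τ`. -/
def eulerLogDiv (N : ℕ) (β s r t : ℝ) : ℝ :=
  β * (s * r ^ 2 * t + r * t - r ^ 2 * t ^ 2) + N * (2 * s * r + s ^ 2 * r ^ 2)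

/-- `(x · ∇)² logDiv β N` as a polynomial in `s = |x|²`, `ρ` and `τ`. -/
def eulerLogDiv₂ (N : ℕ) (β s r t : ℝ) : ℝ :=
  β * (2 * s * r ^ 2 * t + 2 * s ^ 2 * r ^ 3 * t + s * r ^ 2 * (t - r * t ^ 2)
      + s * r ^ 2 * t + r * (t - r * t ^ 2)
      - 2 * s * r ^ 3 * t ^ 2 - 2 * r ^ 2 * t * (t - r * t ^ 2))
    + N * (4 * s * r + 2 * s ^ 2 * r ^ 2 + 4 * s ^ 2 * r ^ 2 + 2 * s ^ 3 * r ^ 3)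

/-- `|x|² w⁻¹ ∇·(w ∇ logDiv β N)`, with `w = d^α ρ^(N-2)`, as a polynomial in `s = |x|²`, `ρ`
and `τ`. -/
def laplacianLogDiv (N : ℕ) (α β s r t : ℝ) : ℝ :=
  eulerLogDiv N β s r t * (N + α * (r * t) + (N - 2 : ℕ) * (s * r) - 2) + eulerLogDiv₂ N β s r t

section PuncturedBall

variable {x : E N}

theorem hasRadialDerivAt_logDiv (β : ℝ) (hx : x ∈ puncturedBall N) :
    HasRadialDerivAt (logDiv β N : E N → ℝ)
      (eulerLogDiv N β (‖x‖ ^ 2) (rho x) (tau x) / ‖x‖ ^ 2) x := by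
  have h1 := norm_pos_of_mem hx
  have hρ := hasRadialDerivAt_rho hx
  have h := ((HasRadialDerivAt.const (N : ℝ)).add
    ((hρ.mul (hasRadialDerivAt_tau hx)).const_mul β)).add
      (((hasRadialDerivAt_normSq x).mul hρ).const_mul (N : ℝ))
  have heq : (logDiv β N : E N → ℝ) =ᶠ[𝓝 x]
      fun y => (N : ℝ) + β * (rho y * tau y) + N * (‖y‖ ^ 2 * rho y) := by
    filter_upwards [isOpen_puncturedBall.mem_nhds hx] with y hy using logDiv_eq β N hy
  refine HasRadialDerivAt.congr_deriv (HasFDerivAt.congr_of_eventuallyEq h heq) ?_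
  rw [eulerLogDiv]
  field_simp
  ring

theorem gradient_logDiv (β : ℝ) (hx : x ∈ puncturedBall N) :
    gradient (logDiv β N : E N → ℝ) x =
      (eulerLogDiv N β (‖x‖ ^ 2) (rho x) (tau x) / ‖x‖ ^ 2) • x :=
  (hasRadialDerivAt_logDiv β hx).gradient_eq

theorem hasRadialDerivAt_eulerLogDiv (β : ℝ) (hx : x ∈ puncturedBall N) :
    HasRadialDerivAt (fun y : E N => eulerLogDiv N β (‖y‖ ^ 2) (rho y) (tau y))
      (eulerLogDiv₂ N β (‖x‖ ^ 2) (rho x) (tau x) / ‖x‖ ^ 2) x := by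
  have h1 := norm_pos_of_mem hx
  have hs := hasRadialDerivAt_normSq x
  have hρ := hasRadialDerivAt_rho hx
  have ht := hasRadialDerivAt_tau hx
  have hρ2 := hρ.mul hρ
  have h := (((((hs.mul hρ2).mul ht).add (hρ.mul ht)).add
    ((hρ2.mul (ht.mul ht)).const_mul (-1))).const_mul β).add
      ((((hs.mul hρ).const_mul 2).add ((hs.mul hs).mul hρ2)).const_mul (N : ℝ))
  have heq : (fun y : E N => eulerLogDiv N β (‖y‖ ^ 2) (rho y) (tau y)) =ᶠ[𝓝 x] fun y =>
      β * (‖y‖ ^ 2 * (rho y * rho y) * tau y + rho y * tau y +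
        -1 * (rho y * rho y * (tau y * tau y))) +
        N * (2 * (‖y‖ ^ 2 * rho y) + ‖y‖ ^ 2 * ‖y‖ ^ 2 * (rho y * rho y)) := by
    refine Eventually.of_forall fun y => ?_
    simp only [eulerLogDiv]
    ring
  refine HasRadialDerivAt.congr_deriv (HasFDerivAt.congr_of_eventuallyEq h heq) ?_
  rw [eulerLogDiv₂]
  field_simp
  ring

/-- The field has the form h(x) x, with divergence N h + (x·∇)h. The factor 1/|x|² in h contributes
the -2 in `laplacianLogDiv`. -/
theorem divergence_weight_gradient_logDiv (α β : ℝ) (hx : x ∈ puncturedBall N) :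
    divergence (fun y => (rho y ^ (N - 2) * dist0 y ^ α) • gradient (logDiv β N : E N → ℝ) y) x =
      dist0 x ^ α * rho x ^ (N - 2) *
        (laplacianLogDiv N α β (‖x‖ ^ 2) (rho x) (tau x) / ‖x‖ ^ 2) := by
  have h1 := norm_pos_of_mem hx
  have hinv : HasRadialDerivAt (fun y : E N => (‖y‖ ^ 2)⁻¹) (-((‖x‖ ^ 2) ^ 2)⁻¹ * 2) x :=
    (hasRadialDerivAt_normSq x).comp (hasDerivAt_inv (by positivity))
  have h := (hasRadialDerivAt_weight α (N - 2) hx).mul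
    ((hasRadialDerivAt_eulerLogDiv β hx).mul hinv)
  have heq : (fun y => (rho y ^ (N - 2) * dist0 y ^ α) • gradient (logDiv β N : E N → ℝ) y)
      =ᶠ[𝓝 x] fun y => (dist0 y ^ α * rho y ^ (N - 2) *
        (eulerLogDiv N β (‖y‖ ^ 2) (rho y) (tau y) * (‖y‖ ^ 2)⁻¹)) • y := by
    filter_upwards [isOpen_puncturedBall.mem_nhds hx] with y hy
    rw [gradient_logDiv β hy, smul_smul, div_eq_mul_inv, mul_comm (rho y ^ (N - 2))]
  rw [divergence_congr heq, h.divergence_smul_id, laplacianLogDiv]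
  field_simp
  ring

/-! ### Smoothness off the centre and uniform bounds on smaller balls -/

theorem contDiffAt_rho {m : WithTop ℕ∞} (hx : x ∈ puncturedBall N) : ContDiffAt ℝ m rho x :=
  contDiffAt_const.div (contDiffAt_const.sub (contDiff_norm_sq ℝ).contDiffAt)
    (one_sub_norm_sq_pos hx).ne'

theorem contDiffAt_dist0 {m : WithTop ℕ∞} (hx : x ∈ puncturedBall N) : ContDiffAt ℝ m dist0 x := by
  have h1 := norm_pos_of_mem hx
  have h2 : 0 < 1 - ‖x‖ := by linarith [norm_lt_one_of_mem hx]
  have hn : ContDiffAt ℝ m (fun y : E N => ‖y‖) x := contDiffAt_norm ℝ hx.2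
  exact ((contDiffAt_const.add hn).div (contDiffAt_const.sub hn) h2.ne').log
    (div_pos (by positivity) h2).ne'

theorem contDiffAt_weight {m : WithTop ℕ∞} (γ : ℝ) (k : ℕ) (hx : x ∈ puncturedBall N) :
    ContDiffAt ℝ m (fun y => dist0 y ^ γ * rho y ^ k) x :=
  ((contDiffAt_dist0 hx).rpow_const_of_ne (dist0_pos hx).ne').mul ((contDiffAt_rho hx).pow k)

theorem contDiffAt_tau {m : WithTop ℕ∞} (hx : x ∈ puncturedBall N) : ContDiffAt ℝ m tau x :=
  (contDiffAt_norm ℝ hx.2).div (contDiffAt_dist0 hx) (dist0_pos hx).ne'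

theorem contDiffAt_logDiv {m : WithTop ℕ∞} (γ : ℝ) (k : ℕ) (hx : x ∈ puncturedBall N) :
    ContDiffAt ℝ m (logDiv γ k : E N → ℝ) x := by
  have hρ := contDiffAt_rho (m := m) hx
  have h : ContDiffAt ℝ m
      (fun y : E N => (N : ℝ) + γ * (rho y * tau y) + k * (‖y‖ ^ 2 * rho y)) x :=
    (contDiffAt_const.add (contDiffAt_const.mul (hρ.mul (contDiffAt_tau hx)))).add
      (contDiffAt_const.mul ((contDiff_norm_sq ℝ).contDiffAt.mul hρ))
  refine h.congr_of_eventuallyEq ?_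
  filter_upwards [isOpen_puncturedBall.mem_nhds hx] with y hy using logDiv_eq γ k hy

/-- A continuous function of `|x|²`, `ρ` and `τ` is bounded on smaller balls. -/
theorem exists_bound_of_continuousOn {R : ℝ} (hR : R < 1) {P : ℝ × ℝ × ℝ → ℝ}
    (hP : ContinuousOn P (univ ×ˢ Ioi 0 ×ˢ Ioi 0)) :
    ∃ C, 0 < C ∧ ∀ x ∈ puncturedBall N, ‖x‖ ≤ R → |P (‖x‖ ^ 2, rho x, tau x)| ≤ C := by
  -- This box contains all values of (|x|², ρ, τ) for 0 < |x| ≤ R and avoids ρ = 0 and τ = 0, so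
  -- negative powers are allowed in P. The lower bound for τ comes from `dist0_le`.
  have hc : IsCompact (Icc (0 : ℝ) 1 ×ˢ Icc (2 : ℝ) (2 / (1 - R ^ 2)) ×ˢ
      Icc ((1 - R) / 2) (1 : ℝ)) := isCompact_Icc.prod (isCompact_Icc.prod isCompact_Icc)
  obtain ⟨C, hC⟩ := hc.exists_bound_of_continuousOn (hP.mono fun q hq =>
    ⟨mem_univ _, two_pos.trans_le hq.2.1.1, (half_pos (sub_pos.2 hR)).trans_le hq.2.2.1⟩)
  refine ⟨max C 1, by positivity, fun x hx hxR => le_max_of_le_left (hC _ ?_)⟩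
  have h1 := norm_pos_of_mem hx
  have h2 := norm_lt_one_of_mem hx
  have h3 := one_sub_norm_sq_pos hx
  have h4 : 0 < 1 - R ^ 2 := by nlinarith
  have h5 : 0 < 1 - R := sub_pos.2 hR
  refine ⟨⟨by positivity, by linarith⟩, ⟨?_, ?_⟩, ?_, tau_le_one hx⟩
  · rw [rho, le_div_iff₀ h3]
    nlinarith
  · exact div_le_div_of_nonneg_left two_pos.le h4 (by nlinarith)
  · rw [tau, le_div_iff₀ (dist0_pos hx)]
    calc (1 - R) / 2 * dist0 x ≤ (1 - R) / 2 * (2 / (1 - R) * ‖x‖) := by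
          gcongr
          exact dist0_le hx hxR hR
      _ = ‖x‖ := by field_simp

/-- Substitute d = |x|/τ: the singular factor is a pure power of |x|, and the remaining one is
bounded above and below on smaller balls. -/
theorem weight_eq (γ : ℝ) (k : ℕ) (hx : x ∈ puncturedBall N) :
    dist0 x ^ γ * rho x ^ k = (‖x‖ ^ 2) ^ (γ / 2) * (tau x ^ (-γ) * rho x ^ k) := by
  have h1 := norm_pos_of_mem hx
  have h2 : dist0 x = ‖x‖ * (tau x)⁻¹ := by
    rw [tau]; field_simp
  have h3 : (‖x‖ ^ 2) ^ (γ / 2) = ‖x‖ ^ γ := by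
    rw [← Real.rpow_natCast, ← Real.rpow_mul h1.le]
    congr 1
    push_cast
    ring
  rw [h2, Real.mul_rpow h1.le (inv_nonneg.2 (tau_pos hx).le), Real.inv_rpow (tau_pos hx).le,
    ← Real.rpow_neg (tau_pos hx).le, h3]
  ring

/-- The weight `d^γ ρ^k` is comparable to `|x|^γ` on smaller balls. -/
theorem exists_weight_comparison {R : ℝ} (hR : R < 1) (γ : ℝ) (k : ℕ) :
    ∃ C, 0 < C ∧ ∀ x ∈ puncturedBall N, ‖x‖ ≤ R →
      dist0 x ^ γ * rho x ^ k ≤ C * (‖x‖ ^ 2) ^ (γ / 2) ∧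
      (‖x‖ ^ 2) ^ (γ / 2) ≤ C * (dist0 x ^ γ * rho x ^ k) := by
  have hP : ContinuousOn (fun q : ℝ × ℝ × ℝ => q.2.2 ^ (-γ) * q.2.1 ^ k)
      (univ ×ˢ Ioi 0 ×ˢ Ioi 0) :=
    (ContinuousOn.rpow_const (by fun_prop) fun q hq => Or.inl (ne_of_gt hq.2.2)).mul (by fun_prop)
  have hpos : ∀ q ∈ (univ ×ˢ Ioi 0 ×ˢ Ioi 0 : Set (ℝ × ℝ × ℝ)), 0 < q.2.2 ^ (-γ) * q.2.1 ^ k :=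
    fun q hq => mul_pos (Real.rpow_pos_of_pos hq.2.2 _) (pow_pos hq.2.1 _)
  obtain ⟨C₁, hC₁, h₁⟩ := exists_bound_of_continuousOn (N := N) hR hP
  obtain ⟨C₂, hC₂, h₂⟩ := exists_bound_of_continuousOn (N := N) hR
    (P := fun q => (q.2.2 ^ (-γ) * q.2.1 ^ k)⁻¹) (hP.inv₀ fun q hq => (hpos q hq).ne')
  refine ⟨max C₁ C₂, by positivity, fun x hx hxR => ?_⟩
  have hq := hpos (‖x‖ ^ 2, rho x, tau x) ⟨mem_univ _, rho_pos hx, tau_pos hx⟩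
  have a₁ := (le_abs_self _).trans (h₁ x hx hxR)
  have a₂ := (le_abs_self _).trans (h₂ x hx hxR)
  simp only at hq a₁ a₂
  rw [weight_eq γ k hx]
  have hs : 0 ≤ (‖x‖ ^ 2) ^ (γ / 2) := Real.rpow_nonneg (by positivity) _
  constructor
  · rw [mul_comm]
    exact mul_le_mul_of_nonneg_right (a₁.trans (le_max_left _ _)) hs
  · rw [inv_le_comm₀ hq hC₂] at a₂
    have : 1 ≤ max C₁ C₂ * (tau x ^ (-γ) * rho x ^ k) := by
      rw [inv_le_iff_one_le_mul₀ hC₂] at a₂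
      rw [mul_comm] at a₂
      exact a₂.trans (mul_le_mul_of_nonneg_right (le_max_right _ _) hq.le)
    nlinarith

end PuncturedBall

/-! ### Hyperbolic volume -/

theorem measurable_rho : Measurable (rho : E N → ℝ) := by
  unfold rho
  fun_prop

section HypVolume

variable {Ω : Set (E N)}

theorem integrableOn_hypVolume_iff (hΩ : MeasurableSet Ω) (hΩB : Ω ⊆ Metric.ball 0 1)
    {g : E N → ℝ} :
    IntegrableOn g Ω (hypVolume N) ↔ IntegrableOn (fun x => rho x ^ N * g x) Ω := by
  rw [IntegrableOn, hypVolume, restrict_withDensity hΩ,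
    integrable_withDensity_iff_integrable_smul' (measurable_rho.pow_const N).ennreal_ofReal
      (ae_of_all _ fun x => ENNReal.ofReal_lt_top)]
  refine integrable_congr (ae_restrict_of_forall_mem hΩ fun x hx => ?_)
  have hx1 : ‖x‖ < 1 := by simpa using hΩB hx
  have : 0 ≤ rho x := div_nonneg two_pos.le (by nlinarith [norm_nonneg x])
  simp only [ENNReal.toReal_ofReal (pow_nonneg this N), smul_eq_mul]

theorem setIntegral_hypVolume (hΩ : MeasurableSet Ω) (hΩB : Ω ⊆ Metric.ball 0 1) (g : E N → ℝ) :
    ∫ x in Ω, g x ∂(hypVolume N) = ∫ x in Ω, rho x ^ N * g x := by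
  rw [hypVolume, setIntegral_withDensity_eq_setIntegral_toReal_smul
    (measurable_rho.pow_const N).ennreal_ofReal (ae_of_all _ fun x => ENNReal.ofReal_lt_top) _ hΩ]
  refine setIntegral_congr_fun hΩ fun x hx => ?_
  have hx1 : ‖x‖ < 1 := by simpa using hΩB hx
  have : 0 ≤ rho x := div_nonneg two_pos.le (by nlinarith [norm_nonneg x])
  simp only [ENNReal.toReal_ofReal (pow_nonneg this N), smul_eq_mul]

end HypVolume

/-! ### Gradients up to the boundary -/

/-- This makes the derivative relative to the closure well determined, hence continuous up to the
boundary. -/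
theorem uniqueDiffOn_closure_sdiff_zero {Ω : Set (E N)} (hΩ : IsOpen Ω) (hreg : HasC1Boundary Ω) :
    UniqueDiffOn ℝ (closure Ω \ {0}) := by
  intro x hx
  have h : UniqueDiffWithinAt ℝ (closure Ω) x := by
    by_cases hxΩ : x ∈ Ω
    · exact (hΩ.uniqueDiffWithinAt hxΩ).mono subset_closure
    · obtain ⟨φ, hφ⟩ := hreg x (hΩ.frontier_eq ▸ ⟨hx.1, hxΩ⟩)
      exact (hφ.uniqueDiffWithinAt hΩ (hΩ.frontier_eq ▸ ⟨hx.1, hxΩ⟩)).mono subset_closure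
  exact h.inter (isOpen_ne.mem_nhds hx.2)

theorem fderivWithin_sdiff_zero {S : Set (E N)} {u : E N → ℝ} {x : E N} (hx : x ≠ 0) :
    fderivWithin ℝ u (S \ {0}) x = fderivWithin ℝ u S x :=
  fderivWithin_inter (isOpen_ne.mem_nhds hx)

theorem continuousOn_gradientWithin_closure {Ω : Set (E N)} (hΩ : IsOpen Ω)
    (hreg : HasC1Boundary Ω) {u : E N → ℝ} (hu : ContDiffOn ℝ 1 u (closure Ω \ {0})) :
    ContinuousOn (gradientWithin u (closure Ω)) (closure Ω \ {0}) := by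
  have h := hu.continuousOn_fderivWithin (uniqueDiffOn_closure_sdiff_zero hΩ hreg) le_rfl
  refine (InnerProductSpace.toDual ℝ (E N)).symm.continuous.comp_continuousOn (h.congr ?_)
  exact fun x hx => (fderivWithin_sdiff_zero hx.2).symm

theorem gradientWithin_closure_eq {Ω : Set (E N)} (hΩ : IsOpen Ω) {u : E N → ℝ} {x : E N}
    (hx : x ∈ Ω) : gradientWithin u (closure Ω) x = gradient u x := by
  rw [gradientWithin, gradient,
    fderivWithin_of_mem_nhds (mem_of_superset (hΩ.mem_nhds hx) subset_closure)]

/-- The gradient of a function vanishing on the boundary is normal to the boundary. -/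
theorem gradientWithin_eq_inner_smul_outwardNormal {Ω : Set (E (n + 1))} (hΩ : IsOpen Ω)
    (hreg : HasC1Boundary Ω) {u : E (n + 1) → ℝ} (hu0 : ∀ x ∈ frontier Ω, u x = 0)
    {x : E (n + 1)} (hx : x ∈ frontier Ω) (hu : DifferentiableWithinAt ℝ u (closure Ω) x) :
    gradientWithin u (closure Ω) x =
      inner ℝ (gradientWithin u (closure Ω) x) (outwardNormal Ω x) • outwardNormal Ω x := by
  obtain ⟨M, γ, U, hγ, hγ0, hγ1, -, hU, hxU, h⟩ := hreg.exists_graph hΩ hx one_pos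
  have hΦ0 : graphChart M x γ (0, 0) = x := by
    simp [graphChart, hγ0]
  have hν : outwardNormal Ω x = M (WithLp.toLp 2 (0, 1)) := by
    have hc : graphCoord M x γ x = (0, 0) := by
      rw [← graphCoord_graphChart M x γ (0, 0), hΦ0]
    have hn : ‖graphNormal M γ 0‖ = 1 := by
      have := norm_graphNormal_sq M γ 0
      rw [hγ1, norm_zero] at this
      nlinarith [norm_nonneg (graphNormal M γ 0)]
    rw [outwardNormal_eq_of_graph hΩ hγ hU h hxU hx, hc, hn, inv_one, one_smul, graphNormal,
      gradient, hγ1, map_zero, neg_zero]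
  obtain ⟨A, hA, hA'⟩ := hasFDerivAt_graphChart_left M x hγ 0 0
  have hfr : ∀ᶠ y in 𝓝 (0 : E n), graphChart M x γ (y, 0) ∈ frontier Ω := by
    have hU' : ∀ᶠ y in 𝓝 (0 : E n), graphChart M x γ (y, 0) ∈ U :=
      hA.continuousAt.eventually (by beta_reduce; rw [hΦ0]; exact hU.mem_nhds hxU)
    filter_upwards [hU'] with y hy
    rw [mem_frontier_iff_of_graph hΩ hγ hU h hy, graphCoord_graphChart]
  -- The function u vanishes along the graph, whose tangent space at x is spanned by the M(v, 0)
  -- because γ has zero derivative at the base point.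
  have htan : ∀ v : E n,
      inner ℝ (gradientWithin u (closure Ω) x) (M (WithLp.toLp 2 (v, 0))) = 0 := by
    intro v
    have h1 : HasFDerivAt (fun y => u (graphChart M x γ (y, 0)))
        ((fderivWithin ℝ u (closure Ω) x).comp A) 0 := by
      rw [← hΦ0] at hu
      have := hu.hasFDerivWithinAt.comp_of_tendsto (x := (0 : E n)) (s := univ) hA.hasFDerivWithinAt
        (tendsto_nhdsWithin_iff.2 ⟨by rw [nhdsWithin_univ]; exact hA.continuousAt, by
          rw [nhdsWithin_univ]
          exact hfr.mono fun y hy => frontier_subset_closure hy⟩)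
      rw [hΦ0] at this
      exact hasFDerivWithinAt_univ.1 this
    have h2 : (fun y => u (graphChart M x γ (y, 0))) =ᶠ[𝓝 0] fun _ => 0 :=
      hfr.mono fun y hy => hu0 _ hy
    have h3 := h1.unique ((hasFDerivAt_const (0 : ℝ) (0 : E n)).congr_of_eventuallyEq h2)
    have h4 := congrArg (fun L => L v) h3
    simp only [ContinuousLinearMap.comp_apply, hA', hγ1] at h4
    rw [inner_gradientWithin_left]
    simpa using h4
  rw [hν]
  refine ext_inner_right ℝ fun z => ?_
  obtain ⟨q, rfl⟩ := M.surjective z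
  have hq : M q = M (WithLp.toLp 2 (q.fst, 0)) + q.snd • M (WithLp.toLp 2 (0, 1)) := by
    rw [← map_smul, ← map_add]
    congr 1
    refine WithLp.ofLp_injective 2 (Prod.ext ?_ ?_) <;> simp
  rw [hq, inner_add_right, htan, zero_add, real_inner_smul_right, real_inner_smul_left,
    inner_add_right, inner_frame, real_inner_smul_right, inner_frame]
  simp [mul_comm]

theorem norm_outwardNormal {Ω : Set (E (n + 1))} (hΩ : IsOpen Ω) (hreg : HasC1Boundary Ω)
    {x : E (n + 1)} (hx : x ∈ frontier Ω) : ‖outwardNormal Ω x‖ = 1 := by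
  obtain ⟨φ, hφ⟩ := hreg x hx
  rw [hφ.outwardNormal_eq hΩ hx]
  exact norm_smul_inv_norm (𝕜 := ℝ) hφ.2.1

/-! ### Divergences of products of gradients -/

theorem contDiffAt_gradient {u : E N → ℝ} {x : E N} (hu : ContDiffAt ℝ 2 u x) :
    ContDiffAt ℝ 1 (gradient u) x :=
  (InnerProductSpace.toDual ℝ (E N)).symm.toContinuousLinearEquiv.contDiff.contDiffAt.comp x
    (hu.fderiv_right (by norm_num))

/-- Under the Riesz isomorphism the derivative of ∇u is the second derivative of u, which is
symmetric. -/
theorem inner_fderiv_gradient_comm {u : E N → ℝ} {x : E N} (hu : ContDiffAt ℝ 2 u x) (a b : E N) :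
    inner ℝ (fderiv ℝ (gradient u) x a) b = inner ℝ (fderiv ℝ (gradient u) x b) a := by
  have hd : DifferentiableAt ℝ (fderiv ℝ u) x :=
    (hu.fderiv_right (m := 1) (by norm_num)).differentiableAt one_ne_zero
  have key : ∀ c d : E N,
      inner ℝ (fderiv ℝ (gradient u) x c) d = fderiv ℝ (fderiv ℝ u) x c d := by
    intro c d
    have h := ((InnerProductSpace.toDual ℝ (E N)).symm.toContinuousLinearEquiv.hasFDerivAt.comp x
      hd.hasFDerivAt).fderiv
    have h' : fderiv ℝ (gradient u) x c =
        (InnerProductSpace.toDual ℝ (E N)).symm (fderiv ℝ (fderiv ℝ u) x c) :=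
      congrArg (fun L => L c) h
    rw [h', InnerProductSpace.toDual_symm_apply]
  rw [key, key]
  exact hu.isSymmSndFDerivAt (by simp) a b

theorem gradient_inner_id_gradient {u : E N → ℝ} {x : E N} (hu : ContDiffAt ℝ 2 u x) :
    gradient (fun y => inner ℝ y (gradient u y)) x =
      gradient u x + fderiv ℝ (gradient u) x x := by
  have hd := (contDiffAt_gradient hu).differentiableAt one_ne_zero
  refine ext_inner_right ℝ fun v => ?_
  rw [inner_gradient_left, fderiv_inner_apply ℝ differentiableAt_fun_id hd, inner_add_left,
    fderiv_fun_id, ContinuousLinearMap.id_apply, real_inner_comm, add_comm,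
    real_inner_comm v (gradient u x), inner_fderiv_gradient_comm hu v x]

theorem gradient_norm_gradient_sq {u : E N → ℝ} {x : E N} (hu : ContDiffAt ℝ 2 u x) :
    gradient (fun y => ‖gradient u y‖ ^ 2) x =
      (2 : ℝ) • fderiv ℝ (gradient u) x (gradient u x) := by
  have hd := (contDiffAt_gradient hu).differentiableAt one_ne_zero
  refine ext_inner_right ℝ fun v => ?_
  have h : (fun y => ‖gradient u y‖ ^ 2) = fun y => inner ℝ (gradient u y) (gradient u y) := by
    funext y
    rw [real_inner_self_eq_norm_sq]
  rw [inner_gradient_left, h, fderiv_inner_apply ℝ hd hd, real_inner_smul_left,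
    real_inner_comm (fderiv ℝ (gradient u) x v), inner_fderiv_gradient_comm hu v]
  ring

theorem gradient_comp {h : E N → ℝ} {f : ℝ → ℝ} {f' : ℝ} {x : E N} (hf : HasDerivAt f f' (h x))
    (hh : DifferentiableAt ℝ h x) : gradient (fun y => f (h y)) x = f' • gradient h x := by
  refine ext_inner_right ℝ fun v => ?_
  have h' : fderiv ℝ (fun y => f (h y)) x = _ := (hf.comp_hasFDerivAt x hh.hasFDerivAt).fderiv
  rw [inner_gradient_left, h', real_inner_smul_left, inner_gradient_left]
  simp

theorem gradient_mul {h₁ h₂ : E N → ℝ} {x : E N} (hh₁ : DifferentiableAt ℝ h₁ x)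
    (hh₂ : DifferentiableAt ℝ h₂ x) :
    gradient (fun y => h₁ y * h₂ y) x = h₁ x • gradient h₂ x + h₂ x • gradient h₁ x := by
  refine ext_inner_right ℝ fun v => ?_
  rw [inner_gradient_left, fderiv_fun_mul hh₁ hh₂, inner_add_left, real_inner_smul_left,
    real_inner_smul_left, inner_gradient_left, inner_gradient_left]
  simp

theorem gradient_const_mul (c : ℝ) {h : E N → ℝ} {x : E N} (hh : DifferentiableAt ℝ h x) :
    gradient (fun y => c * h y) x = c • gradient h x := by
  refine ext_inner_right ℝ fun v => ?_
  rw [inner_gradient_left, fderiv_const_mul hh, real_inner_smul_left, inner_gradient_left]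
  simp

/-- The Pohozaev multiplier field `(x·∇u) w∇u - ½|∇u|² w x`. -/
theorem divergence_pohozaev {u w : E N → ℝ} {x : E N} (hu : ContDiffAt ℝ 2 u x)
    (hw : DifferentiableAt ℝ w x) :
    divergence (fun y => inner ℝ y (gradient u y) • (w y • gradient u y) +
        (-(1 / 2) * ‖gradient u y‖ ^ 2) • (w y • y)) x =
      inner ℝ x (gradient u x) * divergence (fun y => w y • gradient u y) x +
        w x * ‖gradient u x‖ ^ 2 -
        1 / 2 * ‖gradient u x‖ ^ 2 * divergence (fun y => w y • y) x := by
  have hd := (contDiffAt_gradient hu).differentiableAt one_ne_zero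
  have h1 : DifferentiableAt ℝ (fun y => inner ℝ y (gradient u y)) x :=
    differentiableAt_fun_id.inner ℝ hd
  have h2 : DifferentiableAt ℝ (fun y => ‖gradient u y‖ ^ 2) x := hd.norm_sq ℝ
  have h3 : DifferentiableAt ℝ (fun y => w y • gradient u y) x := hw.fun_smul hd
  have h4 : DifferentiableAt ℝ (fun y => w y • y) x := hw.fun_smul differentiableAt_fun_id
  rw [divergence_add (h1.fun_smul h3) ((h2.const_mul _).fun_smul h4), divergence_smul h1 h3,
    divergence_smul (h2.const_mul _) h4, gradient_inner_id_gradient hu, gradient_const_mul _ h2,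
    gradient_norm_gradient_sq hu]
  simp only [real_inner_smul_right, real_inner_smul_left, inner_add_left,
    real_inner_self_eq_norm_sq]
  -- Symmetry of the Hessian makes the two terms w⟨D²u x, ∇u⟩ cancel, leaving no second derivatives
  -- outside ∇·(w∇u).
  rw [inner_fderiv_gradient_comm hu (gradient u x) x]
  ring

theorem divergence_abs_rpow_smul {u : E N → ℝ} {G : E N → E N} {x : E N} {p : ℝ} (hp : 1 < p)
    (hu : DifferentiableAt ℝ u x) (hG : DifferentiableAt ℝ G x) :
    divergence (fun y => |u y| ^ p • G y) x =
      |u x| ^ p * divergence G x + p * |u x| ^ (p - 2) * u x * inner ℝ (gradient u x) (G x) := by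
  have h := hasDerivAt_abs_rpow (u x) hp
  have hd : DifferentiableAt ℝ (fun y => |u y| ^ p) x :=
    (h.comp_hasFDerivAt x hu.hasFDerivAt).differentiableAt
  rw [divergence_smul hd hG, gradient_comp h hu, real_inner_smul_left]

theorem divergence_mul_smul {f u : E N → ℝ} {G : E N → E N} {x : E N}
    (hf : DifferentiableAt ℝ f x) (hu : DifferentiableAt ℝ u x) (hG : DifferentiableAt ℝ G x) :
    divergence (fun y => (f y * u y) • G y) x =
      f x * u x * divergence G x + f x * inner ℝ (gradient u x) (G x) +
        u x * inner ℝ (gradient f x) (G x) := by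
  rw [divergence_smul (hf.fun_mul hu) hG, gradient_mul hf hu, inner_add_left, real_inner_smul_left,
    real_inner_smul_left, add_assoc]

theorem divergence_sq_smul {u : E N → ℝ} {G : E N → E N} {x : E N}
    (hu : DifferentiableAt ℝ u x) (hG : DifferentiableAt ℝ G x) :
    divergence (fun y => u y ^ 2 • G y) x =
      u x ^ 2 * divergence G x + 2 * u x * inner ℝ (gradient u x) (G x) := by
  simp only [pow_two]
  rw [divergence_mul_smul hu hu hG]
  ring

/-! ### Integrability of the terms in the identity -/

theorem ae_restrict_of_forall_mem_sdiff_zero {Ω : Set (E (n + 1))} (hΩ : IsOpen Ω)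
    {q : E (n + 1) → Prop} (hq : ∀ x ∈ Ω \ {0}, q x) : ∀ᵐ x ∂(volume.restrict Ω), q x := by
  rw [← restrict_sdiff_zero]
  exact ae_restrict_of_forall_mem (hΩ.sdiff isClosed_singleton).measurableSet hq

theorem IntegrableOn.of_le_of_continuousOn {Ω : Set (E (n + 1))} (hΩ : IsOpen Ω)
    {f g : E (n + 1) → ℝ} (hg : IntegrableOn g Ω) (hf : ContinuousOn f (Ω \ {0}))
    (hfg : ∀ x ∈ Ω \ {0}, |f x| ≤ g x) : IntegrableOn f Ω := by
  refine Integrable.mono' hg ?_ (ae_restrict_of_forall_mem_sdiff_zero hΩ hfg)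
  rw [← restrict_sdiff_zero]
  exact hf.aestronglyMeasurable (hΩ.sdiff isClosed_singleton).measurableSet

theorem IntegrableOn.congr_of_eq_sdiff_zero {Ω : Set (E (n + 1))} (hΩ : IsOpen Ω)
    {f g : E (n + 1) → ℝ} (hg : IntegrableOn g Ω) (hfg : ∀ x ∈ Ω \ {0}, g x = f x) :
    IntegrableOn f Ω :=
  Integrable.congr hg (ae_restrict_of_forall_mem_sdiff_zero hΩ hfg)

theorem integrableOn_cutoff_mul {Ω : Set (E (n + 1))} (hcpt : IsCompact (closure Ω))
    {f : E (n + 1) → ℝ} (hf : ContinuousOn f (closure Ω \ {0})) (k : ℝ) :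
    IntegrableOn (fun x => cutoff k x * f x) Ω :=
  ((continuousOn_cutoff_smul hf (contDiff_cutoff k).continuous
    (cutoff_eventuallyEq_zero k)).integrableOn_compact hcpt).mono_set subset_closure

theorem continuousOn_weight (γ : ℝ) (k : ℕ) :
    ContinuousOn (fun y : E N => dist0 y ^ γ * rho y ^ k) (puncturedBall N) := fun _ hx =>
  (contDiffAt_weight (m := 0) γ k hx).continuousAt.continuousWithinAt

theorem contDiffAt_normSq_rpow {m : WithTop ℕ∞} (a : ℝ) {x : E N} (hx : x ≠ 0) :
    ContDiffAt ℝ m (fun y : E N => (‖y‖ ^ 2) ^ a) x :=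
  (contDiff_norm_sq ℝ).contDiffAt.rpow_const_of_ne (pow_pos (norm_pos_iff.2 hx) 2).ne'

theorem closure_sdiff_zero_subset {Ω : Set (E N)} (hB : closure Ω ⊆ Metric.ball 0 1) :
    closure Ω \ {0} ⊆ puncturedBall N := fun _ hx => ⟨hB hx.1, hx.2⟩

theorem isCompact_closure_of_subset_ball {Ω : Set (E N)} (hB : closure Ω ⊆ Metric.ball 0 1) :
    IsCompact (closure Ω) :=
  Metric.isCompact_of_isClosed_isBounded isClosed_closure (Metric.isBounded_ball.subset hB)

theorem exists_norm_le_lt_one {Ω : Set (E N)} (hB : closure Ω ⊆ Metric.ball 0 1) :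
    ∃ R < 1, ∀ x ∈ closure Ω, ‖x‖ ≤ R := by
  obtain ⟨R, hR, h⟩ := exists_lt_subset_ball isClosed_closure hB
  exact ⟨R, hR, fun x hx => by simpa using (Metric.mem_ball.1 (h hx)).le⟩

/-- **Hardy inequality**, qualitative form: if `|x|^(a+1) |∇u|` is square integrable, so is
`|x|^a u`, for `u` vanishing on the boundary and exponents above the critical one. -/
theorem integrableOn_hardy {Ω : Set (E (n + 1))} (hΩ : IsOpen Ω)
    (hB : closure Ω ⊆ Metric.ball 0 1) (hreg : HasC1Boundary Ω) {u : E (n + 1) → ℝ}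
    (hu : ContDiffOn ℝ 1 u (closure Ω \ {0})) (hu0 : ∀ x ∈ frontier Ω, u x = 0) {a : ℝ}
    (ha : 0 < ((n + 1 : ℕ) : ℝ) + 2 * a)
    (hint : IntegrableOn
      (fun x => (‖x‖ ^ 2) ^ (a + 1) * ‖gradientWithin u (closure Ω) x‖ ^ 2) Ω) :
    IntegrableOn (fun x => u x ^ 2 * (‖x‖ ^ 2) ^ a) Ω := by
  have hcpt := isCompact_closure_of_subset_ball hB
  have hopen : IsOpen (Ω \ {0}) := hΩ.sdiff isClosed_singleton
  have hsub : Ω \ {0} ⊆ closure Ω \ {0} := sdiff_subset_sdiff_left subset_closure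
  have hball := closure_sdiff_zero_subset hB
  set g := gradientWithin u (closure Ω) with hg
  set c : ℝ := ((n + 1 : ℕ) : ℝ) + 2 * a with hc
  have hgc := continuousOn_gradientWithin_closure hΩ hreg hu
  have hsc : ContinuousOn (fun x : E (n + 1) => (‖x‖ ^ 2) ^ a) (closure Ω \ {0}) := fun x hx =>
    (contDiffAt_normSq_rpow (m := 0) a hx.2).continuousAt.continuousWithinAt
  have hsd : ∀ x ∈ Ω \ {0}, ContDiffAt ℝ 1 (fun y : E (n + 1) => (‖y‖ ^ 2) ^ a • y) x := fun x hx =>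
    (contDiffAt_normSq_rpow a hx.2).smul contDiffAt_id
  have hud : ∀ x ∈ Ω \ {0}, ContDiffAt ℝ 1 u x := fun x hx =>
    (hu.mono hsub).contDiffAt (hopen.mem_nhds hx)
  have hcut := integral_cutoff_divergence hΩ hcpt hreg
    (F := fun x => u x ^ 2 • ((‖x‖ ^ 2) ^ a • x))
    (D := fun x => c * (u x ^ 2 * (‖x‖ ^ 2) ^ a) + 2 * u x * ((‖x‖ ^ 2) ^ a * inner ℝ (g x) x))
    (fun x hx => (((hud x hx).pow 2).smul (hsd x hx)).contDiffWithinAt)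
    ((hu.continuousOn.pow 2).smul (hsc.smul continuousOn_id))
    ((continuousOn_const.mul ((hu.continuousOn.pow 2).mul hsc)).add
      ((continuousOn_const.mul hu.continuousOn).mul (hsc.mul (hgc.inner continuousOn_id))))
    (fun x hx => by
      have hx1 := norm_pos_of_mem (hball (hsub hx))
      rw [divergence_sq_smul ((hud x hx).differentiableAt one_ne_zero)
        ((hsd x hx).differentiableAt one_ne_zero),
        (hasRadialDerivAt_normSq_rpow a (hball (hsub hx))).divergence_smul_id,
        real_inner_smul_right, hg, gradientWithin_closure_eq hΩ hx.1, hc]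
      field_simp)
    (fun x hx => by simp [hu0 x hx])
  have hfc : ContinuousOn (fun x => u x ^ 2 * (‖x‖ ^ 2) ^ a) (closure Ω \ {0}) :=
    (hu.continuousOn.pow 2).mul hsc
  refine integrableOn_of_cutoff hΩ (hfc.mono hsub) (fun x _ => by positivity)
    (B := (c / 2)⁻¹ * (2 / c * ∫ x in Ω, (‖x‖ ^ 2) ^ (a + 1) * ‖g x‖ ^ 2))
    (fun k => integrableOn_cutoff_mul hcpt hfc k) fun k => ?_
  obtain ⟨hD, hF, heq⟩ := hcut k
  -- The cutoff term has the good sign, so the integral of cutoff times D is at most 0 with no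
  -- knowledge of u near the origin.
  have hFnn : 0 ≤ ∫ x in Ω, inner ℝ (gradient (cutoff k) x) (u x ^ 2 • ((‖x‖ ^ 2) ^ a • x)) := by
    refine integral_nonneg fun x => ?_
    simp only [Pi.zero_apply, real_inner_smul_right]
    have := inner_gradient_cutoff_nonneg k x
    positivity
  have hle : ∫ x in Ω, (c / 2 * (cutoff k x * (u x ^ 2 * (‖x‖ ^ 2) ^ a)) -
        2 / c * ((‖x‖ ^ 2) ^ (a + 1) * ‖g x‖ ^ 2)) ≤
      ∫ x in Ω, cutoff k x *
        (c * (u x ^ 2 * (‖x‖ ^ 2) ^ a) + 2 * u x * ((‖x‖ ^ 2) ^ a * inner ℝ (g x) x)) := by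
    refine integral_mono_ae
      (((integrableOn_cutoff_mul hcpt hfc k).const_mul _).sub (hint.const_mul _)) hD
      (ae_restrict_of_forall_mem_sdiff_zero hΩ fun x hx => ?_)
    have hx1 := norm_pos_of_mem (hball (hsub hx))
    have hs : (‖x‖ ^ 2) ^ (a + 1) = (‖x‖ ^ 2) ^ a * ‖x‖ ^ 2 := by
      rw [Real.rpow_add_one (by positivity)]
    have hS : 0 < (‖x‖ ^ 2) ^ a := Real.rpow_pos_of_pos (by positivity) _
    -- Young's inequality, spending half of the positive coefficient c on the cross term.
    have hyoung : -(2 / c * (‖x‖ ^ 2 * ‖g x‖ ^ 2)) ≤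
        c / 2 * u x ^ 2 + 2 * u x * inner ℝ (g x) x := by
      have h1 : inner ℝ (g x) x ^ 2 ≤ ‖x‖ ^ 2 * ‖g x‖ ^ 2 := by
        rw [← mul_pow, ← sq_abs]
        gcongr
        rw [mul_comm]
        exact abs_real_inner_le_norm _ _
      have h2 : 0 ≤ c / 2 * (u x + 2 / c * inner ℝ (g x) x) ^ 2 := by positivity
      have h3 : c / 2 * (u x + 2 / c * inner ℝ (g x) x) ^ 2 =
          c / 2 * u x ^ 2 + 2 * u x * inner ℝ (g x) x + 2 / c * inner ℝ (g x) x ^ 2 := by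
        field_simp
        ring
      have h4 : 2 / c * inner ℝ (g x) x ^ 2 ≤ 2 / c * (‖x‖ ^ 2 * ‖g x‖ ^ 2) := by gcongr
      linarith
    have hη0 := cutoff_nonneg k x
    have hη1 := cutoff_le_one k x
    have hmul := mul_le_mul_of_nonneg_left hyoung (mul_nonneg hη0 hS.le)
    have hE : 0 ≤ (1 - cutoff k x) * (2 / c * ((‖x‖ ^ 2) ^ a * ‖x‖ ^ 2 * ‖g x‖ ^ 2)) :=
      mul_nonneg (by linarith) (by positivity)
    beta_reduce
    rw [hs]
    nlinarith
  rw [integral_sub ((integrableOn_cutoff_mul hcpt hfc k).const_mul _) (hint.const_mul _),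
    integral_const_mul, integral_const_mul] at hle
  rw [le_inv_mul_iff₀ (by positivity)]
  linarith

/-- For t = 0 the value given to |0|^(p-2) is harmless, since it is multiplied by t. -/
theorem abs_rpow_sub_two_mul_self_mul_self (t : ℝ) {p : ℝ} (hp : 1 < p) :
    |t| ^ (p - 2) * t * t = |t| ^ p := by
  rcases eq_or_ne t 0 with rfl | ht
  · simp [Real.zero_rpow (by linarith : p ≠ 0)]
  · have h : |t| ^ p = |t| ^ (p - 2) * |t| ^ 2 := by
      rw [← Real.rpow_natCast, ← Real.rpow_add (abs_pos.2 ht)]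
      congr 1
      push_cast
      ring
    rw [h, sq_abs]
    ring

namespace IsSolution

theorem divergence_weight_gradient {Ω : Set (E N)} {α β p : ℝ} {u : E N → ℝ}
    (hu : IsSolution Ω α β p u) (hB : closure Ω ⊆ Metric.ball 0 1) {x : E N} (hx : x ∈ Ω \ {0}) :
    divergence (fun y => (dist0 y ^ α * rho y ^ (N - 2)) • gradient u y) x =
      -(dist0 x ^ β * rho x ^ N * (|u x| ^ (p - 2) * u x)) := by
  have hρ := rho_pos (x := x) ⟨hB (subset_closure hx.1), hx.2⟩
  have h := hu.equation x hx.1 hx.2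
  rw [hypLaplacian] at h
  simp only [mul_comm (rho _ ^ (N - 2))] at h
  have h2 : (rho x ^ N)⁻¹ * rho x ^ N = 1 := inv_mul_cancel₀ (by positivity)
  linear_combination (-(rho x ^ N)) * h - 
    divergence (fun y => (dist0 y ^ α * rho y ^ (N - 2)) • gradient u y) x * h2

section

variable {Ω : Set (E (n + 1))} {α β p : ℝ} {u : E (n + 1) → ℝ}

theorem contDiffAt (hu : IsSolution Ω α β p u) (hΩ : IsOpen Ω) {x : E (n + 1)}
    (hx : x ∈ Ω \ {0}) : ContDiffAt ℝ 2 u x :=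
  hu.contDiffOn_interior.contDiffAt ((hΩ.sdiff isClosed_singleton).mem_nhds hx)

/-- The squared hyperbolic gradient carries ρ^(-2), which lowers the exponent of the volume factor
to N - 2; N ≥ 2 makes the natural-number subtraction genuine. -/
theorem rho_pow_mul_energy (hn : 2 ≤ n + 1) (hB : closure Ω ⊆ Metric.ball 0 1) (hΩ : IsOpen Ω)
    {x : E (n + 1)} (hx : x ∈ Ω \ {0}) :
    rho x ^ (n + 1) * (dist0 x ^ α * ‖hypGradient u x‖ ^ 2) =
      dist0 x ^ α * rho x ^ (n + 1 - 2) * ‖gradientWithin u (closure Ω) x‖ ^ 2 := by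
  have hρ := rho_pos (x := x) ⟨hB (subset_closure hx.1), hx.2⟩
  have h : rho x ^ (n + 1) = rho x ^ (n + 1 - 2) * rho x ^ 2 := by
    rw [← pow_add, Nat.sub_add_cancel hn]
  rw [hypGradient, norm_smul, gradientWithin_closure_eq hΩ hx.1, norm_inv,
    Real.norm_of_nonneg hρ.le, h]
  field_simp

theorem integrableOn_energy (hu : IsSolution Ω α β p u) (hn : 2 ≤ n + 1) (hΩ : IsOpen Ω)
    (hB : closure Ω ⊆ Metric.ball 0 1) :
    IntegrableOn (fun x => dist0 x ^ α * rho x ^ (n + 1 - 2) *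
      ‖gradientWithin u (closure Ω) x‖ ^ 2) Ω :=
  IntegrableOn.congr_of_eq_sdiff_zero hΩ
    ((integrableOn_hypVolume_iff hΩ.measurableSet (subset_closure.trans hB)).1 hu.finite_energy)
    fun _ hx => rho_pow_mul_energy hn hB hΩ hx

/-- Hardy with a = α/2 - 1, for which N + 2a > 0 is the assumption on α. The comparison of w with
|x|^α is used in both directions: once for the energy, once for the conclusion. -/
theorem integrableOn_sq_div (hu : IsSolution Ω α β p u) (hn : 2 ≤ n + 1) (hΩ : IsOpen Ω)
    (hB : closure Ω ⊆ Metric.ball 0 1) (hreg : HasC1Boundary Ω)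
    (hα : -((n + 1 : ℕ) : ℝ) < α - 2) :
    IntegrableOn (fun x => dist0 x ^ α * rho x ^ (n + 1 - 2) * (u x ^ 2 / ‖x‖ ^ 2)) Ω := by
  have hsub : Ω \ {0} ⊆ closure Ω \ {0} := sdiff_subset_sdiff_left subset_closure
  have hball := closure_sdiff_zero_subset hB
  obtain ⟨R, hR, hRx⟩ := exists_norm_le_lt_one hB
  obtain ⟨C, hC, hw⟩ := exists_weight_comparison (N := n + 1) hR α (n + 1 - 2)
  have hgc := continuousOn_gradientWithin_closure hΩ hreg hu.contDiffOn_closure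
  have huc := hu.contDiffOn_closure.continuousOn
  have hsc : ∀ a : ℝ, ContinuousOn (fun x : E (n + 1) => (‖x‖ ^ 2) ^ a) (closure Ω \ {0}) :=
    fun a x hx => (contDiffAt_normSq_rpow (m := 0) a hx.2).continuousAt.continuousWithinAt
  have h1 := integrableOn_hardy hΩ hB hreg hu.contDiffOn_closure hu.boundary (a := α / 2 - 1)
    (by linarith) (IntegrableOn.of_le_of_continuousOn hΩ
      ((hu.integrableOn_energy hn hΩ hB).const_mul C)
      (((hsc _).mul (hgc.norm.pow 2)).mono hsub) fun x hx => by
        rw [abs_of_nonneg (by positivity), sub_add_cancel, ← mul_assoc]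
        gcongr
        exact (hw x (hball (hsub hx)) (hRx x (hsub hx).1)).2)
  refine IntegrableOn.of_le_of_continuousOn hΩ (h1.const_mul C)
    ((((continuousOn_weight α _).mono hball).mul ((huc.pow 2).div (by fun_prop)
      fun x hx => (pow_pos (norm_pos_iff.2 hx.2) 2).ne')).mono hsub) fun x hx => ?_
  have hx1 := norm_pos_of_mem (hball (hsub hx))
  have hwp := weight_pos α (n + 1 - 2) (hball (hsub hx))
  rw [abs_of_nonneg (by positivity), Real.rpow_sub_one (by positivity)]
  calc _ ≤ C * (‖x‖ ^ 2) ^ (α / 2) * (u x ^ 2 / ‖x‖ ^ 2) :=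
        mul_le_mul_of_nonneg_right (hw x (hball (hsub hx)) (hRx x (hsub hx).1)).1 (by positivity)
    _ = _ := by ring

/-- Testing the equation with ηu, η a cutoff, gives ∫ η v|u|^p = ∫ η w|∇u|² + ∫ w u ∇η·∇u. As |∇η| ≤
C/|x|, the last term is bounded through w|∇u|² and w u²/|x|², uniformly in the cutoff. -/
theorem integrableOn_potential (hu : IsSolution Ω α β p u) (hn : 2 ≤ n + 1) (hp : 1 < p)
    (hΩ : IsOpen Ω) (hB : closure Ω ⊆ Metric.ball 0 1) (hreg : HasC1Boundary Ω)
    (hα : -((n + 1 : ℕ) : ℝ) < α - 2) :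
    IntegrableOn (fun x => dist0 x ^ β * rho x ^ (n + 1) * |u x| ^ p) Ω := by
  have hcpt := isCompact_closure_of_subset_ball hB
  have hsub : Ω \ {0} ⊆ closure Ω \ {0} := sdiff_subset_sdiff_left subset_closure
  have hball := closure_sdiff_zero_subset hB
  have hE := hu.integrableOn_energy hn hΩ hB
  have hH := hu.integrableOn_sq_div hn hΩ hB hreg hα
  have hgc := continuousOn_gradientWithin_closure hΩ hreg hu.contDiffOn_closure
  have huc := hu.contDiffOn_closure.continuousOn
  have hwc := (continuousOn_weight α (n + 1 - 2)).mono hball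
  have hvc := (continuousOn_weight β (n + 1)).mono hball
  obtain ⟨C, hC, hη⟩ := exists_norm_gradient_cutoff_le (N := n + 1)
  set g := gradientWithin u (closure Ω) with hg
  have hfc : ContinuousOn (fun x => dist0 x ^ β * rho x ^ (n + 1) * |u x| ^ p)
      (closure Ω \ {0}) := hvc.mul (huc.abs.rpow_const fun x _ => Or.inr (by linarith))
  have hec : ContinuousOn (fun x => dist0 x ^ α * rho x ^ (n + 1 - 2) * ‖g x‖ ^ 2)
      (closure Ω \ {0}) := hwc.mul (hgc.norm.pow 2)
  have hgrad : ∀ x ∈ Ω \ {0}, g =ᶠ[𝓝 x] gradient u := fun x hx => by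
    filter_upwards [hΩ.mem_nhds hx.1] with y hy using gradientWithin_closure_eq hΩ hy
  have hgd : ∀ x ∈ Ω \ {0}, ContDiffAt ℝ 1 g x := fun x hx =>
    (contDiffAt_gradient (hu.contDiffAt hΩ hx)).congr_of_eventuallyEq (hgrad x hx)
  have hcut := integral_cutoff_divergence hΩ hcpt hreg
    (F := fun x => u x • ((dist0 x ^ α * rho x ^ (n + 1 - 2)) • g x))
    (D := fun x => dist0 x ^ α * rho x ^ (n + 1 - 2) * ‖g x‖ ^ 2 -
      dist0 x ^ β * rho x ^ (n + 1) * |u x| ^ p)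
    (fun x hx => ((((hu.contDiffAt hΩ hx).of_le one_le_two).smul
      ((contDiffAt_weight α _ (hball (hsub hx))).smul (hgd x hx)))).contDiffWithinAt)
    (huc.smul (hwc.smul hgc)) (hec.sub hfc)
    (fun x hx => by
      have hwd : DifferentiableAt ℝ
          (fun y => (dist0 y ^ α * rho y ^ (n + 1 - 2)) • g y) x :=
        ((contDiffAt_weight α _ (hball (hsub hx))).smul (hgd x hx)).differentiableAt one_ne_zero
      rw [divergence_smul ((hu.contDiffAt hΩ hx).differentiableAt two_ne_zero) hwd,
        divergence_congr ((hgrad x hx).mono fun y hy => by rw [hy]),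
        hu.divergence_weight_gradient hB hx, real_inner_smul_right, (hgrad x hx).self_of_nhds,
        real_inner_self_eq_norm_sq, ← abs_rpow_sub_two_mul_self_mul_self (u x) hp]
      ring)
    (fun x hx => by simp [hu.boundary x hx])
  refine integrableOn_of_cutoff hΩ (hfc.mono hsub)
    (fun x hx => mul_nonneg (weight_pos β _ (hball (hsub hx))).le (by positivity))
    (B := ∫ x in Ω, (dist0 x ^ α * rho x ^ (n + 1 - 2) * ‖g x‖ ^ 2 +
      C * (dist0 x ^ α * rho x ^ (n + 1 - 2) * ‖g x‖ ^ 2 +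
        dist0 x ^ α * rho x ^ (n + 1 - 2) * (u x ^ 2 / ‖x‖ ^ 2))))
    (fun k => integrableOn_cutoff_mul hcpt hfc k) fun k => ?_
  obtain ⟨-, hF, heq⟩ := hcut k
  have hEk := integrableOn_cutoff_mul hcpt hec k
  have hPk := integrableOn_cutoff_mul hcpt hfc k
  simp only [mul_sub] at heq
  rw [integral_sub hEk hPk, sub_add_eq_add_sub, sub_eq_zero, ← integral_add hEk hF] at heq
  rw [← heq]
  refine integral_mono_ae (hEk.add hF) (hE.add ((hE.add hH).const_mul C))
    (ae_restrict_of_forall_mem_sdiff_zero hΩ fun x hx => ?_)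
  have hx1 := norm_pos_of_mem (hball (hsub hx))
  have hwp := weight_pos α (n + 1 - 2) (hball (hsub hx))
  refine add_le_add (mul_le_of_le_one_left (by positivity) (cutoff_le_one k x)) ?_
  set w := dist0 x ^ α * rho x ^ (n + 1 - 2)
  calc inner ℝ (gradient (cutoff k) x) (u x • w • g x)
      ≤ ‖gradient (cutoff k) x‖ * ‖u x • w • g x‖ := real_inner_le_norm _ _
    _ = (‖gradient (cutoff k) x‖ * ‖x‖) * (w * (‖g x‖ * (|u x| / ‖x‖))) := by
        rw [norm_smul, norm_smul, Real.norm_eq_abs, Real.norm_of_nonneg hwp.le]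
        field_simp
    _ ≤ C * (w * (‖g x‖ ^ 2 + (|u x| / ‖x‖) ^ 2)) := by
        gcongr
        · exact hη k x
        · nlinarith [sq_nonneg (‖g x‖ - |u x| / ‖x‖), sq_nonneg ‖g x‖, sq_nonneg (|u x| / ‖x‖)]
    _ = _ := by
        rw [div_pow, sq_abs]
        ring

end

end IsSolution

/-! ### The Pohozaev identity -/

theorem exists_abs_logDiv_le {R : ℝ} (hR : R < 1) (γ : ℝ) (k : ℕ) :
    ∃ C, 0 < C ∧ ∀ x ∈ puncturedBall N, ‖x‖ ≤ R → |logDiv γ k x| ≤ C := by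
  obtain ⟨C, hC, h⟩ := exists_bound_of_continuousOn (N := N) hR
    (P := fun q => N + γ * (q.2.1 * q.2.2) + k * (q.1 * q.2.1)) (by fun_prop)
  exact ⟨C, hC, fun x hx hxR => by rw [logDiv_eq γ k hx]; exact h x hx hxR⟩

theorem exists_norm_gradient_logDiv_le {R : ℝ} (hR : R < 1) (β : ℝ) :
    ∃ C, 0 < C ∧ ∀ x ∈ puncturedBall N, ‖x‖ ≤ R →
      ‖gradient (logDiv β N : E N → ℝ) x‖ * ‖x‖ ≤ C := by
  obtain ⟨C, hC, h⟩ := exists_bound_of_continuousOn (N := N) hR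
    (P := fun q => eulerLogDiv N β q.1 q.2.1 q.2.2) (by unfold eulerLogDiv; fun_prop)
  refine ⟨C, hC, fun x hx hxR => ?_⟩
  have hx1 := norm_pos_of_mem hx
  rw [gradient_logDiv β hx, norm_smul, norm_div, Real.norm_eq_abs,
    Real.norm_of_nonneg (by positivity)]
  refine le_of_eq_of_le ?_ (h x hx hxR)
  field_simp

theorem exists_divergence_weight_gradient_logDiv_le {R : ℝ} (hR : R < 1) (α β : ℝ) :
    ∃ C, 0 < C ∧ ∀ x ∈ puncturedBall N, ‖x‖ ≤ R →
      |divergence (fun y => (rho y ^ (N - 2) * dist0 y ^ α) •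
        gradient (logDiv β N : E N → ℝ) y) x| ≤
        C * (dist0 x ^ α * rho x ^ (N - 2) / ‖x‖ ^ 2) := by
  obtain ⟨C, hC, h⟩ := exists_bound_of_continuousOn (N := N) hR
    (P := fun q => laplacianLogDiv N α β q.1 q.2.1 q.2.2)
    (by unfold laplacianLogDiv eulerLogDiv eulerLogDiv₂; fun_prop)
  refine ⟨C, hC, fun x hx hxR => ?_⟩
  have hx1 := norm_pos_of_mem hx
  have hw := weight_pos α (N - 2) hx
  rw [divergence_weight_gradient_logDiv α β hx, abs_mul, abs_div, abs_of_pos hw,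
    abs_of_pos (by positivity : 0 < ‖x‖ ^ 2)]
  calc _ = |laplacianLogDiv N α β (‖x‖ ^ 2) (rho x) (tau x)| *
        (dist0 x ^ α * rho x ^ (N - 2) / ‖x‖ ^ 2) := by ring
    _ ≤ _ := by
      gcongr
      exact h x hx hxR

/-- The field whose divergence gives the Pohozaev identity; `g` is the gradient of `u`. -/
def pohozaevField (α β p : ℝ) (u : E N → ℝ) (g : E N → E N) (x : E N) : E N :=
  inner ℝ x (g x) • ((dist0 x ^ α * rho x ^ (N - 2)) • g x) +
    (-(1 / 2) * ‖g x‖ ^ 2) • ((dist0 x ^ α * rho x ^ (N - 2)) • x) +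
    (1 / p) • (|u x| ^ p • ((dist0 x ^ β * rho x ^ N) • x)) +
    (1 / p) • ((logDiv β N x * u x) • ((dist0 x ^ α * rho x ^ (N - 2)) • g x)) +
    (-(1 / (2 * p))) • (u x ^ 2 • ((dist0 x ^ α * rho x ^ (N - 2)) • gradient (logDiv β N) x))

theorem contDiffAt_gradient_logDiv (β : ℝ) {x : E N} (hx : x ∈ puncturedBall N) :
    ContDiffAt ℝ 1 (gradient (logDiv β N : E N → ℝ)) x :=
  contDiffAt_gradient (contDiffAt_logDiv β N hx)

theorem contDiffAt_pohozaevField {α β p : ℝ} (hp : 1 < p) {u : E N → ℝ} {g : E N → E N} {x : E N}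
    (hx : x ∈ puncturedBall N) (hu : ContDiffAt ℝ 1 u x) (hg : ContDiffAt ℝ 1 g x) :
    ContDiffAt ℝ 1 (pohozaevField α β p u g) x := by
  have hw := contDiffAt_weight (m := 1) α (N - 2) hx
  have hv := contDiffAt_weight (m := 1) β N hx
  have hf := contDiffAt_logDiv (m := 1) β N hx
  have hdf := contDiffAt_gradient_logDiv β hx
  have hup : ContDiffAt ℝ 1 (fun y => |u y| ^ p) x := (contDiff_norm_rpow hp).contDiffAt.comp x hu
  unfold pohozaevField
  refine ((((ContDiffAt.add ?_ ?_).add ?_).add ?_).add ?_)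
  · exact (contDiffAt_id.inner ℝ hg).smul (hw.smul hg)
  · exact (contDiffAt_const.mul (hg.norm_sq ℝ)).smul (hw.smul contDiffAt_id)
  · exact ContDiffAt.const_smul _ (hup.smul (hv.smul contDiffAt_id))
  · exact ContDiffAt.const_smul _ ((hf.mul hu).smul (hw.smul hg))
  · exact ContDiffAt.const_smul _ ((hu.pow 2).smul (hw.smul hdf))

theorem continuousOn_pohozaevField {α β p : ℝ} (hp : 1 < p) {u : E N → ℝ} {g : E N → E N}
    {S : Set (E N)} (hS : S ⊆ puncturedBall N) (hu : ContinuousOn u S) (hg : ContinuousOn g S) :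
    ContinuousOn (pohozaevField α β p u g) S := by
  have hw := (continuousOn_weight α (N - 2)).mono hS
  have hv := (continuousOn_weight β N).mono hS
  have hf : ContinuousOn (logDiv β N : E N → ℝ) S := fun x hx =>
    (contDiffAt_logDiv (m := 0) β N (hS hx)).continuousAt.continuousWithinAt
  have hdf : ContinuousOn (gradient (logDiv β N : E N → ℝ)) S := fun x hx =>
    (contDiffAt_gradient_logDiv β (hS hx)).continuousAt.continuousWithinAt
  have hup : ContinuousOn (fun y => |u y| ^ p) S :=
    hu.abs.rpow_const fun x _ => Or.inr (by linarith)
  unfold pohozaevField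
  refine ((((ContinuousOn.add ?_ ?_).add ?_).add ?_).add ?_)
  · exact (continuousOn_id.inner (𝕜 := ℝ) hg).smul (hw.smul hg)
  · exact (continuousOn_const.mul (hg.norm.pow 2)).smul (hw.smul continuousOn_id)
  · exact ContinuousOn.const_smul (hup.smul (hv.smul continuousOn_id)) (1 / p)
  · exact ContinuousOn.const_smul ((hf.mul hu).smul (hw.smul hg)) (1 / p)
  · exact ContinuousOn.const_smul ((hu.pow 2).smul (hw.smul hdf)) (-(1 / (2 * p)))

theorem divergence_weight_smul_id_eq_logDiv_mul (γ : ℝ) (k : ℕ) {x : E N}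
    (hx : x ∈ puncturedBall N) :
    divergence (fun y => (dist0 y ^ γ * rho y ^ k) • y) x =
      logDiv γ k x * (dist0 x ^ γ * rho x ^ k) := by
  rw [logDiv, div_mul_cancel₀ _ (weight_pos γ k hx).ne']

/-- Three cancellations: |u|^(p-2)u v (x·∇u) between the multiplier and |u|^p fields, (1/p) f v|u|^p
between the |u|^p and f u fields, and (1/p) u w ∇f·∇u between the last two. -/
theorem divergence_pohozaevField {α β p : ℝ} (hp : 1 < p) {u : E N → ℝ} {x : E N}
    (hx : x ∈ puncturedBall N) (hu : ContDiffAt ℝ 2 u x)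
    (heq : divergence (fun y => (dist0 y ^ α * rho y ^ (N - 2)) • gradient u y) x =
      -(dist0 x ^ β * rho x ^ N * (|u x| ^ (p - 2) * u x))) :
    divergence (pohozaevField α β p u (gradient u)) x =
      -(dist0 x ^ α * rho x ^ (N - 2) * ‖gradient u x‖ ^ 2 *
          (-1 + logDiv α (N - 2) x / 2 - logDiv β N x / p)) -
        1 / (2 * p) * (u x ^ 2 * divergence (fun y => (dist0 y ^ α * rho y ^ (N - 2)) •
          gradient (logDiv β N : E N → ℝ) y) x) := by
  have hp0 : p ≠ 0 := by linarith
  have hud := hu.differentiableAt two_ne_zero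
  have hgd := (contDiffAt_gradient hu).differentiableAt one_ne_zero
  have hw := (contDiffAt_weight (m := 1) α (N - 2) hx).differentiableAt one_ne_zero
  have hv := (contDiffAt_weight (m := 1) β N hx).differentiableAt one_ne_zero
  have hf := (contDiffAt_logDiv (m := 1) β N hx).differentiableAt one_ne_zero
  have hdf := (contDiffAt_gradient_logDiv β hx).differentiableAt one_ne_zero
  have hup : DifferentiableAt ℝ (fun y => |u y| ^ p) x :=
    ((hasDerivAt_abs_rpow (u x) hp).comp_hasFDerivAt x hud.hasFDerivAt).differentiableAt
  have hvx := hv.fun_smul differentiableAt_fun_id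
  have hwg := hw.fun_smul hgd
  have hwf := hw.fun_smul hdf
  have h1 : DifferentiableAt ℝ (fun y => inner ℝ y (gradient u y) •
      ((dist0 y ^ α * rho y ^ (N - 2)) • gradient u y) +
      (-(1 / 2) * ‖gradient u y‖ ^ 2) • ((dist0 y ^ α * rho y ^ (N - 2)) • y)) x :=
    ((differentiableAt_fun_id.inner ℝ hgd).fun_smul hwg).fun_add
      (((hgd.norm_sq ℝ).const_mul _).fun_smul (hw.fun_smul differentiableAt_fun_id))
  have h2 := hup.fun_smul hvx
  have h3 := (hf.fun_mul hud).fun_smul hwg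
  have h4 := (hud.fun_pow 2).fun_smul hwf
  have hdiv : divergence (pohozaevField α β p u (gradient u)) x =
      divergence (fun y => inner ℝ y (gradient u y) •
        ((dist0 y ^ α * rho y ^ (N - 2)) • gradient u y) +
        (-(1 / 2) * ‖gradient u y‖ ^ 2) • ((dist0 y ^ α * rho y ^ (N - 2)) • y)) x +
      1 / p * divergence (fun y => |u y| ^ p • ((dist0 y ^ β * rho y ^ N) • y)) x +
      1 / p * divergence (fun y => (logDiv β N y * u y) •
        ((dist0 y ^ α * rho y ^ (N - 2)) • gradient u y)) x +
      -(1 / (2 * p)) * divergence (fun y => u y ^ 2 •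
        ((dist0 y ^ α * rho y ^ (N - 2)) • gradient (logDiv β N) y)) x := by
    rw [← divergence_const_smul _ h2, ← divergence_const_smul _ h3, ← divergence_const_smul _ h4,
      ← divergence_add h1 (h2.fun_const_smul _),
      ← divergence_add (h1.fun_add (h2.fun_const_smul _)) (h3.fun_const_smul _),
      ← divergence_add ((h1.fun_add (h2.fun_const_smul _)).fun_add (h3.fun_const_smul _))
        (h4.fun_const_smul _)]
    rfl
  rw [hdiv, divergence_pohozaev hu hw, divergence_abs_rpow_smul hp hud hvx,
    divergence_mul_smul hf hud hwg, divergence_sq_smul hud hwf, heq,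
    divergence_weight_smul_id_eq_logDiv_mul β N hx,
    divergence_weight_smul_id_eq_logDiv_mul α (N - 2) hx,
    ← abs_rpow_sub_two_mul_self_mul_self (u x) hp]
  simp only [real_inner_smul_right, real_inner_self_eq_norm_sq]
  rw [real_inner_comm x (gradient u x), real_inner_comm (gradient u x) (gradient (logDiv β N) x)]
  field_simp
  ring

/-- The first three fields carry a factor |x| directly. In the fourth, f is bounded and |u||∇u|/|x|
is split by the arithmetic-geometric mean inequality; in the fifth, |∇f||x| is bounded. -/
theorem exists_norm_pohozaevField_le {R : ℝ} (hR : R < 1) (α β : ℝ) {p : ℝ} (hp : 1 < p)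
    (u : E N → ℝ) (g : E N → E N) :
    ∃ C, 0 < C ∧ ∀ x ∈ puncturedBall N, ‖x‖ ≤ R → ‖pohozaevField α β p u g x‖ / ‖x‖ ≤
      C * (dist0 x ^ α * rho x ^ (N - 2) * ‖g x‖ ^ 2 + dist0 x ^ β * rho x ^ N * |u x| ^ p +
        dist0 x ^ α * rho x ^ (N - 2) * (u x ^ 2 / ‖x‖ ^ 2)) := by
  obtain ⟨C₁, hC₁, h₁⟩ := exists_abs_logDiv_le (N := N) hR β N
  obtain ⟨C₂, hC₂, h₂⟩ := exists_norm_gradient_logDiv_le (N := N) hR β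
  have hp0 : 0 < p := by linarith
  refine ⟨2 + C₁ + C₂, by positivity, fun x hx hxR => ?_⟩
  specialize h₁ x hx hxR
  specialize h₂ x hx hxR
  have hx1 := norm_pos_of_mem hx
  have hw := weight_pos α (N - 2) hx
  have hv := weight_pos β N hx
  have hp1 : 1 / p ≤ 1 := (div_le_one hp0).2 hp.le
  have hp2 : 1 / (2 * p) ≤ 1 := (div_le_one (by positivity)).2 (by linarith)
  rw [pohozaevField]
  generalize dist0 x ^ α * rho x ^ (N - 2) = w at *
  generalize dist0 x ^ β * rho x ^ N = v at *
  generalize logDiv β N x = f at *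
  generalize gradient (logDiv β N) x = df at *
  generalize g x = z at *
  generalize u x = t at *
  have e₁ : ‖inner ℝ x z • (w • z)‖ ≤ w * ‖z‖ ^ 2 * ‖x‖ := by
    rw [norm_smul, norm_smul, Real.norm_of_nonneg hw.le]
    calc ‖inner ℝ x z‖ * (w * ‖z‖) ≤ (‖x‖ * ‖z‖) * (w * ‖z‖) := by
          gcongr
          exact norm_inner_le_norm x z
      _ = _ := by ring
  have e₂ : ‖(-(1 / 2) * ‖z‖ ^ 2) • (w • x)‖ ≤ w * ‖z‖ ^ 2 * ‖x‖ := by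
    rw [norm_smul, norm_smul, Real.norm_of_nonneg hw.le, norm_mul, norm_neg,
      Real.norm_of_nonneg (by positivity : 0 ≤ ‖z‖ ^ 2), Real.norm_of_nonneg (by norm_num)]
    have : 0 ≤ w * ‖z‖ ^ 2 * ‖x‖ := by positivity
    linarith
  have e₃ : ‖(1 / p) • (|t| ^ p • (v • x))‖ ≤ v * |t| ^ p * ‖x‖ := by
    rw [norm_smul, norm_smul, norm_smul, Real.norm_of_nonneg hv.le,
      Real.norm_of_nonneg (by positivity), Real.norm_of_nonneg (by positivity)]
    calc _ ≤ 1 * (|t| ^ p * (v * ‖x‖)) := by gcongr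
      _ = _ := by ring
  have e₄ : ‖(1 / p) • ((f * t) • (w • z))‖ ≤
      C₁ * (w * ‖z‖ ^ 2 + w * (t ^ 2 / ‖x‖ ^ 2)) * ‖x‖ := by
    rw [norm_smul, norm_smul, norm_smul, Real.norm_of_nonneg hw.le, norm_mul,
      Real.norm_of_nonneg (by positivity), Real.norm_eq_abs, Real.norm_eq_abs]
    calc _ ≤ 1 * ((C₁ * |t|) * (w * ‖z‖)) := by gcongr
      _ = C₁ * (w * (‖z‖ * (|t| / ‖x‖))) * ‖x‖ := by field_simp
      _ ≤ C₁ * (w * (‖z‖ ^ 2 + (|t| / ‖x‖) ^ 2)) * ‖x‖ := by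
        gcongr
        nlinarith [sq_nonneg (‖z‖ - |t| / ‖x‖), sq_nonneg ‖z‖, sq_nonneg (|t| / ‖x‖)]
      _ = _ := by rw [div_pow, sq_abs]; ring
  have e₅ : ‖(-(1 / (2 * p))) • (t ^ 2 • (w • df))‖ ≤
      C₂ * (w * (t ^ 2 / ‖x‖ ^ 2)) * ‖x‖ := by
    rw [norm_smul, norm_smul, norm_smul, Real.norm_of_nonneg hw.le, norm_neg,
      Real.norm_of_nonneg (by positivity), Real.norm_of_nonneg (by positivity)]
    calc _ ≤ 1 * (t ^ 2 * (w * ‖df‖)) := by gcongr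
      _ = (‖df‖ * ‖x‖) * (w * (t ^ 2 / ‖x‖ ^ 2)) * ‖x‖ := by field_simp
      _ ≤ _ := by gcongr
  rw [div_le_iff₀ hx1]
  have n₁ : 0 ≤ w * ‖z‖ ^ 2 * ‖x‖ := by positivity
  have n₂ : 0 ≤ v * |t| ^ p * ‖x‖ := by positivity
  have n₃ : 0 ≤ w * (t ^ 2 / ‖x‖ ^ 2) * ‖x‖ := by positivity
  have m₁ := mul_nonneg hC₂.le n₁
  have m₂ := mul_nonneg hC₁.le n₂
  have m₃ := mul_nonneg hC₂.le n₂
  refine (norm_add_le_of_le (norm_add_le_of_le (norm_add_le_of_le (norm_add_le_of_le e₁ e₂) e₃)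
    e₄) e₅).trans ?_
  linarith

/-- Every field containing u vanishes. With g = (g·ν)ν, the other two contribute 1 and -½ times the
same quantity. -/
theorem inner_pohozaevField_of_normal {α β p : ℝ} (hp : 1 < p) {u : E N → ℝ} {g : E N → E N}
    {x ν : E N} (hν : ‖ν‖ = 1) (hg : g x = inner ℝ (g x) ν • ν) (hu : u x = 0) :
    inner ℝ (pohozaevField α β p u g x) ν =
      1 / 2 * (dist0 x ^ α * rho x ^ (N - 2) * ‖g x‖ ^ 2 * inner ℝ x ν) := by
  have h1 : ‖g x‖ ^ 2 = inner ℝ (g x) ν ^ 2 := by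
    conv_lhs => rw [hg]
    rw [norm_smul, hν, mul_one, Real.norm_eq_abs, sq_abs]
  have h2 : inner ℝ x (g x) = inner ℝ (g x) ν * inner ℝ x ν := by
    conv_lhs => rw [hg]
    rw [real_inner_smul_right]
  simp only [pohozaevField, hu, abs_zero, Real.zero_rpow (by linarith : p ≠ 0), inner_add_left,
    real_inner_smul_left, h1, h2]
  ring

namespace IsSolution

variable {Ω : Set (E (n + 1))} {α β p : ℝ} {u : E (n + 1) → ℝ}

theorem continuousOn_boundaryIntegrand (hu : IsSolution Ω α β p u) (hΩ : IsOpen Ω)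
    (hB : closure Ω ⊆ Metric.ball 0 1) (hreg : HasC1Boundary Ω) (h0 : 0 ∉ frontier Ω) :
    ContinuousOn (boundaryIntegrand Ω α u) (frontier Ω) := by
  have hfr : frontier Ω ⊆ closure Ω \ {0} := fun x hx =>
    ⟨frontier_subset_closure hx, fun h => h0 (h ▸ hx)⟩
  have hw := (continuousOn_weight α (n + 1 - 2)).mono (hfr.trans (closure_sdiff_zero_subset hB))
  have hg := (continuousOn_gradientWithin_closure hΩ hreg hu.contDiffOn_closure).mono hfr
  exact (hw.mul (hg.norm.pow 2)).mul
    (continuousOn_id.inner (𝕜 := ℝ) (continuousOn_outwardNormal hΩ hreg))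

theorem rho_pow_mul_gradientIntegrand (hn : 2 ≤ n + 1) (hB : closure Ω ⊆ Metric.ball 0 1)
    (hΩ : IsOpen Ω) {x : E (n + 1)} (hx : x ∈ Ω \ {0}) :
    rho x ^ (n + 1) * gradientIntegrand α β p u x =
      dist0 x ^ α * rho x ^ (n + 1 - 2) * ‖gradientWithin u (closure Ω) x‖ ^ 2 *
        (-1 + logDiv α (n + 1 - 2) x / 2 - logDiv β (n + 1) x / p) := by
  rw [gradientIntegrand, ← mul_assoc, rho_pow_mul_energy hn hB hΩ hx]

theorem rho_pow_mul_zeroOrderIntegrand (hB : closure Ω ⊆ Metric.ball 0 1) {x : E (n + 1)}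
    (hx : x ∈ Ω \ {0}) :
    rho x ^ (n + 1) * zeroOrderIntegrand α β u x =
      u x ^ 2 * divergence (fun y => (rho y ^ (n + 1 - 2) * dist0 y ^ α) •
        gradient (logDiv β (n + 1) : E (n + 1) → ℝ) y) x := by
  have hρ := rho_pos (x := x) ⟨hB (subset_closure hx.1), hx.2⟩
  rw [zeroOrderIntegrand, hypLaplacian]
  field_simp

theorem integrableOn_gradientIntegrand (hu : IsSolution Ω α β p u) (hn : 2 ≤ n + 1) (hp : 1 < p)
    (hΩ : IsOpen Ω) (hB : closure Ω ⊆ Metric.ball 0 1) (hreg : HasC1Boundary Ω) :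
    IntegrableOn (fun x => dist0 x ^ α * rho x ^ (n + 1 - 2) *
      ‖gradientWithin u (closure Ω) x‖ ^ 2 *
        (-1 + logDiv α (n + 1 - 2) x / 2 - logDiv β (n + 1) x / p)) Ω := by
  have hsub : Ω \ {0} ⊆ closure Ω \ {0} := sdiff_subset_sdiff_left subset_closure
  have hball := closure_sdiff_zero_subset hB
  obtain ⟨R, hR, hRx⟩ := exists_norm_le_lt_one hB
  obtain ⟨C₁, hC₁, h₁⟩ := exists_abs_logDiv_le (N := n + 1) hR α (n + 1 - 2)
  obtain ⟨C₂, hC₂, h₂⟩ := exists_abs_logDiv_le (N := n + 1) hR β (n + 1)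
  have hlc : ∀ (γ : ℝ) (k : ℕ), ContinuousOn (logDiv γ k : E (n + 1) → ℝ) (closure Ω \ {0}) :=
    fun γ k x hx => (contDiffAt_logDiv (m := 0) γ k (hball hx)).continuousAt.continuousWithinAt
  have hgc := continuousOn_gradientWithin_closure hΩ hreg hu.contDiffOn_closure
  have hwc := (continuousOn_weight α (n + 1 - 2)).mono hball
  refine IntegrableOn.of_le_of_continuousOn hΩ
    ((hu.integrableOn_energy hn hΩ hB).const_mul (1 + C₁ + C₂))
    (((hwc.mul (hgc.norm.pow 2)).mul ((continuousOn_const.add ((hlc _ _).div_const 2)).sub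
      ((hlc _ _).div_const p))).mono hsub) fun x hx => ?_
  have hw := weight_pos α (n + 1 - 2) (hball (hsub hx))
  have a₁ := abs_le.1 (h₁ x (hball (hsub hx)) (hRx x (hsub hx).1))
  have a₂ := h₂ x (hball (hsub hx)) (hRx x (hsub hx).1)
  have a₃ : |logDiv β (n + 1) x / p| ≤ C₂ := by
    rw [abs_div, abs_of_pos (by linarith : 0 < p)]
    exact (div_le_self (abs_nonneg _) hp.le).trans a₂
  have a₄ := abs_le.1 a₃
  rw [abs_mul, abs_of_nonneg (by positivity), mul_comm]
  gcongr
  rw [abs_le]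
  constructor <;> linarith

theorem integrableOn_zeroOrderIntegrand (hu : IsSolution Ω α β p u) (hn : 2 ≤ n + 1)
    (hΩ : IsOpen Ω) (hB : closure Ω ⊆ Metric.ball 0 1) (hreg : HasC1Boundary Ω)
    (hα : -((n + 1 : ℕ) : ℝ) < α - 2) :
    IntegrableOn (fun x => u x ^ 2 * divergence (fun y => (rho y ^ (n + 1 - 2) * dist0 y ^ α) •
        gradient (logDiv β (n + 1) : E (n + 1) → ℝ) y) x) Ω := by
  have hsub : Ω \ {0} ⊆ closure Ω \ {0} := sdiff_subset_sdiff_left subset_closure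
  have hball := closure_sdiff_zero_subset hB
  obtain ⟨R, hR, hRx⟩ := exists_norm_le_lt_one hB
  obtain ⟨C, hC, h⟩ := exists_divergence_weight_gradient_logDiv_le (N := n + 1) hR α β
  have hdc : ContinuousOn (divergence fun y => (rho y ^ (n + 1 - 2) * dist0 y ^ α) •
      gradient (logDiv β (n + 1) : E (n + 1) → ℝ) y) (puncturedBall (n + 1)) := by
    refine continuousOn_divergence isOpen_puncturedBall fun x hx => ?_
    simp only [mul_comm (rho _ ^ (n + 1 - 2))]
    exact ((contDiffAt_weight α _ hx).smul (contDiffAt_gradient_logDiv β hx)).contDiffWithinAt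
  refine IntegrableOn.of_le_of_continuousOn hΩ
    ((hu.integrableOn_sq_div hn hΩ hB hreg hα).const_mul C)
    (((hu.contDiffOn_closure.continuousOn.pow 2).mul (hdc.mono hball)).mono hsub) fun x hx => ?_
  rw [abs_mul, abs_of_nonneg (sq_nonneg _)]
  calc _ ≤ u x ^ 2 * (C * (dist0 x ^ α * rho x ^ (n + 1 - 2) / ‖x‖ ^ 2)) := by
        gcongr
        exact h x (hball (hsub hx)) (hRx x (hsub hx).1)
    _ = _ := by ring

theorem pohozaev_identity (hu : IsSolution Ω α β p u) (hn : 2 ≤ n + 1) (hp : 1 < p)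
    (hα : -((n + 1 : ℕ) : ℝ) < α - 2) (hΩ : IsOpen Ω) (hB : closure Ω ⊆ Metric.ball 0 1)
    (hreg : HasC1Boundary Ω) (h0 : 0 ∉ frontier Ω) :
    IntegrableOn (boundaryIntegrand Ω α u) (frontier Ω) μHE[n] ∧
    IntegrableOn (gradientIntegrand α β p u) Ω (hypVolume (n + 1)) ∧
    IntegrableOn (zeroOrderIntegrand α β u) Ω (hypVolume (n + 1)) ∧
    -(1 / 2) * ∫ x in frontier Ω, boundaryIntegrand Ω α u x ∂μHE[n] =
      (∫ x in Ω, gradientIntegrand α β p u x ∂(hypVolume (n + 1))) +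
        1 / (2 * p) * ∫ x in Ω, zeroOrderIntegrand α β u x ∂(hypVolume (n + 1)) := by
  have hcpt := isCompact_closure_of_subset_ball hB
  have hsub : Ω \ {0} ⊆ closure Ω \ {0} := sdiff_subset_sdiff_left subset_closure
  have hball := closure_sdiff_zero_subset hB
  have hΩB : Ω ⊆ Metric.ball 0 1 := subset_closure.trans hB
  have hG : IntegrableOn (fun x => rho x ^ (n + 1) * gradientIntegrand α β p u x) Ω :=
    IntegrableOn.congr_of_eq_sdiff_zero hΩ (hu.integrableOn_gradientIntegrand hn hp hΩ hB hreg)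
      fun x hx => (rho_pow_mul_gradientIntegrand hn hB hΩ hx).symm
  have hZ : IntegrableOn (fun x => rho x ^ (n + 1) * zeroOrderIntegrand α β u x) Ω :=
    IntegrableOn.congr_of_eq_sdiff_zero hΩ (hu.integrableOn_zeroOrderIntegrand hn hΩ hB hreg hα)
      fun x hx => (rho_pow_mul_zeroOrderIntegrand hB hx).symm
  refine ⟨integrableOn_frontier hΩ hcpt hreg
    (hu.continuousOn_boundaryIntegrand hΩ hB hreg h0),
    (integrableOn_hypVolume_iff hΩ.measurableSet hΩB).2 hG,
    (integrableOn_hypVolume_iff hΩ.measurableSet hΩB).2 hZ, ?_⟩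
  rw [setIntegral_hypVolume hΩ.measurableSet hΩB, setIntegral_hypVolume hΩ.measurableSet hΩB]
  -- The gradient relative to the closure agrees with ∇u in Ω and makes F continuous up to the
  -- boundary.
  set F := pohozaevField α β p u (gradientWithin u (closure Ω)) with hF
  have hgrad : ∀ x ∈ Ω \ {0}, gradientWithin u (closure Ω) =ᶠ[𝓝 x] gradient u := fun x hx => by
    filter_upwards [hΩ.mem_nhds hx.1] with y hy using gradientWithin_closure_eq hΩ hy
  have hdiv : ∀ x ∈ Ω \ {0}, -(rho x ^ (n + 1) * gradientIntegrand α β p u x) -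
      1 / (2 * p) * (rho x ^ (n + 1) * zeroOrderIntegrand α β u x) = divergence F x := by
    intro x hx
    rw [divergence_congr (G := pohozaevField α β p u (gradient u))
        ((hgrad x hx).mono fun y hy => by simp only [hF, pohozaevField, hy]),
      divergence_pohozaevField hp (hball (hsub hx)) (hu.contDiffAt hΩ hx)
        (hu.divergence_weight_gradient hB hx),
      rho_pow_mul_gradientIntegrand hn hB hΩ hx, rho_pow_mul_zeroOrderIntegrand hB hx,
      (hgrad x hx).self_of_nhds]
    simp only [mul_comm (rho _ ^ (n + 1 - 2))]
  have hFd : ContDiffOn ℝ 1 F (Ω \ {0}) := fun x hx =>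
    (contDiffAt_pohozaevField hp (hball (hsub hx)) ((hu.contDiffAt hΩ hx).of_le one_le_two)
      ((contDiffAt_gradient (hu.contDiffAt hΩ hx)).congr_of_eventuallyEq
        (hgrad x hx))).contDiffWithinAt
  have hFc : ContinuousOn F (closure Ω \ {0}) :=
    continuousOn_pohozaevField hp hball hu.contDiffOn_closure.continuousOn
      (continuousOn_gradientWithin_closure hΩ hreg hu.contDiffOn_closure)
  have hFi : IntegrableOn (fun x => ‖F x‖ / ‖x‖) Ω := by
    obtain ⟨R, hR, hRx⟩ := exists_norm_le_lt_one hB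
    obtain ⟨C, hC, h⟩ := exists_norm_pohozaevField_le hR α β hp u (gradientWithin u (closure Ω))
    refine IntegrableOn.of_le_of_continuousOn hΩ
      ((((hu.integrableOn_energy hn hΩ hB).add
        (hu.integrableOn_potential hn hp hΩ hB hreg hα)).add
        (hu.integrableOn_sq_div hn hΩ hB hreg hα)).const_mul C)
      ((hFc.mono hsub).norm.div continuousOn_id.norm fun x hx => (norm_pos_iff.2 hx.2).ne')
      fun x hx => ?_
    rw [abs_of_nonneg (by positivity)]
    exact h x (hball (hsub hx)) (hRx x (hsub hx).1)
  have hmain := integral_divergence_eq_of_punctured hΩ hcpt hreg h0 hFd hFc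
    (IntegrableOn.congr_of_eq_sdiff_zero hΩ (hG.neg.sub (hZ.const_mul (1 / (2 * p)))) hdiv) hFi
  rw [← integral_congr_ae (ae_restrict_of_forall_mem_sdiff_zero hΩ hdiv),
    integral_sub hG.fun_neg (hZ.const_mul _), integral_neg, integral_const_mul] at hmain
  have hbd : ∫ x in frontier Ω, inner ℝ (F x) (outwardNormal Ω x) ∂μHE[n] =
      1 / 2 * ∫ x in frontier Ω, boundaryIntegrand Ω α u x ∂μHE[n] := by
    rw [← integral_const_mul]
    refine setIntegral_congr_fun isClosed_frontier.measurableSet fun x hx => ?_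
    have hx0 : x ≠ 0 := fun h => h0 (h ▸ hx)
    have hd : DifferentiableWithinAt ℝ u (closure Ω) x :=
      ((hu.contDiffOn_closure.differentiableOn one_ne_zero) x
        ⟨frontier_subset_closure hx, hx0⟩).mono_of_mem_nhdsWithin (sdiff_zero_mem_nhdsWithin hx0)
    exact inner_pohozaevField_of_normal hp (norm_outwardNormal hΩ hreg hx)
      (gradientWithin_eq_inner_smul_outwardNormal hΩ hreg hu.boundary hx hd) (hu.boundary x hx)
  linarith

end IsSolution

end HypPohozaev

end

open HypPohozaev in
theorem proposition6p1 (N : ℕ) (hN : 2 ≤ N) (α β p : ℝ) (hα : -(N : ℝ) < α - 2) (hp : 1 < p)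
    (Ω : Set (EuclideanSpace ℝ (Fin N))) (hΩ : IsOpen Ω)
    (hΩB : closure Ω ⊆ Metric.ball 0 1) (hΩreg : HasC1Boundary Ω) (h0 : 0 ∉ frontier Ω)
    (u : EuclideanSpace ℝ (Fin N) → ℝ) (hu : IsSolution Ω α β p u) :
    IntegrableOn (boundaryIntegrand Ω α u) (frontier Ω) (μHE[N - 1]) ∧
    IntegrableOn (gradientIntegrand α β p u) Ω (hypVolume N) ∧
    IntegrableOn (zeroOrderIntegrand α β u) Ω (hypVolume N) ∧
    -(1 / 2) * ∫ x in frontier Ω, boundaryIntegrand Ω α u x ∂(μHE[N - 1]) =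
      (∫ x in Ω, gradientIntegrand α β p u x ∂(hypVolume N)) +
        1 / (2 * p) * ∫ x in Ω, zeroOrderIntegrand α β u x ∂(hypVolume N) := by
  -- After this substitution the boundary dimension N - 1 reduces to n.
  obtain ⟨n, rfl⟩ : ∃ n, N = n + 1 := ⟨N - 1, by omega⟩
  exact hu.pohozaev_identity hN hp hα hΩ hΩB hΩreg h0
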